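/- Let $\Omega\subset\mathbb{R}^d$ be a bounded open set (for example a bounded Lipschitz domain), $T>0$, $Q=\Omega\times(0,T)$, $\omega=2\pi/T$, and let $\sigma,\nu$ be measurable functions on $\Omega$ with $0<\underline\sigma\le\sigma(x)\le\overline\sigma$ and $0<\underline\nu\le\nu(x)\le\overline\nu$ for $x\in\Omega$. Let $\lambda>0$, $y_d\in L^2(Q)$, $\mu_1=\frac{1}{\sqrt2}\min\{\underline\nu,\underline\sigma\}$, and let $C_F>0$ be a constant in Friedrichs' inequality $\|w\|_{L^2(\Omega)}\le C_F\|\nabla w\|_{L^2(\Omega)}$, $w\in H^1_0(\Omega)$. Norms without subscript are those of $L^2(Q)$, and $\nabla$, $\nabla\cdot$ act in $x$. For $u\in L^2(Q)$ and $k\ge1$ let $u_k^c=\frac2T\int_0^Tu\cos(k\omega t)\,dt$, $u_k^s=\frac2T\int_0^Tu\sin(k\omega t)\,dt$, $\boldsymbol u_k=(u_k^c,u_k^s)$, $\boldsymbol u_k^\perp=(-u_k^s,u_k^c)$, $\|\partial_t^{1/2}u\|^2=\frac T2\sum_{k\ge1}k\omega\|\boldsymbol u_k\|_{L^2(\Omega)}^2$,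 and $|u|_{1,1/2}^2=\|\nabla u\|^2+\|\partial_t^{1/2}u\|^2$. Let $H^{1,0}_0(Q)$ be the space of all $u\in L^2(Q)$ with $\nabla u\in[L^2(Q)]^d$ and $u=0$ on $\partial\Omega\times(0,T)$, that is, limits in the norm $(\|u\|^2+\|\nabla u\|^2)^{1/2}$ of smooth functions vanishing near the lateral boundary. Put $H^{1,1/2}_{0,per}(Q)=\{u\in H^{1,0}_0(Q):\|\partial_t^{1/2}u\|<\infty\}$, $H^{1,1}_{0,per}(Q)=\{u\in H^{1,0}_0(Q):\partial_tu\in L^2(Q),\ u(0)=u(T)\}$ and $H(\mathrm{div},Q)=\{\tau\in[L^2(Q)]^d:\nabla\cdot\tau\in L^2(Q)\}$. Let $$b(y,q)=\tfrac T2\sum_{k\ge1}k\omega\int_\Omega\sigma\,\boldsymbol y_k\cdot\boldsymbol q_k^\perp\,dx,\qquad a(y,q)=\int_Q\nu\nabla y\cdot\nabla q\,dx\,dt+b(y,q),$$ where $b(y,q)=\int_Q\sigma\,\partial_ty\,q\,dx\,dt$ if $y\in H^{1,1}_{0,per}(Q)$. For a control $v\in L^2(Q)$, the state $y(v)\in H^{1,1/2}_{0,per}(Q)$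 is the weak solution of $\sigma\partial_ty-\nabla\cdot(\nu\nabla y)=v$ in $Q$, $y=0$ on $\partial\Omega\times(0,T)$, $y(0)=y(T)$, that is, $a(y(v),q)=\int_Qv\,q$ for all $q\in H^{1,1/2}_{0,per}(Q)$. Let $J(y,v)=\frac12\|y-y_d\|^2+\frac\lambda2\|v\|^2$. Set $$R_1(\eta,\tau,v)=\sigma\partial_t\eta-\nabla\cdot\tau-v,\quad R_2(\eta,\tau)=\tau-\nu\nabla\eta,\quad R_3(\zeta,\rho,\eta)=\eta-y_d+\nabla\cdot\rho+\sigma\partial_t\zeta,\quad R_4(\zeta,\rho)=\rho-\nu\nabla\zeta,$$ $$J^\oplus(\alpha,\beta;\eta,\tau,v)=\tfrac{1+\alpha}2\|\eta-y_d\|^2+\gamma\Big(\|R_2(\eta,\tau)\|^2+\tfrac{C_F^2}{\beta}\|R_1(\eta,\tau,v)\|^2\Big)+\tfrac\lambda2\|v\|^2,\qquad\gamma=\tfrac{(1+\alpha)(1+\beta)C_F^2}{2\alpha\mu_1^2},$$ $$\begin{aligned}J^\ominus(\eta,\zeta,\tau,\rho)={}&\tfrac12\|\eta-y_d\|^2+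\tfrac1{2\lambda}\|\zeta\|^2-\int_Q\big(\nu\nabla\eta\cdot\nabla\zeta+\sigma\partial_t\eta\,\zeta+\lambda^{-1}\zeta^2\big)\,dx\,dt\\&-\tfrac{C_F^2}{\mu_1^2\lambda}\big(C_F\|R_3(\zeta,\rho,\eta)\|+\|R_4(\zeta,\rho)\|\big)^2\\&-\tfrac1{\mu_1}\big(C_F\|R_1(\eta,\tau,-\lambda^{-1}\zeta)\|+\|R_2(\eta,\tau)\|\big)\big(C_F\|R_3(\zeta,\rho,\eta)\|+\|R_4(\zeta,\rho)\|\big),\end{aligned}$$ $$M_1^\oplus(\alpha,\beta;\eta,\zeta,\tau,\rho,v)=J^\oplus(\alpha,\beta;\eta,\tau,v)-J^\ominus(\eta,\zeta,\tau,\rho)+\tfrac{3\lambda}{4C_F^2}\big(C_F\|R_1(\eta,\tau,v)\|+\|R_2(\eta,\tau)\|\big)^2.$$ Then: (a) Every $v\in L^2(Q)$ has a unique state $y(v)$; there is a unique optimal control $u$, i.e. minimizer of $v\mapsto J(y(v),v)$ over $L^2(Q)$. A pair $(y,u)$ consists of the optimal control and its state if and only if $y$ and $p=-\lambda u$ lie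 in $H^{1,1/2}_{0,per}(Q)$ and solve the optimality system $$\int_Qy\,z-\int_Q\nu\nabla p\cdot\nabla z+b(p,z)=\int_Qy_d\,z,\qquad a(y,q)+\lambda^{-1}\int_Qp\,q=0\qquad\forall z,q\in H^{1,1/2}_{0,per}(Q).$$ (b) For all $v\in L^2(Q)$, $\alpha,\beta>0$, $\eta,\zeta\in H^{1,1}_{0,per}(Q)$ and $\tau,\rho\in H(\mathrm{div},Q)$, with $u$ the optimal control, $$|||u-v|||_1^2:=\tfrac12\|y(u)-y(v)\|^2+\tfrac{\lambda\mu_1^2}{2C_F^2}|y(u)-y(v)|_{1,1/2}^2\le M_1^\oplus(\alpha,\beta;\eta,\zeta,\tau,\rho,v),$$ and the majorant has the expanded form $$\begin{aligned}M_1^\oplus={}&\tfrac\alpha2\|\eta-y_d\|^2+\gamma\Big(\|R_2(\eta,\tau)\|^2+\tfrac{C_F^2}\beta\|R_1(\eta,\tau,v)\|^2\Big)+\tfrac\lambda2\|v\|^2-\tfrac1{2\lambda}\|\zeta\|^2\\&+\int_Q\big(\nu\nabla\eta\cdot\nabla\zeta+\sigma\partial_t\eta\,\zeta+\lambda^{-1}\zeta^2\big)\,dx\,dt+\tfrac{C_F^2}{\mu_1^2\lambda}\big(C_F\|R_3(\zeta,\rho,\eta)\|+\|R_4(\zeta,\rho)\|\big)^2\\&+\tfrac1{\mu_1}\big(C_F\|R_1(\eta,\tau,-\lambda^{-1}\zeta)\|+\|R_2(\eta,\tau)\|\big)\big(C_F\|R_3(\zeta,\rho,\eta)\|+\|R_4(\zeta,\rho)\|\big)\\&+\tfrac{3\lambda}{4C_F^2}\big(C_F\|R_1(\eta,\tau,v)\|+\|R_2(\eta,\tau)\|\big)^2.\end{aligned}$$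 (c) The infimum of $M_1^\oplus$ over all $\alpha,\beta>0$, $\eta,\zeta\in H^{1,1}_{0,per}(Q)$, $\tau,\rho\in H(\mathrm{div},Q)$ and $v\in L^2(Q)$ is $0$. It is reached at $v=u$, $\eta=y(u)$, $\zeta=p(u)=-\lambda u$, $\tau=\nu\nabla y(u)$, $\rho=\nu\nabla p(u)$ as $\alpha\to0$: these functions are admissible, and for every $\beta>0$ the majorant there equals $\frac\alpha2\|y(u)-y_d\|^2$, which tends to $0$ as $\alpha\to0^+$. -/

import Mathlib

open MeasureTheory Set Filter Topology
open scoped ContDiff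

noncomputable section

namespace PeriodicOCP

/-- The Euclidean space in which the spatial domain lies. -/
abbrev E (d : ℕ) := EuclideanSpace ℝ (Fin d)

/-- The space-time cylinder `Q = Ω × (0,T)`. -/
def cyl {d : ℕ} (Ω : Set (E d)) (T : ℝ) : Set (E d × ℝ) := Ω ×ˢ Ioo 0 T

/-- Lebesgue measure on `Q`. -/
abbrev muQ {d : ℕ} (Ω : Set (E d)) (T : ℝ) : Measure (E d × ℝ) := volume.restrict (cyl Ω T)

/-- `L²(Q)`. -/
abbrev L2Q {d : ℕ} (Ω : Set (E d)) (T : ℝ) := Lp ℝ 2 (muQ Ω T)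

/-- `[L²(Q)]^d`. -/
abbrev L2Qvec {d : ℕ} (Ω : Set (E d)) (T : ℝ) := Lp (E d) 2 (muQ Ω T)

/-- The `L²(Q)` norm of a scalar or vector function (it is only applied to square integrable
functions). -/
def normQ {d : ℕ} (Ω : Set (E d)) (T : ℝ) {F : Type*} [NormedAddCommGroup F]
    (f : E d × ℝ → F) : ℝ := (eLpNorm f 2 (muQ Ω T)).toReal

/-! ### Weak derivatives in the cylinder -/

/-- Spatial gradient of a smooth function on space-time. -/
def spaceGrad {d : ℕ} (φ : E d × ℝ → ℝ) (z : E d × ℝ) : E d :=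
  gradient (fun x => φ (x, z.2)) z.1

/-- Time derivative of a smooth function on space-time. -/
def timeDeriv {d : ℕ} (φ : E d × ℝ → ℝ) (z : E d × ℝ) : ℝ :=
  deriv (fun t => φ (z.1, t)) z.2

/-- `φ ∈ C_c^∞(Q)`. -/
def IsTest {d : ℕ} (Ω : Set (E d)) (T : ℝ) (φ : E d × ℝ → ℝ) : Prop :=
  ContDiff ℝ ∞ φ ∧ HasCompactSupport φ ∧ tsupport φ ⊆ cyl Ω T

/-- `g` is the weak spatial gradient of `u` in `Q`. -/
def HasWeakGrad {d : ℕ} (Ω : Set (E d)) (T : ℝ) (u : L2Q Ω T) (g : L2Qvec Ω T) : Prop :=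
  ∀ φ : E d × ℝ → ℝ, IsTest Ω T φ →
    ∫ z, u z • spaceGrad φ z ∂(muQ Ω T) = - ∫ z, φ z • g z ∂(muQ Ω T)

/-- `w` is the weak time derivative of `u` in `Q`. -/
def HasWeakTimeDeriv {d : ℕ} (Ω : Set (E d)) (T : ℝ) (u w : L2Q Ω T) : Prop :=
  ∀ φ : E d × ℝ → ℝ, IsTest Ω T φ →
    ∫ z, u z * timeDeriv φ z ∂(muQ Ω T) = - ∫ z, w z * φ z ∂(muQ Ω T)

/-- `w` is the weak spatial divergence of `τ` in `Q`. -/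
def HasWeakDiv {d : ℕ} (Ω : Set (E d)) (T : ℝ) (τ : L2Qvec Ω T) (w : L2Q Ω T) : Prop :=
  ∀ φ : E d × ℝ → ℝ, IsTest Ω T φ →
    ∫ z, inner ℝ (τ z) (spaceGrad φ z) ∂(muQ Ω T) = - ∫ z, w z * φ z ∂(muQ Ω T)

open Classical in
/-- `∇u` (zero if `u` has no weak gradient in `[L²(Q)]^d`). -/
def grad {d : ℕ} {Ω : Set (E d)} {T : ℝ} (u : L2Q Ω T) : L2Qvec Ω T :=
  if h : ∃ g, HasWeakGrad Ω T u g then h.choose else 0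

open Classical in
/-- `∂ₜu` (zero if `u` has no weak time derivative in `L²(Q)`). -/
def dt {d : ℕ} {Ω : Set (E d)} {T : ℝ} (u : L2Q Ω T) : L2Q Ω T :=
  if h : ∃ w, HasWeakTimeDeriv Ω T u w then h.choose else 0

open Classical in
/-- `∇·τ` (zero if `τ` has no weak divergence in `L²(Q)`). -/
def dvg {d : ℕ} {Ω : Set (E d)} {T : ℝ} (τ : L2Qvec Ω T) : L2Q Ω T :=
  if h : ∃ w, HasWeakDiv Ω T τ w then h.choose else 0

/-! ### Function spaces -/

/-- Smooth functions on space-time that vanish near the lateral boundary `∂Ω × ℝ`. -/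
def IsLateralTest {d : ℕ} (Ω : Set (E d)) (φ : E d × ℝ → ℝ) : Prop :=
  ContDiff ℝ ∞ φ ∧ ∃ K : Set (E d), IsCompact K ∧ K ⊆ Ω ∧ ∀ x ∉ K, ∀ t, φ (x, t) = 0

/-- `u ∈ H^{1,0}_0(Q)`: `u` has a weak gradient in `L²`, and `u = 0` on the lateral surface, i.e.
`u` is a limit, in the `H^{1,0}(Q)` norm, of smooth functions vanishing near that surface. -/
def MemH10Zero {d : ℕ} (Ω : Set (E d)) (T : ℝ) (u : L2Q Ω T) : Prop :=
  (∃ g, HasWeakGrad Ω T u g) ∧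
    ∀ ε : ℝ, 0 < ε → ∃ φ : E d × ℝ → ℝ, IsLateralTest Ω φ ∧
      normQ Ω T (fun z => u z - φ z) < ε ∧
      normQ Ω T (fun z => grad u z - spaceGrad φ z) < ε

/-- `u(0) = u(T)`: the representative of `u` that is continuous in time on `[0,T]` takes the same
values at `0` and at `T`, for almost every `x ∈ Ω`. -/
def IsTimePeriodic {d : ℕ} (Ω : Set (E d)) (T : ℝ) (u : L2Q Ω T) : Prop :=
  ∃ U : E d × ℝ → ℝ, (∀ᵐ z ∂(muQ Ω T), u z = U z) ∧
    ∀ᵐ x ∂(volume.restrict Ω),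
      ContinuousOn (fun t => U (x, t)) (Icc 0 T) ∧ U (x, 0) = U (x, T)

/-- `u ∈ H^{1,1}_{0,per}(Q)`. -/
def MemH11ZeroPer {d : ℕ} (Ω : Set (E d)) (T : ℝ) (u : L2Q Ω T) : Prop :=
  MemH10Zero Ω T u ∧ (∃ w, HasWeakTimeDeriv Ω T u w) ∧ IsTimePeriodic Ω T u

/-- `τ ∈ H(div,Q)`. -/
def MemHdiv {d : ℕ} (Ω : Set (E d)) (T : ℝ) (τ : L2Qvec Ω T) : Prop :=
  ∃ w, HasWeakDiv Ω T τ w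

/-! ### Fourier series in time -/

/-- The frequency `ω = 2π/T`. -/
def freq (T : ℝ) : ℝ := 2 * Real.pi / T

/-- The Fourier cosine coefficient `u_k^c` (`k ≥ 1`). -/
def coefC {d : ℕ} {Ω : Set (E d)} {T : ℝ} (u : L2Q Ω T) (k : ℕ) (x : E d) : ℝ :=
  2 / T * ∫ t in (0 : ℝ)..T, u (x, t) * Real.cos (k * freq T * t)

/-- The Fourier sine coefficient `u_k^s` (`k ≥ 1`). -/
def coefS {d : ℕ} {Ω : Set (E d)} {T : ℝ} (u : L2Q Ω T) (k : ℕ) (x : E d) : ℝ :=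
  2 / T * ∫ t in (0 : ℝ)..T, u (x, t) * Real.sin (k * freq T * t)

/-- The term `k ω ‖(u_k^c, u_k^s)‖²_Ω`; it vanishes for `k = 0`. -/
def halfTerm {d : ℕ} {Ω : Set (E d)} {T : ℝ} (u : L2Q Ω T) (k : ℕ) : ℝ :=
  k * freq T * ∫ x in Ω, (coefC u k x ^ 2 + coefS u k x ^ 2)

/-- `‖∂ₜ^{1/2} u‖² < ∞`. -/
def MemHalf {d : ℕ} (Ω : Set (E d)) (T : ℝ) (u : L2Q Ω T) : Prop :=
  Summable (halfTerm u)

/-- `‖∂ₜ^{1/2} u‖²`. -/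
def halfNormSq {d : ℕ} {Ω : Set (E d)} {T : ℝ} (u : L2Q Ω T) : ℝ :=
  T / 2 * ∑' k : ℕ, halfTerm u k

/-- `u ∈ H^{1,1/2}_{0,per}(Q)`. -/
def MemH1half {d : ℕ} (Ω : Set (E d)) (T : ℝ) (u : L2Q Ω T) : Prop :=
  MemH10Zero Ω T u ∧ MemHalf Ω T u

/-- `|u|²_{1,1/2} = ‖∇u‖² + ‖∂ₜ^{1/2} u‖²`. -/
def semiSq {d : ℕ} {Ω : Set (E d)} {T : ℝ} (u : L2Q Ω T) : ℝ :=
  ‖grad u‖ ^ 2 + halfNormSq u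

/-- `⟨σ ∂ₜ^{1/2} y, ∂ₜ^{1/2} q^⊥⟩ = (T/2) ∑_k k ω ⟨σ y_k, q_k^⊥⟩_Ω` with `y_k = (y_k^c, y_k^s)` and
`q_k^⊥ = (-q_k^s, q_k^c)`; it equals `⟨σ ∂ₜ y, q⟩` when `∂ₜ y ∈ L²(Q)` and `y(0) = y(T)`. -/
def halfForm {d : ℕ} {Ω : Set (E d)} {T : ℝ} (σ : E d → ℝ) (y q : L2Q Ω T) : ℝ :=
  T / 2 * ∑' k : ℕ, k * freq T *
    ∫ x in Ω, σ x * (coefC y k x * (-(coefS q k x)) + coefS y k x * coefC q k x)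

/-- `∫_Q ν ∇y · ∇q`. -/
def gradForm {d : ℕ} {Ω : Set (E d)} {T : ℝ} (ν : E d → ℝ) (y q : L2Q Ω T) : ℝ :=
  ∫ z, ν z.1 * inner ℝ (grad y z) (grad q z) ∂(muQ Ω T)

/-! ### The optimal control problem -/

/-- `y = y(v)`: `y ∈ H^{1,1/2}_{0,per}(Q)` is the weak solution of
`σ ∂ₜy - ∇·(ν∇y) = v` in `Q`, `y = 0` on the lateral surface, `y(0) = y(T)`. -/
def IsState {d : ℕ} {Ω : Set (E d)} {T : ℝ} (σ ν : E d → ℝ) (y v : L2Q Ω T) : Prop :=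
  MemH1half Ω T y ∧ ∀ q : L2Q Ω T, MemH1half Ω T q →
    gradForm ν y q + halfForm σ y q = ∫ z, v z * q z ∂(muQ Ω T)

/-- The cost functional. -/
def cost {d : ℕ} {Ω : Set (E d)} {T : ℝ} (lam : ℝ) (yd y u : L2Q Ω T) : ℝ :=
  1 / 2 * ‖y - yd‖ ^ 2 + lam / 2 * ‖u‖ ^ 2

/-- `u` is an optimal control and `y = y(u)` is its state. -/
def IsOptimalPair {d : ℕ} {Ω : Set (E d)} {T : ℝ} (σ ν : E d → ℝ) (lam : ℝ)
    (yd y u : L2Q Ω T) : Prop :=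
  IsState σ ν y u ∧ ∀ yv v : L2Q Ω T, IsState σ ν yv v → cost lam yd y u ≤ cost lam yd yv v

/-- `(y, p)` solves the (reduced) optimality system. -/
def SolvesKKT {d : ℕ} {Ω : Set (E d)} {T : ℝ} (σ ν : E d → ℝ) (lam : ℝ)
    (yd y p : L2Q Ω T) : Prop :=
  MemH1half Ω T y ∧ MemH1half Ω T p ∧
  (∀ z : L2Q Ω T, MemH1half Ω T z →
    ∫ s, y s * z s ∂(muQ Ω T) - gradForm ν p z + halfForm σ p z
      = ∫ s, yd s * z s ∂(muQ Ω T)) ∧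
  (∀ q : L2Q Ω T, MemH1half Ω T q →
    gradForm ν y q + halfForm σ y q + lam⁻¹ * ∫ s, p s * q s ∂(muQ Ω T) = 0)

/-- `C` is a constant in Friedrichs' inequality `‖w‖_Ω ≤ C ‖∇w‖_Ω` on `H^1_0(Ω)`, the closure
of `C_c^∞(Ω)` in `H^1(Ω)`. -/
def IsFriedrichsConst {d : ℕ} (Ω : Set (E d)) (C : ℝ) : Prop :=
  0 < C ∧ ∀ w : E d → ℝ, ContDiff ℝ ∞ w → HasCompactSupport w → tsupport w ⊆ Ω →
    ∫ x in Ω, w x ^ 2 ≤ C ^ 2 * ∫ x in Ω, ‖gradient w x‖ ^ 2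

/-! ### The residuals, the majorant and the minorant -/

/-- `μ₁ = min {ν_, σ_} / √2`. -/
def mu1 (νlo σlo : ℝ) : ℝ := 1 / Real.sqrt 2 * min νlo σlo

/-- `‖R₁(η,τ,v)‖` with `R₁ = σ ∂ₜη - ∇·τ - v`. -/
def R1 {d : ℕ} {Ω : Set (E d)} {T : ℝ} (σ : E d → ℝ) (η : L2Q Ω T) (τ : L2Qvec Ω T)
    (v : L2Q Ω T) : ℝ :=
  normQ Ω T (fun z => σ z.1 * dt η z - dvg τ z - v z)

/-- `‖R₂(η,τ)‖` with `R₂ = τ - ν ∇η`; also `‖R₄(ζ,ρ)‖`, where `R₄ = ρ - ν ∇ζ`. -/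
def R2 {d : ℕ} {Ω : Set (E d)} {T : ℝ} (ν : E d → ℝ) (η : L2Q Ω T) (τ : L2Qvec Ω T) : ℝ :=
  normQ Ω T (fun z => τ z - ν z.1 • grad η z)

/-- `‖R₃(ζ,ρ,η)‖` with `R₃ = η - y_d + ∇·ρ + σ ∂ₜζ`. -/
def R3 {d : ℕ} {Ω : Set (E d)} {T : ℝ} (σ : E d → ℝ) (yd ζ : L2Q Ω T) (ρ : L2Qvec Ω T)
    (η : L2Q Ω T) : ℝ :=
  normQ Ω T (fun z => η z - yd z + dvg ρ z + σ z.1 * dt ζ z)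

/-- `∫_Q (ν ∇η · ∇ζ + σ ∂ₜη ζ + λ⁻¹ ζ²)`. -/
def mixedInt {d : ℕ} {Ω : Set (E d)} {T : ℝ} (σ ν : E d → ℝ) (lam : ℝ) (η ζ : L2Q Ω T) : ℝ :=
  ∫ z, (ν z.1 * inner ℝ (grad η z) (grad ζ z) + σ z.1 * dt η z * ζ z + lam⁻¹ * ζ z ^ 2)
    ∂(muQ Ω T)

/-- The constant `γ = (1+α)(1+β) C_F² / (2 α μ₁²)`. -/
def gam (μ CF α β : ℝ) : ℝ := (1 + α) * (1 + β) * CF ^ 2 / (2 * α * μ ^ 2)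

/-- The majorant `J^⊕(α,β;η,τ,v)` of the cost functional (`μ` stands for `μ₁`). -/
def Jplus {d : ℕ} {Ω : Set (E d)} {T : ℝ} (σ ν : E d → ℝ) (μ lam CF : ℝ) (yd : L2Q Ω T)
    (α β : ℝ) (η : L2Q Ω T) (τ : L2Qvec Ω T) (v : L2Q Ω T) : ℝ :=
  (1 + α) / 2 * ‖η - yd‖ ^ 2
    + gam μ CF α β * (R2 ν η τ ^ 2 + CF ^ 2 / β * R1 σ η τ v ^ 2)
    + lam / 2 * ‖v‖ ^ 2

/-- The minorant `J^⊖(η,ζ,τ,ρ)` of the cost functional (`μ` stands for `μ₁`). -/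
def Jminus {d : ℕ} {Ω : Set (E d)} {T : ℝ} (σ ν : E d → ℝ) (μ lam CF : ℝ) (yd : L2Q Ω T)
    (η ζ : L2Q Ω T) (τ ρ : L2Qvec Ω T) : ℝ :=
  1 / 2 * ‖η - yd‖ ^ 2 + 1 / (2 * lam) * ‖ζ‖ ^ 2 - mixedInt σ ν lam η ζ
    - CF ^ 2 / (μ ^ 2 * lam) * (CF * R3 σ yd ζ ρ η + R2 ν ζ ρ) ^ 2
    - 1 / μ * (CF * R1 σ η τ (-(lam⁻¹ • ζ)) + R2 ν η τ) * (CF * R3 σ yd ζ ρ η + R2 ν ζ ρ)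

/-- The majorant `M₁^⊕(α,β;η,ζ,τ,ρ,v)` of the control-state error (`μ` stands for `μ₁`). -/
def M1plus {d : ℕ} {Ω : Set (E d)} {T : ℝ} (σ ν : E d → ℝ) (μ lam CF : ℝ) (yd : L2Q Ω T)
    (α β : ℝ) (η ζ : L2Q Ω T) (τ ρ : L2Qvec Ω T) (v : L2Q Ω T) : ℝ :=
  Jplus σ ν μ lam CF yd α β η τ v - Jminus σ ν μ lam CF yd η ζ τ ρ
    + 3 * lam / (4 * CF ^ 2) * (CF * R1 σ η τ v + R2 ν η τ) ^ 2

/-- The squared weighted error norm `|||u - v|||₁²`, in terms of `yu = y(u)` and `yv = y(v)`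
(`μ` stands for `μ₁`). -/
def errSq {d : ℕ} {Ω : Set (E d)} {T : ℝ} (μ lam CF : ℝ) (yu yv : L2Q Ω T) : ℝ :=
  1 / 2 * ‖yu - yv‖ ^ 2 + lam * μ ^ 2 / (2 * CF ^ 2) * semiSq (yu - yv)

end PeriodicOCP

end

/-! The coefficients depend on x only, so multiplication by them commutes with the projection P_k
(`modeP`) onto the k-th time-Fourier mode and with the rotation J_k (`modeJ`) of that mode by a
quarter period. J_k is skew, J_k² = -P_k for k ≥ 1, and ∂ₜ is kω J_k on the mode. Hence the
parabolic problem decouples into modes. State and adjoint equation are treated together as s σ ∂ₜy -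
∇·(ν∇y) = f with s = 1 and s = -1.

Everything rests on one inf-sup estimate, `Coeffs.mu1_sq_mul_semiSq_le`. Test with ∑ (P_k y + s J_k
y). Skewness kills the cross terms ⟨ν P_k ∇y, J_k ∇y⟩ and ⟨σ J_k y, P_k y⟩, and what remains is at
least min{ν_, σ_} |y|²_{1,1/2}. The squared gradient norm of the test function is at most twice that
of y, whence the factor 1/√2 in μ₁. With Friedrichs' inequality this yields uniqueness, stability of
the solution operator, and the bound of the distance between an approximation and the solution by
the residuals (`Coeffs.deviation_le`).

Existence comes from Lax–Milgram on each mode and orthogonal summation (`Coeffs.exists_solution`).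
Testing a mode with J_k y bounds kω J_k y, so the solution has ∂ₜy in L² and its flux a divergence
in L². By uniqueness every weak solution is this regular one (`Coeffs.isSol_regular`), which is why
the optimal state, adjoint state and fluxes are admissible in the majorant.

The cost is quadratic along the affine solution map, with gradient p + λu (`Coeffs.cost_eq`). So
optimality is equivalent to p = -λu, and then J(v) - J(u) = ½‖y(u) - y(v)‖² + (λ/2)‖u - v‖². By the
inf-sup estimate the last term dominates the weighted seminorm of y(u) - y(v), so the error is at
most J(v) - J(u). It remains to bound J(v) above by J^⊕ (triangle inequality and two Young
inequalities, `Coeffs.cost_le_Jplus`) and J(u) below by J^⊖ (expansion around η and ζ and completion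
of a square, `Coeffs.Jminus_le_cost`). The additional residual term of the majorant is nonnegative.
At the exact solution all residuals vanish and the remaining terms cancel except the one with factor
α (`Coeffs.M1plus_optimal`). -/

noncomputable section
set_option linter.unusedSectionVars false

namespace PeriodicOCP

section

/-! ### Multiplication operators on L². -/

section Mul
variable {X F : Type*} [MeasurableSpace X] {μ : Measure X} [NormedAddCommGroup F]
  [InnerProductSpace ℝ F] {m n : X → ℝ}

open Classical in
/-- Multiplication by an essentially bounded function on `L²`. -/
def mulOp (μ : Measure X) (m : X → ℝ) : Lp F 2 μ →L[ℝ] Lp F 2 μ :=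
  if h : MemLp m ⊤ μ then (ContinuousLinearMap.lsmul ℝ ℝ).holderL μ ⊤ 2 2 (h.toLp m) else 0

lemma coeFn_mulOp (h : MemLp m ⊤ μ) (u : Lp F 2 μ) :
    mulOp μ m u =ᵐ[μ] fun x => m x • u x := by
  have h1 : mulOp μ m u = (ContinuousLinearMap.lsmul ℝ ℝ : ℝ →L[ℝ] F →L[ℝ] F).holder 2
      (h.toLp m) u := by
    simp only [mulOp, h, dif_pos]; rfl
  rw [h1]
  filter_upwards [(ContinuousLinearMap.lsmul ℝ ℝ : ℝ →L[ℝ] F →L[ℝ] F).coeFn_holder (r := 2)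
    (h.toLp m) u, h.coeFn_toLp] with x h1 h2
  rw [h1, h2]; rfl

lemma inner_mulOp_left (h : MemLp m ⊤ μ) (u v : Lp F 2 μ) :
    inner ℝ (mulOp μ m u) v = ∫ x, m x * inner ℝ (u x) (v x) ∂μ := by
  rw [L2.inner_def]
  refine integral_congr_ae ?_
  filter_upwards [coeFn_mulOp h u] with x hx
  rw [hx, real_inner_smul_left]

/-- No boundedness of m is required, since `mulOp` is 0 by convention when m is not essentially
bounded. -/
lemma inner_mulOp_comm (m : X → ℝ) (u v : Lp F 2 μ) :
    inner ℝ (mulOp μ m u) v = inner ℝ u (mulOp μ m v) := by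
  by_cases h : MemLp m ⊤ μ
  · rw [inner_mulOp_left h, real_inner_comm, inner_mulOp_left h]
    simp_rw [real_inner_comm]
  · simp [mulOp, h]

lemma integrable_mul_inner (h : MemLp m ⊤ μ) (u v : Lp F 2 μ) :
    Integrable (fun x => m x * inner ℝ (u x) (v x)) μ := by
  refine (L2.integrable_inner (𝕜 := ℝ) (mulOp μ m u) v).congr ?_
  filter_upwards [coeFn_mulOp h u] with x hx
  rw [hx, real_inner_smul_left]

lemma le_inner_mulOp_self {c : ℝ} (h : MemLp m ⊤ μ) (hc : ∀ᵐ x ∂μ, c ≤ m x) (u : Lp F 2 μ) :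
    c * ‖u‖ ^ 2 ≤ inner ℝ (mulOp μ m u) u := by
  rw [inner_mulOp_left h, ← real_inner_self_eq_norm_sq, L2.inner_def, ← integral_const_mul]
  refine integral_mono_ae ((L2.integrable_inner (𝕜 := ℝ) u u).const_mul c)
    (integrable_mul_inner h u u) ?_
  filter_upwards [hc] with x hx
  exact mul_le_mul_of_nonneg_right hx real_inner_self_nonneg

end Mul

/-! ### Fubini on the cylinder; averages in time and their adjoints. -/

section Cylinder
variable {d : ℕ} {Ω : Set (E d)} {T : ℝ} {F : Type*} [NormedAddCommGroup F]
  [InnerProductSpace ℝ F]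

lemma muQ_eq (Ω : Set (E d)) (T : ℝ) :
    muQ Ω T = (volume.restrict Ω).prod (volume.restrict (Ioo 0 T)) := by
  rw [Measure.prod_restrict, ← Measure.volume_eq_prod]; rfl

lemma isFiniteMeasure_muQ (hΩ : Bornology.IsBounded Ω) (T : ℝ) : IsFiniteMeasure (muQ Ω T) := by
  refine ⟨?_⟩
  rw [Measure.restrict_apply_univ]
  exact (hΩ.prod (Metric.isBounded_Ioo 0 T)).measure_lt_top

section Fubini
variable {G : Type*} [NormedAddCommGroup G] [NormedSpace ℝ G] {f : E d × ℝ → G}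

lemma integral_muQ (hT : 0 < T) (hf : Integrable f (muQ Ω T)) :
    ∫ z, f z ∂(muQ Ω T) = ∫ x in Ω, ∫ t in (0 : ℝ)..T, f (x, t) := by
  rw [muQ_eq] at hf ⊢
  simp_rw [intervalIntegral.integral_of_le hT.le, integral_Ioc_eq_integral_Ioo]
  exact integral_prod _ hf

lemma integrable_integral_snd (hT : 0 < T) (hf : Integrable f (muQ Ω T)) :
    Integrable (fun x => ∫ t in (0 : ℝ)..T, f (x, t)) (volume.restrict Ω) := by
  rw [muQ_eq] at hf
  simp_rw [intervalIntegral.integral_of_le hT.le, integral_Ioc_eq_integral_Ioo]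
  exact hf.integral_prod_left

lemma ae_intervalIntegrable (hT : 0 < T) (hf : Integrable f (muQ Ω T)) :
    ∀ᵐ x ∂(volume.restrict Ω), IntervalIntegrable (fun t => f (x, t)) volume 0 T := by
  rw [muQ_eq] at hf
  filter_upwards [hf.prod_right_ae] with x hx
  rw [intervalIntegrable_iff_integrableOn_Ioo_of_le hT.le]
  exact hx

lemma ae_ae_of_ae_muQ {p : E d × ℝ → Prop} (h : ∀ᵐ z ∂(muQ Ω T), p z) :
    ∀ᵐ x ∂(volume.restrict Ω), ∀ᵐ t ∂(volume.restrict (Ioo 0 T)), p (x, t) := by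
  rw [muQ_eq] at h
  exact Measure.ae_ae_of_ae_prod h

lemma ae_muQ_of_ae {p : E d → Prop} (h : ∀ᵐ x ∂(volume.restrict Ω), p x) :
    ∀ᵐ z ∂(muQ Ω T), p z.1 := by
  rw [muQ_eq]
  exact Measure.quasiMeasurePreserving_fst.ae h

end Fubini

/-- `T` times the Lebesgue measure on `Ω`. -/
abbrev muX (Ω : Set (E d)) (T : ℝ) : Measure (E d) := (muQ Ω T).map Prod.fst

/-- The pushforward makes the first projection measure preserving, so that `lift` is an isometry and
averaging in time is its adjoint. The price is the factor T that has to be tracked when returning to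
Lebesgue measure on Ω. -/
lemma muX_eq (Ω : Set (E d)) (T : ℝ) : muX Ω T = ENNReal.ofReal T • volume.restrict Ω := by
  rw [muX, muQ_eq, Measure.map_fst_prod]; simp

lemma integral_muX {G : Type*} [NormedAddCommGroup G] [NormedSpace ℝ G] (hT : 0 < T)
    (f : E d → G) : ∫ x, f x ∂(muX Ω T) = T • ∫ x in Ω, f x := by
  rw [muX_eq, integral_smul_measure, ENNReal.toReal_ofReal hT.le]

lemma ae_muX_iff (hT : 0 < T) {p : E d → Prop} :
    (∀ᵐ x ∂(muX Ω T), p x) ↔ ∀ᵐ x ∂(volume.restrict Ω), p x := by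
  rw [muX_eq, Measure.ae_ennreal_smul_measure_iff (by simpa using hT)]

/-- Functions of `x` regarded as functions on the cylinder. -/
def lift (Ω : Set (E d)) (T : ℝ) : Lp F 2 (muX Ω T) →ₗᵢ[ℝ] Lp F 2 (muQ Ω T) :=
  Lp.compMeasurePreservingₗᵢ ℝ Prod.fst (measurable_fst.measurePreserving _)

lemma coeFn_lift (f : Lp F 2 (muX Ω T)) : lift Ω T f =ᵐ[muQ Ω T] fun z => f z.1 :=
  Lp.coeFn_compMeasurePreserving f (measurable_fst.measurePreserving _)

lemma memLp_top_snd {θ : ℝ → ℝ} (hθ : Continuous θ) (Ω : Set (E d)) (T : ℝ) :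
    MemLp (fun z : E d × ℝ => θ z.2) ⊤ (muQ Ω T) := by
  obtain ⟨C, hC⟩ := isCompact_Icc.exists_bound_of_continuousOn (s := Icc 0 T) hθ.continuousOn
  have hm : AEStronglyMeasurable (fun z : E d × ℝ => θ z.2) (muQ Ω T) :=
    (hθ.comp continuous_snd).aestronglyMeasurable
  refine memLp_top_of_bound hm C ?_
  rw [muQ_eq]
  refine Measure.quasiMeasurePreserving_snd.ae (p := fun t => ‖θ t‖ ≤ C) ?_
  filter_upwards [ae_restrict_mem measurableSet_Ioo] with t ht using hC t (Ioo_subset_Icc_self ht)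

variable [CompleteSpace F]

/-- Average in time. -/
def tavg (Ω : Set (E d)) (T : ℝ) : Lp F 2 (muQ Ω T) →L[ℝ] Lp F 2 (muX Ω T) :=
  ContinuousLinearMap.adjoint (lift Ω T).toContinuousLinearMap

/-- `u ↦ T⁻¹ ∫₀ᵀ u θ dt`. -/
def tcoef (Ω : Set (E d)) (T : ℝ) (θ : ℝ → ℝ) : Lp F 2 (muQ Ω T) →L[ℝ] Lp F 2 (muX Ω T) :=
  tavg Ω T ∘L mulOp (muQ Ω T) (fun z => θ z.2)

/-- `f ↦ f(x) θ(t)`. -/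
def tsyn (Ω : Set (E d)) (T : ℝ) (θ : ℝ → ℝ) : Lp F 2 (muX Ω T) →L[ℝ] Lp F 2 (muQ Ω T) :=
  mulOp (muQ Ω T) (fun z => θ z.2) ∘L (lift Ω T).toContinuousLinearMap

/-- Analysis and synthesis are adjoint. Together with the orthogonality relation `tcoef_tsyn`, this
gives the algebra of the modes without any pointwise formula. -/
lemma inner_tcoef_left (θ : ℝ → ℝ) (u : Lp F 2 (muQ Ω T)) (f : Lp F 2 (muX Ω T)) :
    inner ℝ (tcoef Ω T θ u) f = inner ℝ u (tsyn Ω T θ f) := by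
  simp only [tcoef, tavg, tsyn, ContinuousLinearMap.comp_apply,
    ContinuousLinearMap.adjoint_inner_left, inner_mulOp_comm]

lemma inner_tcoef_right (θ : ℝ → ℝ) (u : Lp F 2 (muQ Ω T)) (f : Lp F 2 (muX Ω T)) :
    inner ℝ f (tcoef Ω T θ u) = inner ℝ (tsyn Ω T θ f) u := by
  rw [real_inner_comm, inner_tcoef_left, real_inner_comm]

lemma coeFn_tsyn {θ : ℝ → ℝ} (hθ : Continuous θ) (f : Lp F 2 (muX Ω T)) :
    tsyn Ω T θ f =ᵐ[muQ Ω T] fun z => θ z.2 • f z.1 := by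
  filter_upwards [coeFn_mulOp (memLp_top_snd hθ Ω T) (lift Ω T f), coeFn_lift f] with z h1 h2
  simp only [tsyn, ContinuousLinearMap.comp_apply, LinearIsometry.coe_toContinuousLinearMap]
  rw [h1, h2]

lemma tcoef_tsyn (hT : 0 < T) {θ θ' : ℝ → ℝ} (hθ : Continuous θ) (hθ' : Continuous θ')
    (f : Lp F 2 (muX Ω T)) :
    tcoef Ω T θ (tsyn Ω T θ' f) = (T⁻¹ * ∫ t in (0 : ℝ)..T, θ t * θ' t) • f := by
  refine ext_inner_right ℝ fun g => ?_
  rw [inner_tcoef_left, real_inner_smul_left, L2.inner_def, L2.inner_def, integral_muX hT, intervalIntegral.integral_of_le hT.le,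
    integral_Ioc_eq_integral_Ioo]
  have h : ∫ z, inner ℝ (tsyn Ω T θ' f z) (tsyn Ω T θ g z) ∂(muQ Ω T)
      = ∫ z, inner ℝ (f z.1) (g z.1) * (θ z.2 * θ' z.2) ∂(muQ Ω T) := by
    refine integral_congr_ae ?_
    filter_upwards [coeFn_tsyn hθ' f, coeFn_tsyn hθ g] with z h1 h2
    rw [h1, h2, real_inner_smul_left, real_inner_smul_right]; ring
  rw [h, muQ_eq, integral_prod_mul (f := fun x => inner ℝ (f x) (g x))
    (g := fun t => θ t * θ' t), smul_eq_mul]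
  field_simp

/-- This ties the abstract adjoint to the concrete Fourier integral: both sides are integrable in x
and have equal integrals over every measurable set, by adjointness applied to indicator functions
and Fubini. -/
lemma coeFn_tcoef (hΩ : Bornology.IsBounded Ω) (hT : 0 < T) {θ : ℝ → ℝ} (hθ : Continuous θ)
    (u : Lp F 2 (muQ Ω T)) :
    ∀ᵐ x ∂(volume.restrict Ω), tcoef Ω T θ u x = T⁻¹ • ∫ t in (0 : ℝ)..T, θ t • u (x, t) := by
  have := isFiniteMeasure_muQ hΩ T
  have hi : Integrable (fun z => θ z.2 • u z) (muQ Ω T) :=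
    ((Lp.memLp (mulOp (muQ Ω T) (fun z => θ z.2) u)).integrable one_le_two).congr
      (coeFn_mulOp (memLp_top_snd hθ Ω T) u)
  have hi1 : Integrable (fun x => T⁻¹ • ∫ t in (0 : ℝ)..T, θ t • u (x, t)) (muX Ω T) := by
    rw [muX_eq]
    refine (Integrable.smul_measure ?_ ENNReal.ofReal_ne_top)
    exact (integrable_integral_snd hT hi).smul _
  refine (ae_muX_iff hT).1 ?_
  refine Integrable.ae_eq_of_forall_setIntegral_eq _ _
    ((Lp.memLp (tcoef Ω T θ u)).integrable one_le_two) hi1 fun S hS hSm => ?_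
  refine ext_inner_left ℝ fun e => ?_
  rw [← L2.inner_indicatorConstLp_eq_inner_setIntegral ℝ hS hSm.ne, inner_tcoef_right,
    L2.inner_def]
  have h1 : ∫ z, inner ℝ (tsyn Ω T θ (indicatorConstLp 2 hS hSm.ne e) z) (u z) ∂(muQ Ω T)
      = ∫ z, S.indicator (fun _ => (1 : ℝ)) z.1 * inner ℝ e (θ z.2 • u z) ∂(muQ Ω T) := by
    refine integral_congr_ae ?_
    have h2 := (measurable_fst.measurePreserving (muQ Ω T)).quasiMeasurePreserving.ae
      (indicatorConstLp_coeFn (p := 2) (hs := hS) (hμs := hSm.ne) (c := e))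
    filter_upwards [coeFn_tsyn hθ (indicatorConstLp 2 hS hSm.ne e), h2] with z h1 h2
    rw [h1, h2, real_inner_smul_left, real_inner_smul_right]
    by_cases hz : z.1 ∈ S <;> simp [hz]
  have h3 : Integrable (fun z : E d × ℝ =>
      S.indicator (fun _ => (1 : ℝ)) z.1 * inner ℝ e (θ z.2 • u z)) (muQ Ω T) := by
    refine Integrable.bdd_mul (c := 1) (hi.const_inner e) ?_ ?_
    · exact ((measurable_const.indicator hS).comp measurable_fst).aestronglyMeasurable
    · refine Eventually.of_forall fun z => ?_
      by_cases hz : z.1 ∈ S <;> simp [hz]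
  have h4 : Integrable (fun x => T • S.indicator
      (fun x => T⁻¹ • ∫ t in (0 : ℝ)..T, θ t • u (x, t)) x) (volume.restrict Ω) := by
    refine ((integrable_integral_snd hT hi).indicator hS).congr (Eventually.of_forall fun x => ?_)
    by_cases hxS : x ∈ S <;> simp [hxS, hT.ne']
  rw [h1, integral_muQ hT h3, ← integral_indicator hS, integral_muX hT, ← integral_smul,
    ← integral_inner h4]
  refine integral_congr_ae ?_
  filter_upwards [ae_intervalIntegrable hT hi] with x hx
  by_cases hxS : x ∈ S
  · simp only [hxS, indicator_of_mem, one_mul]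
    rw [smul_inv_smul₀ hT.ne']
    simp_rw [intervalIntegral.integral_of_le hT.le]
    exact integral_inner hx.1 e
  · simp [hxS]

lemma memLp_fst {m : E d → ℝ} (hm : MemLp m ⊤ (muX Ω T)) :
    MemLp (fun z : E d × ℝ => m z.1) ⊤ (muQ Ω T) :=
  hm.comp_measurePreserving (measurable_fst.measurePreserving _)

lemma mulOp_fst_tsyn {m : E d → ℝ} (hm : MemLp m ⊤ (muX Ω T)) {θ : ℝ → ℝ} (hθ : Continuous θ)
    (f : Lp F 2 (muX Ω T)) :
    mulOp (muQ Ω T) (fun z => m z.1) (tsyn Ω T θ f) = tsyn Ω T θ (mulOp (muX Ω T) m f) := by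
  ext1
  filter_upwards [coeFn_mulOp (memLp_fst hm) (tsyn Ω T θ f), coeFn_tsyn hθ f,
    coeFn_tsyn hθ (mulOp (muX Ω T) m f), (measurable_fst.measurePreserving
      (muQ Ω T)).quasiMeasurePreserving.ae (coeFn_mulOp hm f)] with z h1 h2 h3 h4
  rw [h1, h2, h3, h4, smul_comm]

/-- A multiplier depending on `x` only commutes with time averages. -/
lemma tcoef_mulOp_fst {m : E d → ℝ} (hm : MemLp m ⊤ (muX Ω T)) {θ : ℝ → ℝ} (hθ : Continuous θ)
    (u : Lp F 2 (muQ Ω T)) :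
    tcoef Ω T θ (mulOp (muQ Ω T) (fun z => m z.1) u) = mulOp (muX Ω T) m (tcoef Ω T θ u) := by
  refine ext_inner_right ℝ fun g => ?_
  rw [inner_tcoef_left, inner_mulOp_comm, inner_mulOp_comm, inner_tcoef_left, mulOp_fst_tsyn hm hθ]

end Cylinder
end

/-! ### Orthogonality of the trigonometric system. -/

section

/-- `cos(kωt)`. -/
def cosk (T : ℝ) (k : ℕ) (t : ℝ) : ℝ := Real.cos (k * freq T * t)

/-- `sin(kωt)`. -/
def sink (T : ℝ) (k : ℕ) (t : ℝ) : ℝ := Real.sin (k * freq T * t)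

lemma continuous_cosk (T : ℝ) (k : ℕ) : Continuous (cosk T k) := by unfold cosk; fun_prop

lemma continuous_sink (T : ℝ) (k : ℕ) : Continuous (sink T k) := by unfold sink; fun_prop

lemma hasDerivAt_cosk (T : ℝ) (k : ℕ) (t : ℝ) :
    HasDerivAt (cosk T k) (-(k * freq T * sink T k t)) t := by
  have h : HasDerivAt (fun t : ℝ => k * freq T * t) (k * freq T) t := by
    simpa using (hasDerivAt_id t).const_mul (k * freq T)
  exact h.cos.congr_deriv (by simp only [sink]; ring)

lemma hasDerivAt_sink (T : ℝ) (k : ℕ) (t : ℝ) :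
    HasDerivAt (sink T k) (k * freq T * cosk T k t) t := by
  have h : HasDerivAt (fun t : ℝ => k * freq T * t) (k * freq T) t := by
    simpa using (hasDerivAt_id t).const_mul (k * freq T)
  exact h.sin.congr_deriv (by simp only [cosk]; ring)

lemma freq_pos {T : ℝ} (hT : 0 < T) : 0 < freq T := by unfold freq; positivity

lemma freq_mul_self {T : ℝ} (hT : 0 < T) : freq T * T = 2 * Real.pi := by
  unfold freq; field_simp

lemma integral_cos_int_freq {T : ℝ} (hT : 0 < T) (n : ℤ) :
    ∫ t in (0 : ℝ)..T, Real.cos (n * freq T * t) = if n = 0 then T else 0 := by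
  split_ifs with h
  · simp [h]
  · have h1 : (n : ℝ) * freq T ≠ 0 := mul_ne_zero (by exact_mod_cast h) (freq_pos hT).ne'
    rw [intervalIntegral.integral_comp_mul_left (f := Real.cos) h1, integral_cos, mul_zero,
      Real.sin_zero, mul_assoc, freq_mul_self hT, show (n : ℝ) * (2 * Real.pi) = ((2 * n : ℤ) : ℝ) * Real.pi
        by push_cast; ring, Real.sin_int_mul_pi]
    simp

lemma integral_sin_int_freq {T : ℝ} (hT : 0 < T) (n : ℤ) :
    ∫ t in (0 : ℝ)..T, Real.sin (n * freq T * t) = 0 := by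
  by_cases h : n = 0
  · simp [h]
  · have h1 : (n : ℝ) * freq T ≠ 0 := mul_ne_zero (by exact_mod_cast h) (freq_pos hT).ne'
    rw [intervalIntegral.integral_comp_mul_left (f := Real.sin) h1, integral_sin, mul_zero,
      Real.cos_zero, mul_assoc, freq_mul_self hT, Real.cos_int_mul_two_pi]
    simp

/-- The normalization factor of the `k`-th Fourier mode. -/
def wt (k : ℕ) : ℝ := if k = 0 then 1 else 2

lemma wt_pos (k : ℕ) : 0 < wt k := by unfold wt; split_ifs <;> norm_num

lemma mean_cosk_cosk {T : ℝ} (hT : 0 < T) (k l : ℕ) :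
    T⁻¹ * ∫ t in (0 : ℝ)..T, cosk T k t * cosk T l t = if k = l then (wt k)⁻¹ else 0 := by
  have h : ∀ t, cosk T k t * cosk T l t = 1 / 2 * (Real.cos (((k - l : ℤ) : ℝ) * freq T * t)
      + Real.cos (((k + l : ℤ) : ℝ) * freq T * t)) := fun t => by
    simp only [cosk]
    rw [show ((k - l : ℤ) : ℝ) * freq T * t = k * freq T * t - l * freq T * t by push_cast; ring,
      show ((k + l : ℤ) : ℝ) * freq T * t = k * freq T * t + l * freq T * t by push_cast; ring,
      Real.cos_sub, Real.cos_add]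
    ring
  simp_rw [h]
  rw [intervalIntegral.integral_const_mul, intervalIntegral.integral_add
    (Continuous.intervalIntegrable (by fun_prop) _ _)
    (Continuous.intervalIntegrable (by fun_prop) _ _), integral_cos_int_freq hT,
    integral_cos_int_freq hT]
  by_cases hkl : k = l
  · subst hkl
    by_cases hk : k = 0
    · subst hk; simp [wt]; field_simp; norm_num
    · have : (k : ℤ) + k ≠ 0 := by omega
      simp [hk, this, wt]; field_simp
  · have h1 : (k : ℤ) - l ≠ 0 := by omega
    have h2 : (k : ℤ) + l ≠ 0 := by omega
    simp [h1, h2, hkl]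

/-- The index 0 must be excluded: the zeroth sine vanishes, whereas `wt 0 = 1`. -/
lemma mean_sink_sink {T : ℝ} (hT : 0 < T) {k : ℕ} (hk : k ≠ 0) (l : ℕ) :
    T⁻¹ * ∫ t in (0 : ℝ)..T, sink T k t * sink T l t = if k = l then (wt k)⁻¹ else 0 := by
  have h : ∀ t, sink T k t * sink T l t = 1 / 2 * (Real.cos (((k - l : ℤ) : ℝ) * freq T * t)
      - Real.cos (((k + l : ℤ) : ℝ) * freq T * t)) := fun t => by
    simp only [sink]
    rw [show ((k - l : ℤ) : ℝ) * freq T * t = k * freq T * t - l * freq T * t by push_cast; ring,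
      show ((k + l : ℤ) : ℝ) * freq T * t = k * freq T * t + l * freq T * t by push_cast; ring,
      Real.cos_sub, Real.cos_add]
    ring
  simp_rw [h]
  rw [intervalIntegral.integral_const_mul, intervalIntegral.integral_sub
    (Continuous.intervalIntegrable (by fun_prop) _ _)
    (Continuous.intervalIntegrable (by fun_prop) _ _), integral_cos_int_freq hT,
    integral_cos_int_freq hT]
  have h2 : (k : ℤ) + l ≠ 0 := by omega
  by_cases hkl : k = l
  · subst hkl
    simp [h2, wt, hk]; field_simp
  · have h1 : (k : ℤ) - l ≠ 0 := by omega
    simp [h1, h2, hkl]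

lemma mean_sink_cosk {T : ℝ} (hT : 0 < T) (k l : ℕ) :
    T⁻¹ * ∫ t in (0 : ℝ)..T, sink T k t * cosk T l t = 0 := by
  have h : ∀ t, sink T k t * cosk T l t = 1 / 2 * (Real.sin (((k - l : ℤ) : ℝ) * freq T * t)
      + Real.sin (((k + l : ℤ) : ℝ) * freq T * t)) := fun t => by
    simp only [cosk, sink]
    rw [show ((k - l : ℤ) : ℝ) * freq T * t = k * freq T * t - l * freq T * t by push_cast; ring,
      show ((k + l : ℤ) : ℝ) * freq T * t = k * freq T * t + l * freq T * t by push_cast; ring,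
      Real.sin_sub, Real.sin_add]
    ring
  simp_rw [h]
  rw [intervalIntegral.integral_const_mul, intervalIntegral.integral_add
    (Continuous.intervalIntegrable (by fun_prop) _ _)
    (Continuous.intervalIntegrable (by fun_prop) _ _), integral_sin_int_freq hT,
    integral_sin_int_freq hT]
  simp

/-! ### Algebra of the mode projections and of the rotations of the modes. -/

section Modes
variable {d : ℕ} {Ω : Set (E d)} {T : ℝ} {F : Type*} [NormedAddCommGroup F]
  [InnerProductSpace ℝ F] [CompleteSpace F]

/-- The cosine coefficient, as an operator. -/
def cC (Ω : Set (E d)) (T : ℝ) (k : ℕ) : Lp F 2 (muQ Ω T) →L[ℝ] Lp F 2 (muX Ω T) :=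
  tcoef Ω T (cosk T k)

/-- The sine coefficient, as an operator. -/
def cS (Ω : Set (E d)) (T : ℝ) (k : ℕ) : Lp F 2 (muQ Ω T) →L[ℝ] Lp F 2 (muX Ω T) :=
  tcoef Ω T (sink T k)

/-- Cosine synthesis. -/
def eC (Ω : Set (E d)) (T : ℝ) (k : ℕ) : Lp F 2 (muX Ω T) →L[ℝ] Lp F 2 (muQ Ω T) :=
  tsyn Ω T (cosk T k)

/-- Sine synthesis. -/
def eS (Ω : Set (E d)) (T : ℝ) (k : ℕ) : Lp F 2 (muX Ω T) →L[ℝ] Lp F 2 (muQ Ω T) :=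
  tsyn Ω T (sink T k)

/-- The projection onto the `k`-th time-Fourier mode. -/
def modeP (Ω : Set (E d)) (T : ℝ) (k : ℕ) : Lp F 2 (muQ Ω T) →L[ℝ] Lp F 2 (muQ Ω T) :=
  wt k • (eC Ω T k ∘L cC Ω T k + eS Ω T k ∘L cS Ω T k)

/-- The quarter-period rotation of the `k`-th time-Fourier mode; `∂ₜ` acts on the mode as `kω`
times this operator. -/
def modeJ (Ω : Set (E d)) (T : ℝ) (k : ℕ) : Lp F 2 (muQ Ω T) →L[ℝ] Lp F 2 (muQ Ω T) :=
  (2 : ℝ) • (eC Ω T k ∘L cS Ω T k - eS Ω T k ∘L cC Ω T k)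

lemma modeP_apply (k : ℕ) (u : Lp F 2 (muQ Ω T)) :
    modeP Ω T k u = wt k • (eC Ω T k (cC Ω T k u) + eS Ω T k (cS Ω T k u)) := rfl

lemma modeJ_apply (k : ℕ) (u : Lp F 2 (muQ Ω T)) :
    modeJ Ω T k u = (2 : ℝ) • (eC Ω T k (cS Ω T k u) - eS Ω T k (cC Ω T k u)) := rfl

lemma inner_cC_left (k : ℕ) (u : Lp F 2 (muQ Ω T)) (f : Lp F 2 (muX Ω T)) :
    inner ℝ (cC Ω T k u) f = inner ℝ u (eC Ω T k f) := inner_tcoef_left _ u f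

lemma inner_cS_left (k : ℕ) (u : Lp F 2 (muQ Ω T)) (f : Lp F 2 (muX Ω T)) :
    inner ℝ (cS Ω T k u) f = inner ℝ u (eS Ω T k f) := inner_tcoef_left _ u f

lemma inner_eC_left (k : ℕ) (f : Lp F 2 (muX Ω T)) (u : Lp F 2 (muQ Ω T)) :
    inner ℝ (eC Ω T k f) u = inner ℝ f (cC Ω T k u) := (inner_tcoef_right _ u f).symm

lemma inner_eS_left (k : ℕ) (f : Lp F 2 (muX Ω T)) (u : Lp F 2 (muQ Ω T)) :
    inner ℝ (eS Ω T k f) u = inner ℝ f (cS Ω T k u) := (inner_tcoef_right _ u f).symm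

lemma eS_zero (f : Lp F 2 (muX Ω T)) : eS Ω T 0 f = 0 := by
  ext1
  filter_upwards [coeFn_tsyn (continuous_sink T 0) f, Lp.coeFn_zero F 2 (muQ Ω T)] with z h1 h2
  rw [eS, h1, h2]; simp [sink]

lemma cS_zero (u : Lp F 2 (muQ Ω T)) : cS Ω T 0 u = 0 :=
  ext_inner_right ℝ fun f => by simp [inner_cS_left, eS_zero]

lemma cC_eC (hT : 0 < T) (k l : ℕ) (f : Lp F 2 (muX Ω T)) :
    cC Ω T k (eC Ω T l f) = (if k = l then (wt k)⁻¹ else 0 : ℝ) • f := by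
  rw [← mean_cosk_cosk hT]
  exact tcoef_tsyn hT (continuous_cosk T k) (continuous_cosk T l) f

lemma cS_eS (hT : 0 < T) {k : ℕ} (hk : k ≠ 0) (l : ℕ) (f : Lp F 2 (muX Ω T)) :
    cS Ω T k (eS Ω T l f) = (if k = l then (wt k)⁻¹ else 0 : ℝ) • f := by
  rw [← mean_sink_sink hT hk]
  exact tcoef_tsyn hT (continuous_sink T k) (continuous_sink T l) f

lemma cS_eC (hT : 0 < T) (k l : ℕ) (f : Lp F 2 (muX Ω T)) : cS Ω T k (eC Ω T l f) = 0 := by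
  refine (tcoef_tsyn hT (continuous_sink T k) (continuous_cosk T l) f).trans ?_
  rw [mean_sink_cosk hT, zero_smul]

lemma cC_eS (hT : 0 < T) (k l : ℕ) (f : Lp F 2 (muX Ω T)) : cC Ω T k (eS Ω T l f) = 0 := by
  refine (tcoef_tsyn hT (continuous_cosk T k) (continuous_sink T l) f).trans ?_
  simp_rw [mul_comm (cosk T k _)]
  rw [mean_sink_cosk hT, zero_smul]

lemma modeJ_zero (u : Lp F 2 (muQ Ω T)) : modeJ Ω T 0 u = 0 := by
  simp [modeJ_apply, cS_zero, eS_zero]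

lemma cC_modeP (hT : 0 < T) (k l : ℕ) (u : Lp F 2 (muQ Ω T)) :
    cC Ω T k (modeP Ω T l u) = if k = l then cC Ω T k u else 0 := by
  rw [modeP_apply, map_smul, map_add, cC_eC hT, cC_eS hT]
  split_ifs with h
  · subst h; rw [add_zero, smul_inv_smul₀ (wt_pos k).ne']
  · simp

lemma cS_modeP (hT : 0 < T) (k l : ℕ) (u : Lp F 2 (muQ Ω T)) :
    cS Ω T k (modeP Ω T l u) = if k = l then cS Ω T k u else 0 := by
  rcases eq_or_ne k 0 with rfl | hk
  · simp [cS_zero]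
  rw [modeP_apply, map_smul, map_add, cS_eC hT, cS_eS hT hk]
  split_ifs with h
  · subst h; rw [zero_add, smul_inv_smul₀ (wt_pos k).ne']
  · simp

lemma cC_modeJ (hT : 0 < T) (k l : ℕ) (u : Lp F 2 (muQ Ω T)) :
    cC Ω T k (modeJ Ω T l u) = if k = l then cS Ω T k u else 0 := by
  rcases eq_or_ne l 0 with rfl | hl
  · rw [modeJ_zero, map_zero]; split_ifs with h
    · subst h; rw [cS_zero]
    · rfl
  rw [modeJ_apply, map_smul, map_sub, cC_eC hT, cC_eS hT]
  split_ifs with h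
  · subst h; simp [wt, hl]
  · simp

lemma cS_modeJ (hT : 0 < T) {k : ℕ} (hk : k ≠ 0) (l : ℕ) (u : Lp F 2 (muQ Ω T)) :
    cS Ω T k (modeJ Ω T l u) = if k = l then -cC Ω T k u else 0 := by
  rw [modeJ_apply, map_smul, map_sub, cS_eC hT, cS_eS hT hk]
  split_ifs with h
  · subst h; simp [wt, hk]
  · simp

lemma modeP_modeP (hT : 0 < T) (k l : ℕ) (u : Lp F 2 (muQ Ω T)) :
    modeP Ω T k (modeP Ω T l u) = if k = l then modeP Ω T k u else 0 := by
  rw [modeP_apply, cC_modeP hT, cS_modeP hT]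
  split_ifs with h
  · rfl
  · simp

lemma modeP_modeP_self (hT : 0 < T) (k : ℕ) (u : Lp F 2 (muQ Ω T)) :
    modeP Ω T k (modeP Ω T k u) = modeP Ω T k u := by simp [modeP_modeP hT]

lemma modeJ_modeP (hT : 0 < T) (k l : ℕ) (u : Lp F 2 (muQ Ω T)) :
    modeJ Ω T k (modeP Ω T l u) = if k = l then modeJ Ω T k u else 0 := by
  rw [modeJ_apply, cC_modeP hT, cS_modeP hT]
  split_ifs with h
  · rfl
  · simp

lemma modeP_modeJ (hT : 0 < T) (k l : ℕ) (u : Lp F 2 (muQ Ω T)) :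
    modeP Ω T k (modeJ Ω T l u) = if k = l then modeJ Ω T k u else 0 := by
  rcases eq_or_ne k 0 with rfl | hk
  · rw [modeP_apply, cC_modeJ hT, cS_zero, modeJ_zero, cS_zero]; simp
  rw [modeP_apply, cC_modeJ hT, cS_modeJ hT hk]
  split_ifs with h
  · simp [modeJ_apply, wt, hk, sub_eq_add_neg]
  · simp

/-- The rotation is a complex structure on each oscillating mode. It fails for the mean value k = 0,
where `modeJ` vanishes but `modeP` need not. -/
lemma modeJ_modeJ (hT : 0 < T) {k : ℕ} (hk : k ≠ 0) (l : ℕ) (u : Lp F 2 (muQ Ω T)) :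
    modeJ Ω T k (modeJ Ω T l u) = if k = l then -modeP Ω T k u else 0 := by
  rw [modeJ_apply, cC_modeJ hT, cS_modeJ hT hk]
  split_ifs with h
  · simp only [modeP_apply, wt, hk, if_false, map_neg]; module
  · simp

lemma inner_modeP_comm (k : ℕ) (u v : Lp F 2 (muQ Ω T)) :
    inner ℝ (modeP Ω T k u) v = inner ℝ u (modeP Ω T k v) := by
  simp only [modeP_apply, real_inner_smul_left, real_inner_smul_right, inner_add_left,
    inner_add_right, inner_eC_left, inner_eS_left, ← inner_cC_left, ← inner_cS_left]

lemma inner_modeJ_left (k : ℕ) (u v : Lp F 2 (muQ Ω T)) :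
    inner ℝ (modeJ Ω T k u) v = -inner ℝ u (modeJ Ω T k v) := by
  simp only [modeJ_apply, real_inner_smul_left, real_inner_smul_right, inner_sub_left,
    inner_sub_right, inner_eC_left, inner_eS_left, ← inner_cC_left, ← inner_cS_left]
  ring

lemma norm_sq_modeP (k : ℕ) (u : Lp F 2 (muQ Ω T)) (hT : 0 < T) :
    ‖modeP Ω T k u‖ ^ 2 = wt k * (‖cC Ω T k u‖ ^ 2 + ‖cS Ω T k u‖ ^ 2) := by
  rw [← real_inner_self_eq_norm_sq, inner_modeP_comm, modeP_modeP_self hT, modeP_apply,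
    real_inner_smul_right, inner_add_right, ← inner_cC_left, ← inner_cS_left,
    real_inner_self_eq_norm_sq, real_inner_self_eq_norm_sq]

lemma norm_modeJ (hT : 0 < T) {k : ℕ} (hk : k ≠ 0) (u : Lp F 2 (muQ Ω T)) :
    ‖modeJ Ω T k u‖ = ‖modeP Ω T k u‖ := by
  rw [← sq_eq_sq₀ (norm_nonneg _) (norm_nonneg _), ← real_inner_self_eq_norm_sq,
    ← real_inner_self_eq_norm_sq, inner_modeJ_left, modeJ_modeJ hT hk, if_pos rfl, inner_neg_right,
    neg_neg, inner_modeP_comm, modeP_modeP_self hT]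

lemma norm_modeJ_le (hT : 0 < T) (k : ℕ) (u : Lp F 2 (muQ Ω T)) :
    ‖modeJ Ω T k u‖ ≤ ‖modeP Ω T k u‖ := by
  rcases eq_or_ne k 0 with rfl | hk
  · simp [modeJ_zero]
  · exact (norm_modeJ hT hk u).le

lemma inner_modeP_modeP {k l : ℕ} (hT : 0 < T) (h : k ≠ l) (u v : Lp F 2 (muQ Ω T)) :
    inner ℝ (modeP Ω T k u) (modeP Ω T l v) = 0 := by
  rw [inner_modeP_comm, modeP_modeP hT, if_neg h, inner_zero_right]

/-- This commutation, and the one for `modeJ` below, decouple the equation into modes; they use that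
m does not depend on time. -/
lemma modeP_mulOp {m : E d → ℝ} (hm : MemLp m ⊤ (muX Ω T)) (k : ℕ) (u : Lp F 2 (muQ Ω T)) :
    modeP Ω T k (mulOp (muQ Ω T) (fun z => m z.1) u)
      = mulOp (muQ Ω T) (fun z => m z.1) (modeP Ω T k u) := by
  simp only [modeP_apply, cC, cS, eC, eS, map_smul, map_add, tcoef_mulOp_fst hm (continuous_cosk T k),
    tcoef_mulOp_fst hm (continuous_sink T k), mulOp_fst_tsyn hm (continuous_cosk T k),
    mulOp_fst_tsyn hm (continuous_sink T k)]

lemma modeJ_mulOp {m : E d → ℝ} (hm : MemLp m ⊤ (muX Ω T)) (k : ℕ) (u : Lp F 2 (muQ Ω T)) :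
    modeJ Ω T k (mulOp (muQ Ω T) (fun z => m z.1) u)
      = mulOp (muQ Ω T) (fun z => m z.1) (modeJ Ω T k u) := by
  simp only [modeJ_apply, cC, cS, eC, eS, map_smul, map_sub, tcoef_mulOp_fst hm (continuous_cosk T k),
    tcoef_mulOp_fst hm (continuous_sink T k), mulOp_fst_tsyn hm (continuous_cosk T k),
    mulOp_fst_tsyn hm (continuous_sink T k)]

/-- Square summable families of modes are summable. -/
lemma summable_of_modes (hT : 0 < T) {f : ℕ → Lp F 2 (muQ Ω T)} (hf : ∀ k, modeP Ω T k (f k) = f k)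
    (hs : Summable fun k => ‖f k‖ ^ 2) : Summable f := by
  let G : ℕ → Submodule ℝ (Lp F 2 (muQ Ω T)) := fun k =>
    LinearMap.range (modeP (F := F) Ω T k).toLinearMap
  have hG : OrthogonalFamily ℝ (fun k => G k) fun k => (G k).subtypeₗᵢ := by
    rintro k l hkl ⟨_, u, rfl⟩ ⟨_, v, rfl⟩
    exact inner_modeP_modeP hT hkl u v
  have hm : ∀ k, f k ∈ G k := fun k => ⟨f k, hf k⟩
  exact (hG.summable_iff_norm_sq_summable fun k => ⟨f k, hm k⟩).2 hs

lemma norm_sq_sum_modes (hT : 0 < T) {f : ℕ → Lp F 2 (muQ Ω T)} (hf : ∀ k, modeP Ω T k (f k) = f k)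
    (s : Finset ℕ) : ‖∑ k ∈ s, f k‖ ^ 2 = ∑ k ∈ s, ‖f k‖ ^ 2 := by
  rw [← real_inner_self_eq_norm_sq, sum_inner]
  refine Finset.sum_congr rfl fun k hk => ?_
  rw [inner_sum, Finset.sum_eq_single k, real_inner_self_eq_norm_sq]
  · intro l _ hlk
    rw [← hf k, ← hf l]
    exact inner_modeP_modeP hT hlk.symm _ _
  · exact fun h => absurd hk h

/-- Bessel's inequality makes the series of modes converge, and its limit differs from u by an
element without modes. The completeness `h0` of the trigonometric system is the only analytic input,
proved separately in `eq_zero_of_modes`. -/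
lemma hasSum_modeP_aux (hT : 0 < T) 
    (h0 : ∀ w : Lp F 2 (muQ Ω T), (∀ k, modeP Ω T k w = 0) → w = 0) (u : Lp F 2 (muQ Ω T)) :
    HasSum (fun k => modeP Ω T k u) u := by
  have hB : ∀ s : Finset ℕ, ∑ k ∈ s, ‖modeP Ω T k u‖ ^ 2 ≤ ‖u‖ ^ 2 := by
    intro s
    have h1 : ‖u - ∑ k ∈ s, modeP Ω T k u‖ ^ 2 = ‖u‖ ^ 2 - ∑ k ∈ s, ‖modeP Ω T k u‖ ^ 2 := by
      have h2 : inner ℝ u (∑ k ∈ s, modeP Ω T k u) = ∑ k ∈ s, ‖modeP Ω T k u‖ ^ 2 := by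
        rw [inner_sum]
        refine Finset.sum_congr rfl fun k _ => ?_
        rw [← real_inner_self_eq_norm_sq, inner_modeP_comm, modeP_modeP_self hT]
      rw [norm_sub_sq_real, h2, norm_sq_sum_modes hT fun k => modeP_modeP_self hT k u]; ring
    nlinarith [sq_nonneg ‖u - ∑ k ∈ s, modeP Ω T k u‖]
  have hs : Summable fun k => modeP Ω T k u :=
    summable_of_modes hT (fun k => modeP_modeP_self hT k u)
      (summable_of_sum_le (fun k => sq_nonneg _) hB)
  obtain ⟨v, hv⟩ := hs
  have : u - v = 0 := h0 _ fun l => by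
    have h1 := hv.mapL (modeP Ω T l)
    have h2 : HasSum (fun k => modeP Ω T l (modeP Ω T k u)) (modeP Ω T l u) := by
      simp only [modeP_modeP hT]
      simpa [eq_comm] using hasSum_ite_eq l (modeP Ω T l u)
    rw [map_sub, sub_eq_zero]
    exact h2.unique h1
  rw [sub_eq_zero] at this
  rwa [← this] at hv

end Modes
end

/-! ### Completeness of the Fourier system in time. -/

section

/-- A square integrable function with vanishing Fourier coefficients vanishes. -/
lemma ae_eq_zero_of_fourier {T : ℝ} (hT : 0 < T) {f : ℝ → ℝ}
    (hf : MemLp f 2 (volume.restrict (Ioo 0 T)))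
    (hc : ∀ k : ℕ, ∫ t in (0 : ℝ)..T, cosk T k t * f t = 0)
    (hs : ∀ k : ℕ, ∫ t in (0 : ℝ)..T, sink T k t * f t = 0) :
    ∀ᵐ t ∂(volume.restrict (Ioo 0 T)), f t = 0 := by
  have hfC : MemLp (fun t => (f t : ℂ)) 2 (volume.restrict (Ioc 0 T)) := by
    rw [← restrict_Ioo_eq_restrict_Ioc]; exact hf.ofReal
  have hfi : IntervalIntegrable f volume 0 T := by
    rw [intervalIntegrable_iff_integrableOn_Ioo_of_le hT.le]
    exact hf.integrable one_le_two
  have hcc : ∀ n : ℤ, ∫ t in (0 : ℝ)..T, Real.cos (n * freq T * t) * f t = 0 := by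
    intro n
    obtain ⟨k, rfl | rfl⟩ := n.eq_nat_or_neg
    · exact_mod_cast hc k
    · refine Eq.trans ?_ (hc k); simp [cosk]
  have hss : ∀ n : ℤ, ∫ t in (0 : ℝ)..T, Real.sin (n * freq T * t) * f t = 0 := by
    intro n
    obtain ⟨k, rfl | rfl⟩ := n.eq_nat_or_neg
    · exact_mod_cast hs k
    · rw [← neg_eq_zero, ← intervalIntegral.integral_neg]; refine Eq.trans ?_ (hs k); simp [sink]
  have h0 : ∀ n : ℤ, fourierCoeffOn hT (fun t => (f t : ℂ)) n = 0 := by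
    intro n
    rw [fourierCoeffOn_eq_integral]
    have h1 : ∀ t : ℝ, fourier (-n) (t : AddCircle (T - 0)) • (f t : ℂ)
        = ((Real.cos (n * freq T * t) * f t : ℝ) : ℂ)
          - ((Real.sin (n * freq T * t) * f t : ℝ) : ℂ) * Complex.I := by
      intro t
      rw [fourier_coe_apply, show 2 * (Real.pi : ℂ) * Complex.I * ((-n : ℤ) : ℂ) * t / ((T - 0 : ℝ) : ℂ)
        = ((-(n * freq T * t) : ℝ) : ℂ) * Complex.I by simp only [freq, sub_zero]; push_cast; ring,
        Complex.exp_mul_I, ← Complex.ofReal_cos, ← Complex.ofReal_sin, Real.cos_neg, Real.sin_neg,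
        smul_eq_mul]
      push_cast; ring
    simp_rw [h1]
    have hi1 : IntervalIntegrable (fun t => Real.cos (n * freq T * t) * f t) volume 0 T :=
      hfi.continuousOn_mul (by fun_prop)
    have hi2 : IntervalIntegrable (fun t => Real.sin (n * freq T * t) * f t) volume 0 T :=
      hfi.continuousOn_mul (by fun_prop)
    have hiC : ∀ g : ℝ → ℝ, IntervalIntegrable g volume 0 T →
        IntervalIntegrable (fun t => (g t : ℂ)) volume 0 T := fun g hg => by
      rw [intervalIntegrable_iff_integrableOn_Ioo_of_le hT.le] at hg ⊢
      exact hg.integrable.ofReal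
    rw [intervalIntegral.integral_sub (hiC _ hi1) ((hiC _ hi2).mul_const _),
      intervalIntegral.integral_mul_const, intervalIntegral.integral_ofReal,
      intervalIntegral.integral_ofReal, hcc, hss]
    simp
  have h1 := hasSum_sq_fourierCoeffOn hT hfC
  simp only [h0, norm_zero, ne_eq, OfNat.ofNat_ne_zero, not_false_eq_true, zero_pow] at h1
  have h2 := hasSum_zero.unique h1
  have h3 : ∫ t in Ioo 0 T, ‖f t‖ ^ 2 = 0 := by
    rw [intervalIntegral.integral_of_le hT.le, integral_Ioc_eq_integral_Ioo] at h2
    simpa [hT.ne'] using h2.symm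
  rw [integral_eq_zero_iff_of_nonneg (fun t => by positivity) hf.integrable_norm_pow'] at h3
  filter_upwards [h3] with t ht
  simpa using ht

section Completeness
variable {d : ℕ} {Ω : Set (E d)} {T : ℝ} {F : Type*} [NormedAddCommGroup F]
  [InnerProductSpace ℝ F] [CompleteSpace F] [SecondCountableTopology F]

/-- For almost every x all the countably many Fourier coefficients of the slice w(x, ·) vanish, so
Parseval on the interval kills the slice. -/
lemma eq_zero_of_modes (hΩ : Bornology.IsBounded Ω) (hT : 0 < T) (w : Lp F 2 (muQ Ω T))
    (h : ∀ k, modeP Ω T k w = 0) : w = 0 := by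
  have := isFiniteMeasure_muQ hΩ T
  have hC : ∀ k, cC Ω T k w = 0 := fun k => by
    have := cC_modeP hT k k w
    rw [h, map_zero, if_pos rfl] at this; exact this.symm
  have hS : ∀ k, cS Ω T k w = 0 := fun k => by
    have := cS_modeP hT k k w
    rw [h, map_zero, if_pos rfl] at this; exact this.symm
  have hi : Integrable (fun z => w z) (muQ Ω T) := (Lp.memLp w).integrable one_le_two
  have hi2 : Integrable (fun z => ‖w z‖ ^ 2) (muQ Ω T) := by
    simpa using (Lp.memLp w).integrable_norm_pow'
  have h0 : ∀ᵐ x ∂(volume.restrict Ω), (0 : Lp F 2 (muX Ω T)) x = 0 :=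
    (ae_muX_iff hT).1 (Lp.coeFn_zero F 2 (muX Ω T))
  have hc : ∀ᵐ x ∂(volume.restrict Ω), ∀ k, ∫ t in (0 : ℝ)..T, cosk T k t • w (x, t) = 0 := by
    refine ae_all_iff.2 fun k => ?_
    filter_upwards [coeFn_tcoef hΩ hT (continuous_cosk T k) w, h0] with x h1 h2
    rw [show tcoef Ω T (cosk T k) w = 0 from hC k, h2] at h1
    simpa [hT.ne'] using h1.symm
  have hs : ∀ᵐ x ∂(volume.restrict Ω), ∀ k, ∫ t in (0 : ℝ)..T, sink T k t • w (x, t) = 0 := by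
    refine ae_all_iff.2 fun k => ?_
    filter_upwards [coeFn_tcoef hΩ hT (continuous_sink T k) w, h0] with x h1 h2
    rw [show tcoef Ω T (sink T k) w = 0 from hS k, h2] at h1
    simpa [hT.ne'] using h1.symm
  have hw : ∀ᵐ x ∂(volume.restrict Ω), ∫ t in (0 : ℝ)..T, ‖w (x, t)‖ ^ 2 = 0 := by
    filter_upwards [hc, hs, ae_intervalIntegrable hT hi, ae_intervalIntegrable hT hi2]
      with x hcx hsx hix hi2x
    have hL : MemLp (fun t => w (x, t)) 2 (volume.restrict (Ioo 0 T)) := by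
      rw [intervalIntegrable_iff_integrableOn_Ioo_of_le hT.le] at hix hi2x
      refine (integrable_norm_rpow_iff hix.1 two_ne_zero ENNReal.ofNat_ne_top).1 ?_
      simpa using hi2x.integrable
    have hz : ∀ᵐ t ∂(volume.restrict (Ioo 0 T)), w (x, t) = 0 := by
      -- The one-dimensional statement is scalar, so it is applied to the components ⟨c, w(x, ·)⟩;
      -- separability of F recovers the vector-valued slice.
      refine ae_eq_zero_of_forall_inner (𝕜 := ℝ) fun c => ?_
      refine ae_eq_zero_of_fourier hT (hL.const_inner c) (fun k => ?_) fun k => ?_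
      · simp_rw [← real_inner_smul_right, intervalIntegral.integral_of_le hT.le]
        rw [integral_inner (hix.continuousOn_smul (continuous_cosk T k).continuousOn).1,
          ← intervalIntegral.integral_of_le hT.le, hcx, inner_zero_right]
      · simp_rw [← real_inner_smul_right, intervalIntegral.integral_of_le hT.le]
        rw [integral_inner (hix.continuousOn_smul (continuous_sink T k).continuousOn).1,
          ← intervalIntegral.integral_of_le hT.le, hsx, inner_zero_right]
    rw [intervalIntegral.integral_of_le hT.le, integral_Ioc_eq_integral_Ioo]
    refine integral_eq_zero_of_ae ?_
    filter_upwards [hz] with t ht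
    simp [ht]
  rw [← norm_eq_zero, ← sq_eq_zero_iff, ← real_inner_self_eq_norm_sq, L2.inner_def]
  simp_rw [real_inner_self_eq_norm_sq]
  rw [integral_muQ hT hi2]
  exact integral_eq_zero_of_ae hw

lemma hasSum_modeP (hΩ : Bornology.IsBounded Ω) (hT : 0 < T) (u : Lp F 2 (muQ Ω T)) :
    HasSum (fun k => modeP Ω T k u) u :=
  hasSum_modeP_aux hT (eq_zero_of_modes hΩ hT) u

end Completeness

/-! ### The half-derivative norm and form in terms of modes. -/

section Half
variable {d : ℕ} {Ω : Set (E d)} {T : ℝ}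

lemma coefC_ae (hΩ : Bornology.IsBounded Ω) (hT : 0 < T) (u : L2Q Ω T) (k : ℕ) :
    ∀ᵐ x ∂(volume.restrict Ω), coefC u k x = 2 * cC Ω T k u x := by
  filter_upwards [coeFn_tcoef hΩ hT (continuous_cosk T k) u] with x hx
  rw [cC, hx, coefC, smul_eq_mul, ← mul_assoc, ← div_eq_mul_inv]
  congr 1
  refine intervalIntegral.integral_congr fun t _ => ?_
  simp [cosk, mul_comm]

lemma coefS_ae (hΩ : Bornology.IsBounded Ω) (hT : 0 < T) (u : L2Q Ω T) (k : ℕ) :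
    ∀ᵐ x ∂(volume.restrict Ω), coefS u k x = 2 * cS Ω T k u x := by
  filter_upwards [coeFn_tcoef hΩ hT (continuous_sink T k) u] with x hx
  rw [cS, hx, coefS, smul_eq_mul, ← mul_assoc, ← div_eq_mul_inv]
  congr 1
  refine intervalIntegral.integral_congr fun t _ => ?_
  simp [sink, mul_comm]

lemma integrable_muX_iff (hT : 0 < T) {f : E d → ℝ} :
    Integrable f (muX Ω T) ↔ Integrable f (volume.restrict Ω) := by
  rw [muX_eq, integrable_smul_measure (by simpa using hT) ENNReal.ofReal_ne_top]

lemma inner_muX (hT : 0 < T) (f g : Lp ℝ 2 (muX Ω T)) :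
    inner ℝ f g = T * ∫ x in Ω, f x * g x := by
  rw [L2.inner_def, integral_muX hT, smul_eq_mul]
  simp_rw [mul_comm (f _)]; rfl

lemma integrable_mul_muX (hT : 0 < T) (f g : Lp ℝ 2 (muX Ω T)) :
    Integrable (fun x => f x * g x) (volume.restrict Ω) := by
  exact (integrable_muX_iff hT).1 (L2.integrable_inner (𝕜 := ℝ) g f)

/-- The factor 2/T combines three normalizations: the coefficients `coefC`, `coefS` are twice the
means `cC`, `cS`, the weight of an oscillating mode is 2, and `muX` carries T. It cancels the
prefactor T/2 of the half norm. -/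
lemma halfTerm_eq (hΩ : Bornology.IsBounded Ω) (hT : 0 < T) (u : L2Q Ω T) (k : ℕ) :
    halfTerm u k = 2 / T * (k * freq T * ‖modeP Ω T k u‖ ^ 2) := by
  rcases eq_or_ne k 0 with rfl | hk
  · simp [halfTerm]
  have h : ∫ x in Ω, (coefC u k x ^ 2 + coefS u k x ^ 2)
      = 4 * (∫ x in Ω, cC Ω T k u x * cC Ω T k u x) + 4 * ∫ x in Ω, cS Ω T k u x * cS Ω T k u x := by
    rw [← integral_const_mul, ← integral_const_mul, ← integral_add
      ((integrable_mul_muX hT _ _).const_mul _) ((integrable_mul_muX hT _ _).const_mul _)]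
    refine integral_congr_ae ?_
    filter_upwards [coefC_ae hΩ hT u k, coefS_ae hΩ hT u k] with x h1 h2
    rw [h1, h2]; ring
  rw [halfTerm, h, norm_sq_modeP k u hT, ← real_inner_self_eq_norm_sq, ← real_inner_self_eq_norm_sq,
    inner_muX hT, inner_muX hT, wt, if_neg hk]
  field_simp; ring

lemma memHalf_iff (hΩ : Bornology.IsBounded Ω) (hT : 0 < T) (u : L2Q Ω T) :
    MemHalf Ω T u ↔ Summable fun k : ℕ => k * freq T * ‖modeP Ω T k u‖ ^ 2 := by
  rw [MemHalf, show halfTerm u = _ from funext (halfTerm_eq hΩ hT u),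
    summable_mul_left_iff (by positivity)]

lemma halfNormSq_eq (hΩ : Bornology.IsBounded Ω) (hT : 0 < T) (u : L2Q Ω T) :
    halfNormSq u = ∑' k : ℕ, k * freq T * ‖modeP Ω T k u‖ ^ 2 := by
  rw [halfNormSq, show halfTerm u = _ from funext (halfTerm_eq hΩ hT u), tsum_mul_left, ← mul_assoc]
  rw [show T / 2 * (2 / T) = 1 by field_simp, one_mul]

lemma halfForm_eq (hΩ : Bornology.IsBounded Ω) (hT : 0 < T) {σ : E d → ℝ}
    (hσ : MemLp σ ⊤ (muX Ω T)) (y q : L2Q Ω T) :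
    halfForm σ y q
      = ∑' k : ℕ, k * freq T * inner ℝ (mulOp (muQ Ω T) (fun z => σ z.1) (modeJ Ω T k y)) q := by
  rw [halfForm, ← tsum_mul_left]
  refine tsum_congr fun k => ?_
  have h : ∫ x in Ω, σ x * (coefC y k x * (-(coefS q k x)) + coefS y k x * coefC q k x)
      = 4 * (∫ x in Ω, mulOp (muX Ω T) σ (cS Ω T k y) x * cC Ω T k q x)
        - 4 * ∫ x in Ω, mulOp (muX Ω T) σ (cC Ω T k y) x * cS Ω T k q x := by
    rw [← integral_const_mul, ← integral_const_mul, ← integral_sub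
      ((integrable_mul_muX hT _ _).const_mul _) ((integrable_mul_muX hT _ _).const_mul _)]
    refine integral_congr_ae ?_
    filter_upwards [coefC_ae hΩ hT y k, coefS_ae hΩ hT y k, coefC_ae hΩ hT q k,
      coefS_ae hΩ hT q k, (ae_muX_iff hT).1 (coeFn_mulOp hσ (cS Ω T k y)),
      (ae_muX_iff hT).1 (coeFn_mulOp hσ (cC Ω T k y))] with x h1 h2 h3 h4 h5 h6
    rw [h1, h2, h3, h4, h5, h6, smul_eq_mul, smul_eq_mul]; ring
  rw [h, modeJ_apply, map_smul, map_sub, eC, eS, mulOp_fst_tsyn hσ (continuous_cosk T k),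
    mulOp_fst_tsyn hσ (continuous_sink T k), real_inner_smul_left, inner_sub_left,
    ← inner_tcoef_right, ← inner_tcoef_right, inner_muX hT, inner_muX hT]
  simp only [cC, cS]
  field_simp; ring

end Half
end

/-! ### Differentiation under the time integral; smooth test functions and time cutoffs. -/

section

section Parametric
variable {d : ℕ} {G : Type*} [NormedAddCommGroup G] [NormedSpace ℝ G]

lemma hasFDerivAt_integral_param (T : ℝ) {f : E d × ℝ → G} {D : E d × ℝ → E d →L[ℝ] G}
    (hf : Continuous f) (hD : Continuous D)
    (h : ∀ x t, HasFDerivAt (fun y => f (y, t)) (D (x, t)) x) (x : E d) :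
    HasFDerivAt (fun x => ∫ t in (0 : ℝ)..T, f (x, t)) (∫ t in (0 : ℝ)..T, D (x, t)) x := by
  obtain ⟨C, hC⟩ := ((isCompact_closedBall x 1).prod (isCompact_uIcc (a := 0) (b := T))
    ).exists_bound_of_continuousOn hD.continuousOn
  refine (intervalIntegral.hasFDerivAt_integral_of_dominated_of_fderiv_le (𝕜 := ℝ)
    (F' := fun x t => D (x, t))
    (bound := fun _ => C) (Metric.closedBall_mem_nhds x one_pos) ?_ ?_ ?_ ?_ ?_ ?_)
  · exact Eventually.of_forall fun y => Continuous.aestronglyMeasurable (by fun_prop)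
  · exact Continuous.intervalIntegrable (by fun_prop) _ _
  · exact Continuous.aestronglyMeasurable (by fun_prop)
  · exact Eventually.of_forall fun t ht y hy => hC (y, t) ⟨hy, uIoc_subset_uIcc ht⟩
  · exact intervalIntegrable_const
  · exact Eventually.of_forall fun t _ y _ => h y t

lemma hasFDerivAt_slice {f : E d × ℝ → G} (hf : Differentiable ℝ f) (x : E d) (t : ℝ) :
    HasFDerivAt (fun y => f (y, t))
      ((fderiv ℝ f (x, t)).comp (ContinuousLinearMap.inl ℝ (E d) ℝ)) x :=
  HasFDerivAt.comp (g := f) x (hf (x, t)).hasFDerivAt (hasFDerivAt_prodMk_left x t)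

/-- Induction on the order of smoothness. The codomain G is generalized because the x-derivative, to
which the induction hypothesis is applied, takes values in E d →L[ℝ] G. -/
lemma contDiff_integral_param (T : ℝ) (n : ℕ) : ∀ {G : Type*} [NormedAddCommGroup G]
    [NormedSpace ℝ G] {f : E d × ℝ → G}, ContDiff ℝ n f →
    ContDiff ℝ n (fun x => ∫ t in (0 : ℝ)..T, f (x, t)) := by
  induction n with
  | zero =>
    intro G _ _ f hf
    rw [Nat.cast_zero, contDiff_zero] at hf ⊢
    exact intervalIntegral.continuous_parametric_intervalIntegral_of_continuous'
      (f := fun x t => f (x, t)) hf 0 T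
  | succ n ih =>
    intro G _ _ f hf
    have hD : ContDiff ℝ n
        (fun z => (fderiv ℝ f z).comp (ContinuousLinearMap.inl ℝ (E d) ℝ)) :=
      (hf.fderiv_right (m := n) (by norm_cast)).clm_comp contDiff_const
    have h := hasFDerivAt_integral_param T hf.continuous hD.continuous
      fun x t => hasFDerivAt_slice (hf.differentiable (by simp)) x t
    rw [show ((n + 1 : ℕ) : WithTop ℕ∞) = (n : WithTop ℕ∞) + 1 by norm_cast,
      contDiff_succ_iff_fderiv]
    refine ⟨fun x => (h x).differentiableAt, by simp, ?_⟩
    rw [show fderiv ℝ (fun x => ∫ t in (0 : ℝ)..T, f (x, t)) = _ from funext fun x => (h x).fderiv]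
    exact ih hD

end Parametric

section Smooth
variable {d : ℕ} {Ω : Set (E d)} {T : ℝ} {φ ψ : E d × ℝ → ℝ}

lemma inner_spaceGrad (hφ : ContDiff ℝ ∞ φ) (z : E d × ℝ) (e : E d) :
    inner ℝ (spaceGrad φ z) e = fderiv ℝ φ z (e, 0) := by
  have h := hasFDerivAt_slice (hφ.differentiable (by simp)) z.1 z.2
  rw [spaceGrad, gradient, h.fderiv, InnerProductSpace.toDual_symm_apply]
  simp

lemma spaceGrad_eq (hφ : ContDiff ℝ ∞ φ) (z : E d × ℝ) :
    spaceGrad φ z = (InnerProductSpace.toDual ℝ (E d)).symm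
      ((fderiv ℝ φ z).comp (ContinuousLinearMap.inl ℝ (E d) ℝ)) := by
  rw [spaceGrad, gradient, (hasFDerivAt_slice (hφ.differentiable (by simp)) z.1 z.2).fderiv]

lemma timeDeriv_eq (hφ : ContDiff ℝ ∞ φ) (z : E d × ℝ) :
    timeDeriv φ z = fderiv ℝ φ z (0, 1) := by
  have h : HasFDerivAt (fun t => φ (z.1, t)) _ z.2 :=
    HasFDerivAt.comp (g := φ) z.2 ((hφ.differentiable (by simp)) (z.1, z.2)).hasFDerivAt
      (hasFDerivAt_prodMk_right z.1 z.2)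
  rw [timeDeriv, h.hasDerivAt.deriv]
  simp

lemma contDiff_spaceGrad (hφ : ContDiff ℝ ∞ φ) : ContDiff ℝ ∞ (spaceGrad φ) := by
  rw [show spaceGrad φ = _ from funext (spaceGrad_eq hφ)]
  exact (InnerProductSpace.toDual ℝ (E d)).symm.contDiff.comp
    ((hφ.fderiv_right (m := ∞) (by simp)).clm_comp contDiff_const)

lemma contDiff_timeDeriv (hφ : ContDiff ℝ ∞ φ) : ContDiff ℝ ∞ (timeDeriv φ) := by
  rw [show timeDeriv φ = _ from funext (timeDeriv_eq hφ)]
  exact (hφ.fderiv_right (m := ∞) (by simp)).clm_apply contDiff_const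

lemma spaceGrad_mul_snd (χ : ℝ → ℝ) (z : E d × ℝ) (hφ : ContDiff ℝ ∞ φ) :
    spaceGrad (fun z => χ z.2 * φ z) z = χ z.2 • spaceGrad φ z := by
  have h := hasFDerivAt_slice (hφ.differentiable (by simp)) z.1 z.2
  simp only [spaceGrad, gradient]
  rw [(h.const_mul (χ z.2)).fderiv, h.fderiv, map_smul]

/-- Continuous functions that vanish near the lateral boundary. -/
def LatSupp {F : Type*} [NormedAddCommGroup F] (Ω : Set (E d)) (f : E d × ℝ → F) : Prop :=
  Continuous f ∧ ∃ K : Set (E d), IsCompact K ∧ K ⊆ Ω ∧ ∀ x ∉ K, ∀ t, f (x, t) = 0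

lemma LatSupp.memLp {F : Type*} [NormedAddCommGroup F] {f : E d × ℝ → F} (hf : LatSupp Ω f)
    (hΩ : Bornology.IsBounded Ω) (T : ℝ) (p : ENNReal) : MemLp f p (muQ Ω T) := by
  have := isFiniteMeasure_muQ hΩ T
  obtain ⟨K, hK, -, h0⟩ := hf.2
  obtain ⟨C, hC⟩ := (hK.prod (isCompact_Icc (a := 0) (b := T))).exists_bound_of_continuousOn
    hf.1.continuousOn
  refine MemLp.of_bound hf.1.aestronglyMeasurable (max C 0) ?_
  rw [muQ_eq]
  refine (Measure.quasiMeasurePreserving_snd.ae (p := fun t => t ∈ Ioo 0 T)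
    (ae_restrict_mem measurableSet_Ioo)).mono fun z hz => ?_
  by_cases hzK : z.1 ∈ K
  · exact (hC z ⟨hzK, Ioo_subset_Icc_self hz⟩).trans (le_max_left _ _)
  · rw [show f z = 0 from h0 z.1 hzK z.2, norm_zero]; exact le_max_right _ _

lemma IsLateralTest.latSupp (h : IsLateralTest Ω φ) : LatSupp Ω φ := ⟨h.1.continuous, h.2⟩

lemma IsLateralTest.latSupp_spaceGrad (h : IsLateralTest Ω φ) : LatSupp Ω (spaceGrad φ) := by
  refine ⟨(contDiff_spaceGrad h.1).continuous, ?_⟩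
  obtain ⟨K, hK, hKΩ, h0⟩ := h.2
  refine ⟨K, hK, hKΩ, fun x hx t => ?_⟩
  have h1 : (fun y => φ (y, t)) =ᶠ[𝓝 x] fun _ => 0 := by
    filter_upwards [hK.isClosed.isOpen_compl.mem_nhds hx] with y hy using h0 y hy t
  rw [spaceGrad, gradient, h1.fderiv_eq]
  simp

lemma IsTest.isLateralTest (h : IsTest Ω T φ) : IsLateralTest Ω φ := by
  refine ⟨h.1, Prod.fst '' tsupport φ, h.2.1.isCompact.image continuous_fst, ?_, ?_⟩
  · rintro _ ⟨z, hz, rfl⟩; exact (h.2.2 hz).1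
  · intro x hx t
    by_contra hne
    exact hx ⟨(x, t), subset_tsupport _ hne, rfl⟩

lemma IsTest.latSupp_timeDeriv (h : IsTest Ω T φ) : LatSupp Ω (timeDeriv φ) := by
  refine ⟨(contDiff_timeDeriv h.1).continuous, ?_⟩
  obtain ⟨K, hK, hKΩ, h0⟩ := h.isLateralTest.2
  exact ⟨K, hK, hKΩ, fun x hx t => by simp [timeDeriv, h0 x hx]⟩

/-- Functions with vanishing moments against all test functions vanish. -/
lemma eq_zero_of_test {F : Type*} [NormedAddCommGroup F] [NormedSpace ℝ F] [CompleteSpace F]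
    (hΩo : IsOpen Ω) (hΩ : Bornology.IsBounded Ω) (f : Lp F 2 (muQ Ω T))
    (h : ∀ φ, IsTest Ω T φ → ∫ z, φ z • f z ∂(muQ Ω T) = 0) : f = 0 := by
  have := isFiniteMeasure_muQ hΩ T
  have ho : IsOpen (cyl Ω T) := hΩo.prod isOpen_Ioo
  have hi : IntegrableOn f (cyl Ω T) volume := (Lp.memLp f).integrable one_le_two
  have h1 := ho.ae_eq_zero_of_integral_contDiff_smul_eq_zero hi.locallyIntegrableOn
    (fun φ h1 h2 h3 => by
      rw [← h φ ⟨h1, h2, h3⟩]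
      refine (setIntegral_eq_integral_of_forall_compl_eq_zero fun z hz => ?_).symm
      rw [image_eq_zero_of_notMem_tsupport fun hz' => hz (h3 hz'), zero_smul])
  ext1
  filter_upwards [(ae_restrict_iff' ho.measurableSet).2 h1, Lp.coeFn_zero F 2 (muQ Ω T)] with z hz h0
  rw [hz, h0]; rfl

end Smooth

section Cutoff

/-- Smooth cutoff functions on `(0,T)`. -/
def cutoff (T : ℝ) (n : ℕ) (t : ℝ) : ℝ :=
  Real.smoothTransition ((n + 1) * t - 1) * Real.smoothTransition ((n + 1) * (T - t) - 1)

lemma contDiff_cutoff (T : ℝ) (n : ℕ) : ContDiff ℝ ∞ (cutoff T n) := by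
  unfold cutoff
  exact (Real.smoothTransition.contDiff.comp (by fun_prop)).mul
    (Real.smoothTransition.contDiff.comp (by fun_prop))

lemma cutoff_nonneg (T : ℝ) (n : ℕ) (t : ℝ) : 0 ≤ cutoff T n t :=
  mul_nonneg (Real.smoothTransition.nonneg _) (Real.smoothTransition.nonneg _)

lemma cutoff_le_one (T : ℝ) (n : ℕ) (t : ℝ) : cutoff T n t ≤ 1 :=
  mul_le_one₀ (Real.smoothTransition.le_one _) (Real.smoothTransition.nonneg _)
    (Real.smoothTransition.le_one _)

lemma cutoff_eq_zero {T : ℝ} {n : ℕ} {t : ℝ}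
    (ht : t ∉ Icc (1 / (n + 1 : ℝ)) (T - 1 / (n + 1 : ℝ))) : cutoff T n t = 0 := by
  have hn : (0 : ℝ) < n + 1 := by positivity
  rw [mem_Icc, not_and_or, not_le, not_le] at ht
  rcases ht with ht | ht
  · rw [cutoff, Real.smoothTransition.zero_of_nonpos, zero_mul]
    rw [lt_div_iff₀ hn] at ht; linarith
  · rw [cutoff, Real.smoothTransition.zero_of_nonpos (x := (n + 1) * (T - t) - 1), mul_zero]
    have : T - t < 1 / (n + 1 : ℝ) := by linarith
    rw [lt_div_iff₀ hn] at this; linarith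

lemma cutoff_eq_one {T : ℝ} {n : ℕ} {t : ℝ} (h1 : 2 / (n + 1 : ℝ) ≤ t)
    (h2 : t ≤ T - 2 / (n + 1 : ℝ)) : cutoff T n t = 1 := by
  have hn : (0 : ℝ) < n + 1 := by positivity
  have h3 : 2 / (n + 1 : ℝ) ≤ T - t := by linarith
  rw [div_le_iff₀ hn] at h1 h3
  rw [cutoff, Real.smoothTransition.one_of_one_le (by linarith),
    Real.smoothTransition.one_of_one_le (by linarith), one_mul]

lemma tendsto_two_div : Tendsto (fun n : ℕ => 2 / (n + 1 : ℝ)) atTop (𝓝 0) := by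
  simpa [div_eq_mul_inv] using (tendsto_one_div_add_atTop_nhds_zero_nat (𝕜 := ℝ)).const_mul 2

lemma tendsto_cutoff {T t : ℝ} (ht : t ∈ Ioo 0 T) :
    Tendsto (fun n => cutoff T n t) atTop (𝓝 1) := by
  refine tendsto_const_nhds.congr' ?_
  filter_upwards [tendsto_two_div.eventually_le_const ht.1,
    tendsto_two_div.eventually_le_const (sub_pos.2 ht.2)] with n h1 h2
  exact (cutoff_eq_one h1 (by linarith)).symm

lemma tsupport_cutoff_mul_subset {T : ℝ} (n : ℕ) : 
    Icc (1 / (n + 1 : ℝ)) (T - 1 / (n + 1 : ℝ)) ⊆ Ioo 0 T := by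
  have hn : (0 : ℝ) < 1 / (n + 1 : ℝ) := by positivity
  exact fun t ht => ⟨hn.trans_le ht.1, by linarith [ht.2]⟩

lemma IsLateralTest.cutoff_mul {d : ℕ} {Ω : Set (E d)} {φ : E d × ℝ → ℝ} (h : IsLateralTest Ω φ)
    (T : ℝ) (n : ℕ) : IsTest Ω T (fun z => cutoff T n z.2 * φ z) := by
  obtain ⟨K, hK, hKΩ, h0⟩ := h.2
  have hc := hK.prod (isCompact_Icc (a := 1 / (n + 1 : ℝ)) (b := T - 1 / (n + 1 : ℝ)))
  have hs : tsupport (fun z => cutoff T n z.2 * φ z) ⊆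
      K ×ˢ Icc (1 / (n + 1 : ℝ)) (T - 1 / (n + 1 : ℝ)) := by
    refine closure_minimal (fun z hz => ?_) hc.isClosed
    by_contra hzn
    refine hz ?_
    rw [mem_prod, not_and_or] at hzn
    rcases hzn with hz1 | hz2
    · simp only; rw [show φ z = 0 from h0 z.1 hz1 z.2, mul_zero]
    · simp only; rw [cutoff_eq_zero hz2, zero_mul]
  refine ⟨((contDiff_cutoff T n).comp contDiff_snd).mul h.1,
    hc.of_isClosed_subset (isClosed_tsupport _) hs, hs.trans ?_⟩
  exact prod_mono hKΩ (tsupport_cutoff_mul_subset n)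

end Cutoff
end

section
variable {d : ℕ} {Ω : Set (E d)} {T : ℝ} {φ ψ : E d × ℝ → ℝ}

/-! ### Uniqueness and weak formulations of the derivatives in the cylinder. -/

section Weak

lemma LatSupp.integrable_smul {F : Type*} [NormedAddCommGroup F] [NormedSpace ℝ F]
    (hΩ : Bornology.IsBounded Ω) {f : E d × ℝ → ℝ} (hf : LatSupp Ω f) (u : Lp F 2 (muQ Ω T)) :
    Integrable (fun z => f z • u z) (muQ Ω T) :=
  memLp_one_iff_integrable.1 ((Lp.memLp u).smul (hf.memLp hΩ T 2))

lemma hasWeakGrad_unique (hΩo : IsOpen Ω) (hΩ : Bornology.IsBounded Ω) {u : L2Q Ω T}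
    {g g' : L2Qvec Ω T} (h : HasWeakGrad Ω T u g) (h' : HasWeakGrad Ω T u g') : g = g' := by
  rw [← sub_eq_zero]
  refine eq_zero_of_test hΩo hΩ _ fun φ hφ => ?_
  have h1 : ∫ z, φ z • (g - g') z ∂(muQ Ω T) = ∫ z, (φ z • g z - φ z • g' z) ∂(muQ Ω T) := by
    refine integral_congr_ae ?_
    filter_upwards [Lp.coeFn_sub g g'] with z hz
    rw [hz, Pi.sub_apply, smul_sub]
  rw [h1, integral_sub (hφ.isLateralTest.latSupp.integrable_smul hΩ g)
    (hφ.isLateralTest.latSupp.integrable_smul hΩ g'), ← neg_neg (∫ z, φ z • g z ∂_), ← h φ hφ,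
    h' φ hφ]
  simp

lemma eq_of_test_mul (hΩo : IsOpen Ω) (hΩ : Bornology.IsBounded Ω) {w w' : L2Q Ω T}
    (h : ∀ φ, IsTest Ω T φ → ∫ z, w z * φ z ∂(muQ Ω T) = ∫ z, w' z * φ z ∂(muQ Ω T)) :
    w = w' := by
  rw [← sub_eq_zero]
  refine eq_zero_of_test hΩo hΩ _ fun φ hφ => ?_
  have h1 : ∫ z, φ z • (w - w') z ∂(muQ Ω T) = ∫ z, (φ z • w z - φ z • w' z) ∂(muQ Ω T) := by
    refine integral_congr_ae ?_
    filter_upwards [Lp.coeFn_sub w w'] with z hz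
    rw [hz, Pi.sub_apply, smul_sub]
  rw [h1, integral_sub (hφ.isLateralTest.latSupp.integrable_smul hΩ w)
    (hφ.isLateralTest.latSupp.integrable_smul hΩ w'), sub_eq_zero]
  simpa [mul_comm] using h φ hφ

lemma grad_eq (hΩo : IsOpen Ω) (hΩ : Bornology.IsBounded Ω) {u : L2Q Ω T}
    {g : L2Qvec Ω T} (h : HasWeakGrad Ω T u g) : grad u = g := by
  have h' : ∃ g, HasWeakGrad Ω T u g := ⟨g, h⟩
  rw [grad, dif_pos h']
  exact hasWeakGrad_unique hΩo hΩ h'.choose_spec h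

lemma dt_eq (hΩo : IsOpen Ω) (hΩ : Bornology.IsBounded Ω) {u w : L2Q Ω T}
    (h : HasWeakTimeDeriv Ω T u w) : dt u = w := by
  have h' : ∃ w, HasWeakTimeDeriv Ω T u w := ⟨w, h⟩
  rw [dt, dif_pos h']
  refine eq_of_test_mul hΩo hΩ fun φ hφ => ?_
  rw [← neg_inj, ← h'.choose_spec φ hφ, h φ hφ]

lemma dvg_eq (hΩo : IsOpen Ω) (hΩ : Bornology.IsBounded Ω) {τ : L2Qvec Ω T} {w : L2Q Ω T}
    (h : HasWeakDiv Ω T τ w) : dvg τ = w := by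
  have h' : ∃ w, HasWeakDiv Ω T τ w := ⟨w, h⟩
  rw [dvg, dif_pos h']
  refine eq_of_test_mul hΩo hΩ fun φ hφ => ?_
  rw [← neg_inj, ← h'.choose_spec φ hφ, h φ hφ]

lemma hasWeakTimeDeriv_dt {u : L2Q Ω T} (h : ∃ w, HasWeakTimeDeriv Ω T u w) :
    HasWeakTimeDeriv Ω T u (dt u) := by
  rw [dt, dif_pos h]; exact h.choose_spec

lemma hasWeakDiv_dvg {τ : L2Qvec Ω T} (h : MemHdiv Ω T τ) : HasWeakDiv Ω T τ (dvg τ) := by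
  have h' : ∃ w, HasWeakDiv Ω T τ w := h
  rw [dvg, dif_pos h']; exact h'.choose_spec

lemma LatSupp.inner_toLp {F : Type*} [NormedAddCommGroup F] [InnerProductSpace ℝ F]
    (hΩ : Bornology.IsBounded Ω) {f : E d × ℝ → F} (hf : LatSupp Ω f) (u : Lp F 2 (muQ Ω T)) :
    inner ℝ u ((hf.memLp hΩ T 2).toLp f) = ∫ z, inner ℝ (u z) (f z) ∂(muQ Ω T) := by
  rw [L2.inner_def]
  refine integral_congr_ae ?_
  filter_upwards [(hf.memLp hΩ T 2).coeFn_toLp] with z hz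
  rw [hz]

lemma LatSupp.inner_const {f : E d × ℝ → E d} (hf : LatSupp Ω f) (e : E d) :
    LatSupp Ω (fun z => inner ℝ (f z) e) := by
  obtain ⟨hc, K, h1, h2, h3⟩ := hf
  exact ⟨by fun_prop, K, h1, h2, fun x hx t => by simp only [h3 x hx, inner_zero_left]⟩

lemma LatSupp.smul_const {f : E d × ℝ → ℝ} (hf : LatSupp Ω f) (e : E d) :
    LatSupp Ω (fun z => f z • e) := by
  obtain ⟨hc, K, h1, h2, h3⟩ := hf
  exact ⟨by fun_prop, K, h1, h2, fun x hx t => by simp only [h3 x hx, zero_smul]⟩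

/-- Pairing the vector identity with each constant vector e turns it into equalities of L² inner
products, which are visibly stable under limits of (u, g). -/
lemma hasWeakGrad_iff (hΩ : Bornology.IsBounded Ω) (u : L2Q Ω T) (g : L2Qvec Ω T) :
    HasWeakGrad Ω T u g ↔ ∀ ψ, IsTest Ω T ψ → ∀ e : E d,
      ∫ z, inner ℝ (u z) (inner ℝ (spaceGrad ψ z) e) ∂(muQ Ω T)
        = -∫ z, inner ℝ (g z) (ψ z • e) ∂(muQ Ω T) := by
  refine forall₂_congr fun ψ hψ => ?_
  have h1 : Integrable (fun z => u z • spaceGrad ψ z) (muQ Ω T) :=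
    memLp_one_iff_integrable.1 ((hψ.isLateralTest.latSupp_spaceGrad.memLp hΩ T 2).smul (Lp.memLp u))
  have h2 := hψ.isLateralTest.latSupp.integrable_smul hΩ g
  have h3 : ∀ e : E d, ∫ z, inner ℝ (u z) (inner ℝ (spaceGrad ψ z) e) ∂(muQ Ω T)
      = inner ℝ e (∫ z, u z • spaceGrad ψ z ∂(muQ Ω T)) := fun e => by
    rw [← integral_inner h1]
    simp_rw [real_inner_smul_right, real_inner_comm e]
    exact integral_congr_ae (.of_forall fun z => mul_comm _ _)
  have h4 : ∀ e : E d, -∫ z, inner ℝ (g z) (ψ z • e) ∂(muQ Ω T)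
      = inner ℝ e (-∫ z, ψ z • g z ∂(muQ Ω T)) := fun e => by
    rw [inner_neg_right, ← integral_inner h2]
    simp_rw [real_inner_smul_right, real_inner_comm e]
  simp_rw [h3, h4]
  exact ⟨fun h e => by rw [h], fun h => ext_inner_left ℝ h⟩

end Weak

/-! ### H^{1,0}_0(Q) as the closure of a graph, and Friedrichs' inequality. -/

section GraphSpace

/-- The graph of the gradient on smooth functions vanishing near the lateral boundary. -/
def latGraph (Ω : Set (E d)) (T : ℝ) : Submodule ℝ (L2Q Ω T × L2Qvec Ω T) where
  carrier := {p | ∃ φ, IsLateralTest Ω φ ∧ p.1 =ᵐ[muQ Ω T] φ ∧ p.2 =ᵐ[muQ Ω T] spaceGrad φ}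
  zero_mem' := by
    refine ⟨fun _ => 0, ⟨contDiff_const, ∅, isCompact_empty, empty_subset _, by simp⟩,
      Lp.coeFn_zero ℝ 2 _, (Lp.coeFn_zero (E d) 2 _).trans (.of_forall fun z => ?_)⟩
    simp [spaceGrad, gradient]
  add_mem' := by
    rintro p q ⟨φ, hφ, h1, h2⟩ ⟨ψ, hψ, h3, h4⟩
    obtain ⟨K, hK, hKΩ, hK0⟩ := hφ.2
    obtain ⟨L, hL, hLΩ, hL0⟩ := hψ.2
    refine ⟨fun z => φ z + ψ z, ⟨hφ.1.add hψ.1, K ∪ L, hK.union hL, union_subset hKΩ hLΩ, ?_⟩, ?_, ?_⟩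
    · intro x hx t
      rw [mem_union, not_or] at hx
      simp only [hK0 x hx.1, hL0 x hx.2, add_zero]
    · filter_upwards [h1, h3, Lp.coeFn_add p.1 q.1] with z a b c
      rw [Prod.fst_add, c, Pi.add_apply, a, b]
    · filter_upwards [h2, h4, Lp.coeFn_add p.2 q.2] with z a b c
      have e1 := hasFDerivAt_slice (hφ.1.differentiable (by simp)) z.1 z.2
      have e2 := hasFDerivAt_slice (hψ.1.differentiable (by simp)) z.1 z.2
      rw [Prod.snd_add, c, Pi.add_apply, a, b, spaceGrad, spaceGrad, spaceGrad, gradient, gradient,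
        gradient, e1.fderiv, e2.fderiv, ← map_add]
      exact congrArg _ (e1.add e2).fderiv.symm
  smul_mem' := by
    rintro c p ⟨φ, hφ, h1, h2⟩
    obtain ⟨K, hK, hKΩ, hK0⟩ := hφ.2
    refine ⟨fun z => c * φ z, ⟨contDiff_const.mul hφ.1, K, hK, hKΩ, ?_⟩, ?_, ?_⟩
    · intro x hx t
      simp only [hK0 x hx, mul_zero]
    · filter_upwards [h1, Lp.coeFn_smul c p.1] with z a b
      rw [Prod.smul_fst, b, Pi.smul_apply, a, smul_eq_mul]
    · filter_upwards [h2, Lp.coeFn_smul c p.2] with z a b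
      rw [Prod.smul_snd, b, Pi.smul_apply, a]
      exact (spaceGrad_mul_snd (fun _ => c) z hφ.1).symm

/-- The graph of the gradient on `H^{1,0}_0(Q)`. -/
def H10 (Ω : Set (E d)) (T : ℝ) : Submodule ℝ (L2Q Ω T × L2Qvec Ω T) :=
  (latGraph Ω T).topologicalClosure

lemma isClosed_H10 (Ω : Set (E d)) (T : ℝ) : IsClosed (H10 Ω T : Set (L2Q Ω T × L2Qvec Ω T)) :=
  Submodule.isClosed_topologicalClosure _

/-- The density principle: closed conditions on pairs (u, ∇u) need only be checked for smooth
functions vanishing near the lateral boundary. -/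
lemma H10_subset_of_isClosed {S : Set (L2Q Ω T × L2Qvec Ω T)} (hS : IsClosed S)
    (h : (latGraph Ω T : Set _) ⊆ S) {p} (hp : p ∈ H10 Ω T) : p ∈ S :=
  closure_minimal h hS hp

/-- Although φ need not vanish at the ends of the time interval, the compact support of ψ in the
cylinder allows integration by parts on the whole space. -/
lemma integral_lateral_mul_spaceGrad (hφ : IsLateralTest Ω φ) (hψ : IsTest Ω T ψ) (e : E d) :
    ∫ z, φ z * inner ℝ (spaceGrad ψ z) e ∂(muQ Ω T)
      = -∫ z, inner ℝ (spaceGrad φ z) e * ψ z ∂(muQ Ω T) := by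
  have : (volume : Measure (E d × ℝ)).IsAddHaarMeasure := by
    rw [Measure.volume_eq_prod]; infer_instance
  simp_rw [inner_spaceGrad hφ.1, inner_spaceGrad hψ.1]
  have hdψ : HasCompactSupport (fun z => fderiv ℝ ψ z (e, 0)) :=
    (hψ.2.1.fderiv ℝ).comp_left (g := fun L : E d × ℝ →L[ℝ] ℝ => L (e, 0)) rfl
  have c1 : Continuous (fun z => fderiv ℝ φ z (e, 0)) := 
    (hφ.1.continuous_fderiv (by simp)).clm_apply continuous_const
  have c2 : Continuous (fun z => fderiv ℝ ψ z (e, 0)) := 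
    (hψ.1.continuous_fderiv (by simp)).clm_apply continuous_const
  have c3 := hφ.1.continuous
  have c4 := hψ.1.continuous
  rw [setIntegral_eq_integral_of_forall_compl_eq_zero, setIntegral_eq_integral_of_forall_compl_eq_zero]
  · refine integral_mul_fderiv_eq_neg_fderiv_mul_of_integrable ?_ ?_ ?_ ?_ ?_
    · exact (c1.mul c4).integrable_of_hasCompactSupport hψ.2.1.mul_left
    · exact (c3.mul c2).integrable_of_hasCompactSupport hdψ.mul_left
    · exact (c3.mul c4).integrable_of_hasCompactSupport hψ.2.1.mul_left
    · exact fun z _ => hφ.1.differentiable (by simp) z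
    · exact fun z _ => hψ.1.differentiable (by simp) z
  · intro z hz
    rw [image_eq_zero_of_notMem_tsupport fun hz' => hz (hψ.2.2 hz'), mul_zero]
  · intro z hz
    have : fderiv ℝ ψ z = 0 := 
      image_eq_zero_of_notMem_tsupport fun hz' => hz (hψ.2.2 (tsupport_fderiv_subset ℝ hz'))
    rw [this]; simp

lemma hasWeakGrad_of_mem_H10 (hΩ : Bornology.IsBounded Ω) {p : L2Q Ω T × L2Qvec Ω T}
    (hp : p ∈ H10 Ω T) : HasWeakGrad Ω T p.1 p.2 := by
  rw [hasWeakGrad_iff hΩ]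
  intro ψ hψ e
  have h1 := hψ.isLateralTest.latSupp_spaceGrad.inner_const e
  have h2 := hψ.isLateralTest.latSupp.smul_const e
  rw [← h1.inner_toLp hΩ, ← h2.inner_toLp hΩ]
  refine H10_subset_of_isClosed (S := {p | inner ℝ p.1 ((h1.memLp hΩ T 2).toLp _)
    = -inner ℝ p.2 ((h2.memLp hΩ T 2).toLp _)}) (isClosed_eq (by fun_prop) (by fun_prop)) ?_ hp
  rintro q ⟨φ, hφ, e1, e2⟩
  rw [mem_ofPred_eq, h1.inner_toLp hΩ, h2.inner_toLp hΩ]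
  refine Eq.trans (integral_congr_ae ?_) ((integral_lateral_mul_spaceGrad hφ hψ e).trans
    (congrArg Neg.neg (integral_congr_ae ?_)))
  · filter_upwards [e1] with z hz
    rw [hz]; exact mul_comm _ _
  · filter_upwards [e2] with z hz
    rw [hz, real_inner_smul_right, mul_comm]

lemma grad_of_mem_H10 (hΩo : IsOpen Ω) (hΩ : Bornology.IsBounded Ω) {p : L2Q Ω T × L2Qvec Ω T}
    (hp : p ∈ H10 Ω T) : grad p.1 = p.2 :=
  grad_eq hΩo hΩ (hasWeakGrad_of_mem_H10 hΩ hp)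

lemma normQ_sub {F : Type*} [NormedAddCommGroup F] (u : Lp F 2 (muQ Ω T)) {f : E d × ℝ → F}
    (hf : MemLp f 2 (muQ Ω T)) : normQ Ω T (fun z => u z - f z) = ‖u - hf.toLp f‖ := by
  rw [normQ, Lp.norm_def]
  congr 1
  refine eLpNorm_congr_ae ?_
  filter_upwards [Lp.coeFn_sub u (hf.toLp f), hf.coeFn_toLp] with z h1 h2
  rw [h1, Pi.sub_apply, h2]

lemma memH10Zero_iff (hΩ : Bornology.IsBounded Ω) (u : L2Q Ω T) :
    MemH10Zero Ω T u ↔ (u, grad u) ∈ H10 Ω T := by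
  constructor
  · rintro ⟨-, h⟩
    refine Metric.mem_closure_iff.2 fun ε hε => ?_
    obtain ⟨φ, hφ, h1, h2⟩ := h ε hε
    have m1 := hφ.latSupp.memLp hΩ T 2
    have m2 := hφ.latSupp_spaceGrad.memLp hΩ T 2
    refine ⟨(m1.toLp φ, m2.toLp _), ⟨φ, hφ, m1.coeFn_toLp, m2.coeFn_toLp⟩, ?_⟩
    rw [normQ_sub u m1] at h1
    rw [normQ_sub (grad u) m2] at h2
    rw [Prod.dist_eq, max_lt_iff, dist_eq_norm, dist_eq_norm]
    exact ⟨h1, h2⟩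
  · intro h
    refine ⟨⟨_, hasWeakGrad_of_mem_H10 hΩ h⟩, fun ε hε => ?_⟩
    obtain ⟨p, ⟨φ, hφ, e1, e2⟩, hd⟩ := Metric.mem_closure_iff.1 h ε hε
    have m1 := hφ.latSupp.memLp hΩ T 2
    have m2 := hφ.latSupp_spaceGrad.memLp hΩ T 2
    refine ⟨φ, hφ, ?_⟩
    rw [normQ_sub u m1, normQ_sub (grad u) m2]
    rw [Prod.dist_eq, max_lt_iff, dist_eq_norm, dist_eq_norm] at hd
    have h1 : m1.toLp φ = p.1 := by
      ext1; exact m1.coeFn_toLp.trans e1.symm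
    have h2 : m2.toLp _ = p.2 := by
      ext1; exact m2.coeFn_toLp.trans e2.symm
    rw [h1, h2]; exact hd

/-- Friedrichs' inequality in the cylinder. -/
lemma norm_le_of_mem_H10 (hΩ : Bornology.IsBounded Ω) {C : ℝ}
    (hC : IsFriedrichsConst Ω C) {p : L2Q Ω T × L2Qvec Ω T} (hp : p ∈ H10 Ω T) :
    ‖p.1‖ ≤ C * ‖p.2‖ := by
  have := isFiniteMeasure_muQ hΩ T
  refine H10_subset_of_isClosed (S := {p | ‖p.1‖ ≤ C * ‖p.2‖})
    (isClosed_le (by fun_prop) (by fun_prop)) ?_ hp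
  rintro q ⟨φ, hφ, e1, e2⟩
  refine (sq_le_sq₀ (norm_nonneg _) (mul_nonneg hC.1.le (norm_nonneg _))).1 ?_
  rw [mul_pow, ← real_inner_self_eq_norm_sq, ← real_inner_self_eq_norm_sq, L2.inner_def, L2.inner_def]
  have h1 : ∫ z, inner ℝ (q.1 z) (q.1 z) ∂(muQ Ω T) = ∫ z, φ z ^ 2 ∂(muQ Ω T) := by
    refine integral_congr_ae ?_
    filter_upwards [e1] with z hz
    rw [hz, real_inner_self_eq_norm_sq, Real.norm_eq_abs, sq_abs]
  have h2 : ∫ z, inner ℝ (q.2 z) (q.2 z) ∂(muQ Ω T) = ∫ z, ‖spaceGrad φ z‖ ^ 2 ∂(muQ Ω T) := by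
    refine integral_congr_ae ?_
    filter_upwards [e2] with z hz
    rw [hz, real_inner_self_eq_norm_sq]
  have i1 : Integrable (fun z => φ z ^ 2) (muQ Ω T) := by
    simpa using (hφ.latSupp.memLp hΩ T 2).integrable_sq
  have i2 : Integrable (fun z => ‖spaceGrad φ z‖ ^ 2) (muQ Ω T) := by
    simpa using (hφ.latSupp_spaceGrad.memLp hΩ T 2).integrable_norm_pow'
  rw [h1, h2]
  rw [muQ_eq] at i1 i2 ⊢
  rw [integral_prod_symm _ i1, integral_prod_symm _ i2, ← integral_const_mul]
  -- Integrating in x first, Friedrichs' inequality on Ω applies to each time slice, which is smooth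
  -- with compact support in Ω.
  refine integral_mono i1.integral_prod_right (i2.integral_prod_right.const_mul _) fun t => ?_
  obtain ⟨K, hK, hKΩ, h0⟩ := hφ.2
  have hs : tsupport (fun x => φ (x, t)) ⊆ K := by
    refine closure_minimal (fun x hx => ?_) hK.isClosed
    by_contra hxK; exact hx (h0 x hxK t)
  exact hC.2 (fun x => φ (x, t)) (hφ.1.comp (contDiff_id.prodMk contDiff_const))
    (hK.of_isClosed_subset (isClosed_tsupport _) hs) (hs.trans hKΩ)

end GraphSpace

/-! ### Invariance of H^{1,0}_0(Q) under the mode operators. -/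

section Invariance

lemma isLateralTest_average (h : IsLateralTest Ω φ) {θ θ' : ℝ → ℝ} (hθ : ContDiff ℝ ∞ θ)
    (hθ' : ContDiff ℝ ∞ θ') (T : ℝ) :
    IsLateralTest Ω (fun z => θ z.2 * (T⁻¹ * ∫ t in (0 : ℝ)..T, θ' t * φ (z.1, t))) := by
  obtain ⟨K, hK, hKΩ, h0⟩ := h.2
  have hs : ContDiff ℝ ∞ (fun x => ∫ t in (0 : ℝ)..T, θ' t * φ (x, t)) :=
    contDiff_infty.2 fun n => contDiff_integral_param T n (f := fun z => θ' z.2 * φ z)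
      (((hθ'.comp contDiff_snd).mul h.1).of_le (by exact_mod_cast le_top))
  refine ⟨(hθ.comp contDiff_snd).mul (contDiff_const.mul (hs.comp contDiff_fst)), K, hK, hKΩ, ?_⟩
  intro x hx t
  simp [h0 x hx]

lemma spaceGrad_average (h : IsLateralTest Ω φ) (θ : ℝ → ℝ) {θ' : ℝ → ℝ}
    (hθ' : ContDiff ℝ ∞ θ') (T : ℝ) (z : E d × ℝ) :
    spaceGrad (fun z => θ z.2 * (T⁻¹ * ∫ t in (0 : ℝ)..T, θ' t * φ (z.1, t))) z
      = θ z.2 • T⁻¹ • ∫ t in (0 : ℝ)..T, θ' t • spaceGrad φ (z.1, t) := by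
  have hc := hθ'.continuous
  have hc1 := h.1.continuous
  have hc2 : Continuous (fderiv ℝ φ) := h.1.continuous_fderiv (by simp)
  have h1 := hasFDerivAt_integral_param T (f := fun z => θ' z.2 * φ z)
    (D := fun z => θ' z.2 • (fderiv ℝ φ z).comp (ContinuousLinearMap.inl ℝ (E d) ℝ))
    (by fun_prop) (by fun_prop)
    (fun x t => (hasFDerivAt_slice (h.1.differentiable (by simp)) x t).const_mul (θ' t)) z.1
  rw [spaceGrad, gradient, ((h1.const_mul T⁻¹).const_mul (θ z.2)).fderiv, map_smul, map_smul]
  congr 2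
  have h2 := ((InnerProductSpace.toDual ℝ (E d)).symm.toContinuousLinearEquiv.toContinuousLinearMap
    |>.intervalIntegral_comp_comm (μ := volume) (a := 0) (b := T)
    (f := fun t => θ' t • (fderiv ℝ φ (z.1, t)).comp (ContinuousLinearMap.inl ℝ (E d) ℝ))
    (Continuous.intervalIntegrable (by fun_prop) _ _))
  refine Eq.trans h2.symm (intervalIntegral.integral_congr fun t _ => ?_)
  simp only
  rw [spaceGrad_eq h.1, ← map_smul]; rfl

/-- Averaging in time keeps smoothness and the support in x, and it commutes with the spatial
gradient, so it maps smooth lateral functions to such functions; continuity of the operators extends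
this to the closure. It makes the modes and rotations of y admissible test functions. -/
lemma mem_H10_tsyn_tcoef (hΩ : Bornology.IsBounded Ω) (hT : 0 < T) {θ θ' : ℝ → ℝ} (hθ : ContDiff ℝ ∞ θ)
    (hθ' : ContDiff ℝ ∞ θ') {p : L2Q Ω T × L2Qvec Ω T} (hp : p ∈ H10 Ω T) :
    (tsyn Ω T θ (tcoef Ω T θ' p.1), tsyn Ω T θ (tcoef Ω T θ' p.2)) ∈ H10 Ω T := by
  refine H10_subset_of_isClosed (S := (fun p : L2Q Ω T × L2Qvec Ω T => (tsyn Ω T θ (tcoef Ω T θ' p.1),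
    tsyn Ω T θ (tcoef Ω T θ' p.2))) ⁻¹' (H10 Ω T)) ((isClosed_H10 Ω T).preimage (by fun_prop)) ?_ hp
  rintro q ⟨φ, hφ, e1, e2⟩
  refine subset_closure ⟨_, isLateralTest_average hφ hθ hθ' T, ?_, ?_⟩
  · filter_upwards [coeFn_tsyn hθ.continuous (tcoef Ω T θ' q.1),
      ae_muQ_of_ae (T := T) (coeFn_tcoef hΩ hT hθ'.continuous q.1),
      ae_muQ_of_ae (T := T) (ae_ae_of_ae_muQ e1)] with z h1 h2 h3
    rw [h1, h2, smul_eq_mul, smul_eq_mul]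
    congr 2
    rw [intervalIntegral.integral_of_le hT.le, intervalIntegral.integral_of_le hT.le,
      integral_Ioc_eq_integral_Ioo, integral_Ioc_eq_integral_Ioo]
    refine integral_congr_ae ?_
    filter_upwards [h3] with t ht
    rw [ht, smul_eq_mul]
  · filter_upwards [coeFn_tsyn hθ.continuous (tcoef Ω T θ' q.2),
      ae_muQ_of_ae (T := T) (coeFn_tcoef hΩ hT hθ'.continuous q.2),
      ae_muQ_of_ae (T := T) (ae_ae_of_ae_muQ e2)] with z h1 h2 h3
    rw [h1, h2, spaceGrad_average hφ θ hθ' T]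
    congr 2
    rw [intervalIntegral.integral_of_le hT.le, intervalIntegral.integral_of_le hT.le,
      integral_Ioc_eq_integral_Ioo, integral_Ioc_eq_integral_Ioo]
    refine integral_congr_ae ?_
    filter_upwards [h3] with t ht
    rw [ht]

lemma contDiff_cosk (T : ℝ) (k : ℕ) : ContDiff ℝ ∞ (cosk T k) := by unfold cosk; fun_prop

lemma contDiff_sink (T : ℝ) (k : ℕ) : ContDiff ℝ ∞ (sink T k) := by unfold sink; fun_prop

lemma modeP_mem_H10 (hΩ : Bornology.IsBounded Ω) (hT : 0 < T) (k : ℕ)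
    {p : L2Q Ω T × L2Qvec Ω T} (hp : p ∈ H10 Ω T) :
    (modeP Ω T k p.1, modeP Ω T k p.2) ∈ H10 Ω T :=
  (H10 Ω T).smul_mem (wt k) ((H10 Ω T).add_mem
    (mem_H10_tsyn_tcoef hΩ hT (contDiff_cosk T k) (contDiff_cosk T k) hp)
    (mem_H10_tsyn_tcoef hΩ hT (contDiff_sink T k) (contDiff_sink T k) hp))

lemma modeJ_mem_H10 (hΩ : Bornology.IsBounded Ω) (hT : 0 < T) (k : ℕ)
    {p : L2Q Ω T × L2Qvec Ω T} (hp : p ∈ H10 Ω T) :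
    (modeJ Ω T k p.1, modeJ Ω T k p.2) ∈ H10 Ω T :=
  (H10 Ω T).smul_mem (2 : ℝ) ((H10 Ω T).sub_mem
    (mem_H10_tsyn_tcoef hΩ hT (contDiff_cosk T k) (contDiff_sink T k) hp)
    (mem_H10_tsyn_tcoef hΩ hT (contDiff_sink T k) (contDiff_cosk T k) hp))

end Invariance

/-! ### Integration by parts of fluxes. -/

section Divergence

/-- Integration by parts against `H^{1,0}_0(Q)`. -/
lemma inner_grad_of_hasWeakDiv (hΩo : IsOpen Ω) {τ : L2Qvec Ω T} {w : L2Q Ω T}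
    (h : HasWeakDiv Ω T τ w) {p : L2Q Ω T × L2Qvec Ω T} (hp : p ∈ H10 Ω T) :
    inner ℝ τ p.2 = -inner ℝ w p.1 := by
  refine H10_subset_of_isClosed (S := {p : L2Q Ω T × L2Qvec Ω T | inner ℝ τ p.2 = -inner ℝ w p.1})
    (isClosed_eq (by fun_prop) (by fun_prop)) ?_ hp
  rintro q ⟨φ, hφ, e1, e2⟩
  have i1 := L2.integrable_inner (𝕜 := ℝ) τ q.2
  have i2 := L2.integrable_inner (𝕜 := ℝ) w q.1
  have hmem : ∀ᵐ z ∂(muQ Ω T), z.2 ∈ Ioo 0 T := by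
    filter_upwards [ae_restrict_mem (hΩo.prod isOpen_Ioo).measurableSet] with z hz using hz.2
  -- The weak divergence may only be tested with functions vanishing near t = 0 and t = T. Cutoffs
  -- in time repair this; as they commute with the spatial gradient, no derivative of the cutoff
  -- appears and dominated convergence removes them.
  have hlim : ∀ {f : E d × ℝ → ℝ}, Integrable f (muQ Ω T) →
      Tendsto (fun n => ∫ z, cutoff T n z.2 * f z ∂(muQ Ω T)) atTop (𝓝 (∫ z, f z ∂(muQ Ω T))) := by
    intro f hf
    refine tendsto_integral_of_dominated_convergence (fun z => ‖f z‖) (fun n => ?_) hf.norm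
      (fun n => .of_forall fun z => ?_) ?_
    · exact ((contDiff_cutoff T n).continuous.comp continuous_snd).aestronglyMeasurable.mul
        hf.aestronglyMeasurable
    · rw [norm_mul, Real.norm_of_nonneg (cutoff_nonneg T n _)]
      exact mul_le_of_le_one_left (norm_nonneg _) (cutoff_le_one T n _)
    · filter_upwards [hmem] with z hz
      simpa using (tendsto_cutoff hz).mul_const (f z)
  rw [mem_ofPred_eq, L2.inner_def, L2.inner_def]
  refine tendsto_nhds_unique (hlim i1) ((hlim i2).neg.congr fun n => ?_)
  have h1 := h _ (hφ.cutoff_mul T n)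
  rw [neg_eq_iff_eq_neg] at *
  rw [← neg_eq_iff_eq_neg]
  refine Eq.trans ?_ (h1.symm.trans ?_)
  · refine congrArg Neg.neg (integral_congr_ae ?_)
    filter_upwards [e1] with z hz
    rw [hz]; simp only [Real.inner_apply]; ring
  · refine integral_congr_ae ?_
    filter_upwards [e2] with z hz
    rw [hz, spaceGrad_mul_snd _ _ hφ.1, real_inner_smul_right]

end Divergence
end

section

/-! ### Derivatives of the time cutoffs. -/

section CutoffDeriv

lemma exists_bound_deriv_smoothTransition : ∃ C, 0 ≤ C ∧ ∀ x, |deriv Real.smoothTransition x| ≤ C := by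
  have hc : Continuous (deriv Real.smoothTransition) :=
    (Real.smoothTransition.contDiff (n := 1)).continuous_deriv le_rfl
  obtain ⟨C, hC⟩ := (isCompact_Icc (a := (0 : ℝ)) (b := 1)).exists_bound_of_continuousOn
    hc.continuousOn
  refine ⟨max C 0, le_max_right _ _, fun x => ?_⟩
  by_cases hx : x ∈ Icc (0 : ℝ) 1
  · exact (hC x hx).trans (le_max_left _ _)
  · rw [mem_Icc, not_and_or, not_le, not_le] at hx
    have h : deriv Real.smoothTransition x = 0 := by
      rcases hx with hx | hx
      · have : Real.smoothTransition =ᶠ[𝓝 x] fun _ => 0 := by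
          filter_upwards [gt_mem_nhds hx] with y hy
          exact Real.smoothTransition.zero_of_nonpos hy.le
        rw [this.deriv_eq, deriv_const]
      · have : Real.smoothTransition =ᶠ[𝓝 x] fun _ => 1 := by
          filter_upwards [lt_mem_nhds hx] with y hy
          exact Real.smoothTransition.one_of_one_le hy.le
        rw [this.deriv_eq, deriv_const]
    rw [h, abs_zero]; exact le_max_right _ _

lemma exists_bound_deriv_cutoff (T : ℝ) :
    ∃ C, 0 ≤ C ∧ ∀ (n : ℕ) t, |deriv (cutoff T n) t| ≤ C * (n + 1) := by
  obtain ⟨C, hC0, hC⟩ := exists_bound_deriv_smoothTransition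
  refine ⟨2 * C, by positivity, fun n t => ?_⟩
  have hd : Differentiable ℝ Real.smoothTransition :=
    (Real.smoothTransition.contDiff (n := 1)).differentiable one_ne_zero
  have h1 : HasDerivAt (fun t : ℝ => (n + 1 : ℝ) * t - 1) (n + 1) t := by
    simpa using ((hasDerivAt_id t).const_mul (n + 1 : ℝ)).sub_const 1
  have h2 : HasDerivAt (fun t : ℝ => (n + 1 : ℝ) * (T - t) - 1) (-(n + 1)) t := by
    simpa using (((hasDerivAt_id t).const_sub T).const_mul (n + 1 : ℝ)).sub_const 1
  have h3 := ((hd _).hasDerivAt.comp t h1).mul ((hd _).hasDerivAt.comp t h2)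
  have h4 : deriv (cutoff T n) t = _ := h3.deriv
  have hn : (0 : ℝ) < n + 1 := by positivity
  rw [h4]
  simp only [Function.comp_apply]
  refine (abs_add_le _ _).trans ?_
  rw [abs_mul, abs_mul, abs_mul, abs_mul, abs_neg, abs_of_pos hn,
    abs_of_nonneg (Real.smoothTransition.nonneg _), abs_of_nonneg (Real.smoothTransition.nonneg _)]
  have e1 := hC ((n + 1 : ℝ) * t - 1)
  have e2 := hC ((n + 1 : ℝ) * (T - t) - 1)
  have e3 := Real.smoothTransition.le_one ((n + 1 : ℝ) * t - 1)
  have e4 := Real.smoothTransition.le_one ((n + 1 : ℝ) * (T - t) - 1)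
  have e5 := Real.smoothTransition.nonneg ((n + 1 : ℝ) * t - 1)
  have e6 := Real.smoothTransition.nonneg ((n + 1 : ℝ) * (T - t) - 1)
  have f1 := mul_le_mul (mul_le_mul_of_nonneg_right e1 hn.le) e4 e6 (by positivity)
  have f2 := mul_le_mul e3 (mul_le_mul_of_nonneg_right e2 hn.le) (by positivity) zero_le_one
  linarith

/-- The cutoff equals 1 from distance 2/(n+1) on; the larger distance 3/(n+1) provides a whole
neighbourhood on which it is constant. -/
lemma deriv_cutoff_eq_zero {T : ℝ} {n : ℕ} {t : ℝ} (h1 : 3 / (n + 1 : ℝ) ≤ t)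
    (h2 : t ≤ T - 3 / (n + 1 : ℝ)) : deriv (cutoff T n) t = 0 := by
  have hn : (0 : ℝ) < n + 1 := by positivity
  have h23 : 2 / (n + 1 : ℝ) < 3 / (n + 1 : ℝ) := by gcongr; norm_num
  have : cutoff T n =ᶠ[𝓝 t] fun _ => 1 := by
    filter_upwards [Ioo_mem_nhds (h23.trans_le h1)
      (show t < T - 2 / (n + 1 : ℝ) by linarith)] with s hs
    exact cutoff_eq_one hs.1.le hs.2.le
  rw [this.deriv_eq, deriv_const]

/-- The derivatives of the cutoff functions tend to `δ_0 - δ_T`. -/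
lemma tendsto_integral_mul_deriv_cutoff {T : ℝ} (hT : 0 < T) {g : ℝ → ℝ}
    (hg : ContinuousOn g (Icc 0 T)) (hper : g 0 = g T) :
    Tendsto (fun n => ∫ t in (0 : ℝ)..T, g t * deriv (cutoff T n) t) atTop (𝓝 0) := by
  obtain ⟨C, hC0, hC⟩ := exists_bound_deriv_cutoff T
  have hdc : ∀ n, Continuous (deriv (cutoff T n)) := fun n =>
    (contDiff_cutoff T n).continuous_deriv (by simp)
  have hz : ∀ n, ∫ t in (0 : ℝ)..T, deriv (cutoff T n) t = 0 := by
    intro n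
    have hn : (0 : ℝ) < 1 / (n + 1 : ℝ) := by positivity
    rw [intervalIntegral.integral_deriv_eq_sub
      (fun t _ => (contDiff_cutoff T n).differentiable (by simp) t)
      ((hdc n).intervalIntegrable _ _), cutoff_eq_zero, cutoff_eq_zero, sub_zero]
    · exact fun h => by linarith [h.1]
    · exact fun h => by linarith [h.2]
  rw [← uIcc_of_le hT.le] at hg
  -- The cutoff derivative has mean zero, so g(0) = g(T) may be subtracted. The remaining factor is
  -- then small in both end layers.
  have hgs : ∀ n, ∫ t in (0 : ℝ)..T, g t * deriv (cutoff T n) t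
      = ∫ t in (0 : ℝ)..T, (g t - g 0) * deriv (cutoff T n) t := by
    intro n
    simp_rw [sub_mul]
    rw [intervalIntegral.integral_sub, intervalIntegral.integral_const_mul, hz, mul_zero, sub_zero]
    · exact (hg.mul (hdc n).continuousOn).intervalIntegrable
    · exact ((hdc n).const_mul _).intervalIntegrable _ _
  simp_rw [hgs]
  rw [uIcc_of_le hT.le] at hg
  have h3 : Tendsto (fun n : ℕ => 3 / (n + 1 : ℝ)) atTop (𝓝 0) := by
    simpa [div_eq_mul_inv] using (tendsto_one_div_add_atTop_nhds_zero_nat (𝕜 := ℝ)).const_mul 3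
  refine Metric.tendsto_atTop'.2 fun ε hε => ?_
  -- Each of the two end layers has width 3/(n+1), and there the integrand is at most η C (n+1);
  -- together they contribute at most 6 C η.
  obtain ⟨η, hη, hηε⟩ : ∃ η > 0, 6 * C * η < ε := by
    refine ⟨ε / (6 * C + 1), by positivity, ?_⟩
    rw [mul_div_assoc', div_lt_iff₀ (by positivity)]
    nlinarith
  obtain ⟨δ₁, hδ₁, h0⟩ := Metric.continuousOn_iff.1 hg 0 (left_mem_Icc.2 hT.le) η hη
  obtain ⟨δ₂, hδ₂, hTT⟩ := Metric.continuousOn_iff.1 hg T (right_mem_Icc.2 hT.le) η hη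
  obtain ⟨N, hN⟩ := eventually_atTop.1 ((h3.eventually_lt_const hδ₁).and
    ((h3.eventually_lt_const hδ₂).and (h3.eventually_lt_const (half_pos hT))))
  refine ⟨N, fun n hn => ?_⟩
  obtain ⟨a1, a2, a3⟩ := hN n hn.le
  set δ := 3 / (n + 1 : ℝ) with hδ
  have hn1 : (0 : ℝ) < n + 1 := by positivity
  have hδ0 : 0 < δ := by positivity
  have hδn : δ * (n + 1) = 3 := by rw [hδ]; field_simp
  have hcont : ContinuousOn (fun t => (g t - g 0) * deriv (cutoff T n) t) (Icc 0 T) :=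
    (hg.sub continuousOn_const).mul (hdc n).continuousOn
  have hi : ∀ {a b}, a ∈ Icc 0 T → b ∈ Icc 0 T → IntervalIntegrable
      (fun t => (g t - g 0) * deriv (cutoff T n) t) volume a b := fun ha hb =>
    (hcont.mono (by rw [← uIcc_of_le hT.le] at ha hb ⊢; exact uIcc_subset_uIcc ha hb)).intervalIntegrable
  have m0 : (0 : ℝ) ∈ Icc 0 T := left_mem_Icc.2 hT.le
  have mT : T ∈ Icc 0 T := right_mem_Icc.2 hT.le
  have m1 : δ ∈ Icc 0 T := ⟨hδ0.le, by linarith⟩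
  have m2 : T - δ ∈ Icc 0 T := ⟨by linarith, by linarith⟩
  rw [dist_zero_right, ← intervalIntegral.integral_add_adjacent_intervals (hi m0 m1) (hi m1 mT),
    ← intervalIntegral.integral_add_adjacent_intervals (hi m1 m2) (hi m2 mT)]
  have I2 : ∫ t in δ..(T - δ), (g t - g 0) * deriv (cutoff T n) t = 0 := by
    rw [intervalIntegral.integral_congr (g := fun _ => (0 : ℝ)), intervalIntegral.integral_zero]
    intro t ht
    rw [uIcc_of_le (by linarith)] at ht
    simp only [deriv_cutoff_eq_zero ht.1 ht.2, mul_zero]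
  have I1 : ‖∫ t in (0 : ℝ)..δ, (g t - g 0) * deriv (cutoff T n) t‖ ≤ η * (C * (n + 1)) * |δ - 0| := by
    refine intervalIntegral.norm_integral_le_of_norm_le_const fun t ht => ?_
    rw [uIoc_of_le hδ0.le] at ht
    rw [norm_mul]
    refine mul_le_mul ?_ (hC n t) (norm_nonneg _) hη.le
    exact (h0 t ⟨ht.1.le, ht.2.trans m1.2⟩
      (by rw [Real.dist_eq, sub_zero, abs_of_pos ht.1]; exact ht.2.trans_lt a1)).le
  have I3 : ‖∫ t in (T - δ)..T, (g t - g 0) * deriv (cutoff T n) t‖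
      ≤ η * (C * (n + 1)) * |T - (T - δ)| := by
    refine intervalIntegral.norm_integral_le_of_norm_le_const fun t ht => ?_
    rw [uIoc_of_le (by linarith)] at ht
    rw [norm_mul]
    refine mul_le_mul ?_ (hC n t) (norm_nonneg _) hη.le
    rw [hper]
    exact (hTT t ⟨m2.1.trans ht.1.le, ht.2⟩
      (by rw [Real.dist_eq, abs_sub_comm, abs_of_nonneg (by linarith [ht.2])]; linarith [ht.1])).le
  rw [I2, zero_add]
  refine (norm_add_le _ _).trans_lt ?_
  rw [sub_zero, abs_of_pos hδ0] at I1
  rw [sub_sub_cancel, abs_of_pos hδ0] at I3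
  have : η * (C * (n + 1)) * δ = 3 * C * η := by
    rw [show η * (C * (n + 1)) * δ = η * C * (δ * (n + 1)) by ring, hδn]; ring
  rw [this] at I1 I3
  linarith

end CutoffDeriv

/-! ### Weak time derivatives of periodic functions act mode by mode. -/

section TimeDerivative
variable {d : ℕ} {Ω : Set (E d)} {T : ℝ}

/-- `w` is the periodic time derivative of `u`, mode by mode. -/
def HasModeDeriv (Ω : Set (E d)) (T : ℝ) (u w : L2Q Ω T) : Prop :=
  ∀ k : ℕ, modeP Ω T k w = (k * freq T : ℝ) • modeJ Ω T k u

lemma integrable_coe (hΩ : Bornology.IsBounded Ω) (u : L2Q Ω T) :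
    Integrable (fun z => u z) (muQ Ω T) := by
  have := isFiniteMeasure_muQ hΩ T
  exact (Lp.memLp u).integrable one_le_two

lemma integrable_mul_snd (hΩ : Bornology.IsBounded Ω) {θ : ℝ → ℝ} (hθ : Continuous θ)
    (u : L2Q Ω T) : Integrable (fun z => u z * θ z.2) (muQ Ω T) := by
  refine (integrable_coe hΩ (mulOp (muQ Ω T) (fun z => θ z.2) u)).congr ?_
  filter_upwards [coeFn_mulOp (memLp_top_snd hθ Ω T) u] with z hz
  rw [hz, smul_eq_mul, mul_comm]

/-- Test with products g(x) χ(t) and apply the fundamental lemma of the calculus of variations in x.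
-/
lemma ae_weak_deriv_slice (hΩo : IsOpen Ω) (hΩ : Bornology.IsBounded Ω) (hT : 0 < T) {u w : L2Q Ω T}
    (h : HasWeakTimeDeriv Ω T u w) {χ : ℝ → ℝ} (hχ : ContDiff ℝ ∞ χ) (hc : HasCompactSupport χ)
    (hs : tsupport χ ⊆ Ioo 0 T) :
    ∀ᵐ x ∂(volume.restrict Ω), ∫ t in (0 : ℝ)..T, (u (x, t) * deriv χ t + w (x, t) * χ t) = 0 := by
  have hdχ : Continuous (deriv χ) := hχ.continuous_deriv (by simp)
  have hi : Integrable (fun z : E d × ℝ => u z * deriv χ z.2 + w z * χ z.2) (muQ Ω T) := by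
    exact (integrable_mul_snd hΩ hdχ u).add (integrable_mul_snd hΩ hχ.continuous w)
  have hf : IntegrableOn (fun x => ∫ t in (0 : ℝ)..T, (u (x, t) * deriv χ t + w (x, t) * χ t)) Ω volume :=
    integrable_integral_snd hT hi
  refine (ae_restrict_iff' hΩo.measurableSet).2
    (hΩo.ae_eq_zero_of_integral_contDiff_smul_eq_zero hf.locallyIntegrableOn fun g g1 g2 g3 => ?_)
  rw [← setIntegral_eq_integral_of_forall_compl_eq_zero (s := Ω) fun x hx => by
    rw [image_eq_zero_of_notMem_tsupport fun hx' => hx (g3 hx'), zero_smul]]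
  have htest : IsTest Ω T (fun z => g z.1 * χ z.2) := by
    have hcp := g2.isCompact.prod hc.isCompact
    have hsub : tsupport (fun z : E d × ℝ => g z.1 * χ z.2) ⊆ tsupport g ×ˢ tsupport χ := by
      refine closure_minimal (fun z hz => ⟨?_, ?_⟩) hcp.isClosed
      · exact subset_tsupport _ (left_ne_zero_of_mul hz)
      · exact subset_tsupport _ (right_ne_zero_of_mul hz)
    exact ⟨(g1.comp contDiff_fst).mul (hχ.comp contDiff_snd),
      hcp.of_isClosed_subset (isClosed_tsupport _) hsub, hsub.trans (prod_mono g3 hs)⟩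
  have h1 := h _ htest
  have h2 : ∀ z, timeDeriv (fun z => g z.1 * χ z.2) z = g z.1 * deriv χ z.2 := fun z => by
    simp only [timeDeriv]
    rw [deriv_const_mul _ (hχ.differentiable (by simp) z.2)]
  simp_rw [h2] at h1
  obtain ⟨C, hC⟩ := g2.exists_bound_of_continuous g1.continuous
  have hgm : AEStronglyMeasurable (fun z : E d × ℝ => g z.1) (muQ Ω T) :=
    (g1.continuous.comp continuous_fst).aestronglyMeasurable
  have j1 : Integrable (fun z : E d × ℝ => g z.1 * (u z * deriv χ z.2)) (muQ Ω T) :=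
    (integrable_mul_snd hΩ hdχ u).bdd_mul hgm (.of_forall fun z => hC z.1)
  have j2 : Integrable (fun z : E d × ℝ => g z.1 * (w z * χ z.2)) (muQ Ω T) :=
    (integrable_mul_snd hΩ hχ.continuous w).bdd_mul hgm (.of_forall fun z => hC z.1)
  have h3 : ∫ z, (g z.1 * (u z * deriv χ z.2) + g z.1 * (w z * χ z.2)) ∂(muQ Ω T) = 0 := by
    rw [integral_add j1 j2, add_eq_zero_iff_eq_neg]
    simpa only [mul_left_comm] using h1
  have j3 : Integrable (fun z : E d × ℝ =>
      g z.1 * (u z * deriv χ z.2) + g z.1 * (w z * χ z.2)) (muQ Ω T) := j1.add j2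
  rw [integral_muQ hT j3] at h3
  refine Eq.trans (integral_congr_ae (.of_forall fun x => ?_)) h3
  simp only [smul_eq_mul, ← intervalIntegral.integral_const_mul, mul_add]

/-- The previous identity is used with χ replaced by a cutoff times θ. By the product rule the only
new term contains the derivative of the cutoff, and it disappears in the limit because U(x, ·) θ is
continuous and takes equal values at 0 and T. -/
lemma ae_periodic_deriv_slice (hΩo : IsOpen Ω) (hΩ : Bornology.IsBounded Ω) (hT : 0 < T)
    {u w : L2Q Ω T} (h : HasWeakTimeDeriv Ω T u w) (hp : IsTimePeriodic Ω T u) {θ : ℝ → ℝ}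
    (hθ : ContDiff ℝ ∞ θ) (hθT : θ 0 = θ T) :
    ∀ᵐ x ∂(volume.restrict Ω),
      ∫ t in (0 : ℝ)..T, (u (x, t) * deriv θ t + w (x, t) * θ t) = 0 := by
  obtain ⟨U, hU, hUc⟩ := hp
  have hdθ : Continuous (deriv θ) := hθ.continuous_deriv (by simp)
  have hslice : ∀ᵐ x ∂(volume.restrict Ω), ∀ n : ℕ, ∫ t in (0 : ℝ)..T,
      (u (x, t) * deriv (fun s => cutoff T n s * θ s) t + w (x, t) * (cutoff T n t * θ t)) = 0 := by
    refine ae_all_iff.2 fun n => ?_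
    have hsub : tsupport (fun s => cutoff T n s * θ s) ⊆
        Icc (1 / (n + 1 : ℝ)) (T - 1 / (n + 1 : ℝ)) := by
      refine closure_minimal (fun t ht => ?_) isClosed_Icc
      by_contra hn
      exact left_ne_zero_of_mul ht (cutoff_eq_zero hn)
    exact ae_weak_deriv_slice hΩo hΩ hT h ((contDiff_cutoff T n).mul hθ)
      (isCompact_Icc.of_isClosed_subset (isClosed_tsupport _) hsub)
      (hsub.trans (tsupport_cutoff_mul_subset n))
  filter_upwards [hslice, hUc, ae_ae_of_ae_muQ hU, ae_intervalIntegrable hT (integrable_coe hΩ u),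
    ae_intervalIntegrable hT (integrable_coe hΩ w)] with x hx hUx huU hux hwx
  have hcut : ∀ n, Continuous (cutoff T n) := fun n => (contDiff_cutoff T n).continuous
  have hdc : ∀ n, Continuous (deriv (cutoff T n)) := fun n =>
    (contDiff_cutoff T n).continuous_deriv (by simp)
  have hi : IntervalIntegrable (fun t => u (x, t) * deriv θ t + w (x, t) * θ t) volume 0 T :=
    (hux.mul_continuousOn hdθ.continuousOn).add (hwx.mul_continuousOn hθ.continuous.continuousOn)
  have lim1 : Tendsto (fun n => ∫ t in (0 : ℝ)..T,
      cutoff T n t * (u (x, t) * deriv θ t + w (x, t) * θ t)) atTop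
      (𝓝 (∫ t in (0 : ℝ)..T, (u (x, t) * deriv θ t + w (x, t) * θ t))) := by
    refine intervalIntegral.tendsto_integral_filter_of_dominated_convergence
      (fun t => ‖u (x, t) * deriv θ t + w (x, t) * θ t‖) (.of_forall fun n => ?_)
      (.of_forall fun n => .of_forall fun t _ => ?_) hi.norm ?_
    · rw [uIoc_of_le hT.le]
      exact (hcut n).aestronglyMeasurable.mul hi.1.aestronglyMeasurable
    · rw [norm_mul, Real.norm_of_nonneg (cutoff_nonneg T n _)]
      exact mul_le_of_le_one_left (norm_nonneg _) (cutoff_le_one T n _)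
    · have hne : ∀ᵐ t : ℝ, t ≠ T := by simp [ae_iff]
      filter_upwards [hne] with t ht hmem
      rw [uIoc_of_le hT.le] at hmem
      simpa using (tendsto_cutoff ⟨hmem.1, hmem.2.lt_of_ne ht⟩).mul_const
        (u (x, t) * deriv θ t + w (x, t) * θ t)
  have lim2 := tendsto_integral_mul_deriv_cutoff hT (g := fun t => U (x, t) * θ t)
    (hUx.1.mul hθ.continuous.continuousOn) (by rw [hUx.2, hθT])
  refine tendsto_nhds_unique lim1 ?_
  have lim3 := lim2.neg
  rw [neg_zero] at lim3
  refine lim3.congr fun n => ?_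
  have e1 : ∫ t in (0 : ℝ)..T, U (x, t) * θ t * deriv (cutoff T n) t
      = ∫ t in (0 : ℝ)..T, u (x, t) * (θ t * deriv (cutoff T n) t) := by
    rw [intervalIntegral.integral_of_le hT.le, intervalIntegral.integral_of_le hT.le,
      integral_Ioc_eq_integral_Ioo, integral_Ioc_eq_integral_Ioo]
    refine integral_congr_ae ?_
    filter_upwards [huU] with t ht
    rw [ht]; ring
  have hi2 : IntervalIntegrable (fun t => u (x, t) * (θ t * deriv (cutoff T n) t)) volume 0 T :=
    hux.mul_continuousOn (hθ.continuous.mul (hdc n)).continuousOn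
  rw [e1, neg_eq_iff_add_eq_zero, ← intervalIntegral.integral_add hi2
    (hi.continuousOn_mul (hcut n).continuousOn)]
  refine Eq.trans (intervalIntegral.integral_congr fun t _ => ?_) (hx n)
  have hd := ((contDiff_cutoff T n).differentiable (by simp) t).hasDerivAt.mul
    (hθ.differentiable (by simp) t).hasDerivAt
  rw [show deriv (fun s => cutoff T n s * θ s) t = _ from hd.deriv]
  ring

lemma cosk_T (hT : 0 < T) (k : ℕ) : cosk T k 0 = cosk T k T := by
  simp only [cosk, mul_zero, Real.cos_zero, mul_assoc, freq_mul_self hT]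
  exact (Real.cos_nat_mul_two_pi k).symm

lemma sink_T (hT : 0 < T) (k : ℕ) : sink T k 0 = sink T k T := by
  simp only [sink, mul_zero, Real.sin_zero, mul_assoc, freq_mul_self hT]
  rw [show (k : ℝ) * (2 * Real.pi) = ((2 * k : ℕ) : ℝ) * Real.pi by push_cast; ring,
    Real.sin_nat_mul_pi]

lemma tcoef_periodic_deriv (hΩo : IsOpen Ω) (hΩ : Bornology.IsBounded Ω) (hT : 0 < T)
    {u w : L2Q Ω T} (h : HasWeakTimeDeriv Ω T u w) (hp : IsTimePeriodic Ω T u) {θ θ' : ℝ → ℝ}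
    (hθ : ContDiff ℝ ∞ θ) (hθT : θ 0 = θ T) {c : ℝ} (hθ' : ∀ t, deriv θ t = c * θ' t)
    (hθ'c : Continuous θ') :
    tcoef Ω T θ w = -(c • tcoef Ω T θ' u) := by
  ext1
  refine (ae_muX_iff hT).2 ?_
  filter_upwards [coeFn_tcoef hΩ hT hθ.continuous w, coeFn_tcoef hΩ hT hθ'c u,
    ae_periodic_deriv_slice hΩo hΩ hT h hp hθ hθT, (ae_muX_iff hT).1 (Lp.coeFn_neg
    (c • tcoef Ω T θ' u)), (ae_muX_iff hT).1 (Lp.coeFn_smul c (tcoef Ω T θ' u)),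
    ae_intervalIntegrable hT (integrable_coe hΩ u),
    ae_intervalIntegrable hT (integrable_coe hΩ w)] with x h1 h2 h3 h4 h5 hux hwx
  rw [h1, h4, Pi.neg_apply, h5, Pi.smul_apply, h2]
  rw [intervalIntegral.integral_add
    (hux.mul_continuousOn (hθ.continuous_deriv (by simp)).continuousOn)
    (hwx.mul_continuousOn hθ.continuous.continuousOn)] at h3
  have e1 : ∫ t in (0 : ℝ)..T, θ t • w (x, t) = ∫ t in (0 : ℝ)..T, w (x, t) * θ t := by
    simp_rw [smul_eq_mul, mul_comm]
  have e2 : ∫ t in (0 : ℝ)..T, u (x, t) * deriv θ t = c * ∫ t in (0 : ℝ)..T, θ' t • u (x, t) := by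
    rw [← intervalIntegral.integral_const_mul]
    simp_rw [smul_eq_mul, hθ']
    refine intervalIntegral.integral_congr fun t _ => ?_
    ring
  rw [e1, eq_neg_of_add_eq_zero_right h3, e2, smul_eq_mul, smul_eq_mul, smul_eq_mul]
  ring

/-- Weak time derivatives of periodic functions are computed mode by mode. -/
lemma hasModeDeriv_of_isTimePeriodic (hΩo : IsOpen Ω) (hΩ : Bornology.IsBounded Ω) (hT : 0 < T)
    {u w : L2Q Ω T} (h : HasWeakTimeDeriv Ω T u w) (hp : IsTimePeriodic Ω T u) :
    HasModeDeriv Ω T u w := by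
  intro k
  have h1 : cC Ω T k w = (k * freq T : ℝ) • cS Ω T k u := by
    refine (tcoef_periodic_deriv hΩo hΩ hT h hp (contDiff_cosk T k) (cosk_T hT k)
      (c := -(k * freq T)) (θ' := sink T k) (fun t => ?_) (continuous_sink T k)).trans ?_
    · rw [(hasDerivAt_cosk T k t).deriv]; ring
    · rw [neg_smul, neg_neg]; rfl
  have h2 : cS Ω T k w = -((k * freq T : ℝ) • cC Ω T k u) :=
    tcoef_periodic_deriv hΩo hΩ hT h hp (contDiff_sink T k) (sink_T hT k)
      (fun t => (hasDerivAt_sink T k t).deriv) (continuous_cosk T k)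
  rcases eq_or_ne k 0 with rfl | hk
  · rw [modeP_apply, h1, cS_zero, cS_zero]; simp
  · rw [modeP_apply, h1, h2, modeJ_apply, wt, if_neg hk]
    simp only [map_smul, map_neg]
    module

end TimeDerivative
end

/-! ### The converse: mode derivatives are weak derivatives of time-periodic functions. -/

section
variable {d : ℕ} {Ω : Set (E d)} {T : ℝ} {φ ψ : E d × ℝ → ℝ}

lemma integral_test_mul_timeDeriv (hφ : IsTest Ω T φ) (hψ : IsTest Ω T ψ) :
    ∫ z, φ z * timeDeriv ψ z ∂(muQ Ω T) = -∫ z, timeDeriv φ z * ψ z ∂(muQ Ω T) := by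
  have : (volume : Measure (E d × ℝ)).IsAddHaarMeasure := by
    rw [Measure.volume_eq_prod]; infer_instance
  simp_rw [timeDeriv_eq hφ.1, timeDeriv_eq hψ.1]
  have c1 : Continuous (fun z => fderiv ℝ φ z ((0 : E d), (1 : ℝ))) := 
    (hφ.1.continuous_fderiv (by simp)).clm_apply continuous_const
  have c2 : Continuous (fun z => fderiv ℝ ψ z ((0 : E d), (1 : ℝ))) := 
    (hψ.1.continuous_fderiv (by simp)).clm_apply continuous_const
  have c3 := hφ.1.continuous
  have c4 := hψ.1.continuous
  rw [setIntegral_eq_integral_of_forall_compl_eq_zero, setIntegral_eq_integral_of_forall_compl_eq_zero]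
  · refine integral_mul_fderiv_eq_neg_fderiv_mul_of_integrable ?_ ?_ ?_ ?_ ?_
    · exact (c1.mul c4).integrable_of_hasCompactSupport hψ.2.1.mul_left
    · exact (c3.mul c2).integrable_of_hasCompactSupport hφ.2.1.mul_right
    · exact (c3.mul c4).integrable_of_hasCompactSupport hψ.2.1.mul_left
    · exact fun z _ => hφ.1.differentiable (by simp) z
    · exact fun z _ => hψ.1.differentiable (by simp) z
  · intro z hz
    rw [image_eq_zero_of_notMem_tsupport fun hz' => hz (hψ.2.2 hz'), mul_zero]
  · intro z hz
    rw [image_eq_zero_of_notMem_tsupport fun hz' => hz (hφ.2.2 hz'), zero_mul]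

/-- A test function vanishes at both ends of the time interval, hence is trivially periodic. This
allows weak derivatives to be tested through Fourier series. -/
lemma hasModeDeriv_test (hΩo : IsOpen Ω) (hΩ : Bornology.IsBounded Ω) (hT : 0 < T)
    (hφ : IsTest Ω T φ) :
    HasModeDeriv Ω T ((hφ.isLateralTest.latSupp.memLp hΩ T 2).toLp φ)
      ((hφ.latSupp_timeDeriv.memLp hΩ T 2).toLp (timeDeriv φ)) := by
  refine hasModeDeriv_of_isTimePeriodic hΩo hΩ hT (fun ψ hψ => ?_) ⟨φ, MemLp.coeFn_toLp _, ?_⟩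
  · refine Eq.trans (integral_congr_ae ?_) ((integral_test_mul_timeDeriv hφ hψ).trans
      (congrArg Neg.neg (integral_congr_ae ?_)))
    · filter_upwards [(hφ.isLateralTest.latSupp.memLp hΩ T 2).coeFn_toLp] with z hz
      rw [hz]
    · filter_upwards [(hφ.latSupp_timeDeriv.memLp hΩ T 2).coeFn_toLp] with z hz
      rw [hz]
  · have h0 : ∀ x t, t ∉ Ioo 0 T → φ (x, t) = 0 := fun x t ht =>
      image_eq_zero_of_notMem_tsupport fun hz => ht (hφ.2.2 hz).2
    refine .of_forall fun x => ⟨?_, ?_⟩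
    · exact (hφ.1.continuous.comp (by fun_prop)).continuousOn
    · rw [h0 x 0 (by simp), h0 x T (by simp)]

/-- Functions that are differentiated mode by mode have a weak time derivative. -/
lemma HasModeDeriv.hasWeakTimeDeriv (hΩo : IsOpen Ω) (hΩ : Bornology.IsBounded Ω) (hT : 0 < T)
    {u w : L2Q Ω T} (h : HasModeDeriv Ω T u w) : HasWeakTimeDeriv Ω T u w := by
  intro φ hφ
  have hm := hasModeDeriv_test hΩo hΩ hT hφ
  have m1 := hφ.isLateralTest.latSupp
  have m2 := hφ.latSupp_timeDeriv
  have e1 := m1.inner_toLp hΩ w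
  have e2 := m2.inner_toLp hΩ u
  set Φ := (m1.memLp hΩ T 2).toLp φ
  set Ψ := (m2.memLp hΩ T 2).toLp (timeDeriv φ)
  have s1 : HasSum (fun k => inner ℝ u (modeP Ω T k Ψ)) (inner ℝ u Ψ) :=
    (hasSum_modeP hΩ hT Ψ).mapL (innerSL ℝ u)
  have s2 : HasSum (fun k => inner ℝ Φ (modeP Ω T k w)) (inner ℝ Φ w) :=
    (hasSum_modeP hΩ hT w).mapL (innerSL ℝ Φ)
  -- On each mode integration by parts is the skewness of `modeJ`.
  have h1 : ∀ k, inner ℝ u (modeP Ω T k Ψ) = -inner ℝ Φ (modeP Ω T k w) := fun k => by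
    have e := inner_modeJ_left (T := T) k Φ u
    rw [real_inner_comm] at e
    rw [hm k, h k, real_inner_smul_right, real_inner_smul_right, e]
    ring
  simp_rw [h1] at s1
  have h2 := s1.unique s2.neg
  rw [e2, real_inner_comm, e1] at h2
  simpa only [Real.inner_apply] using h2

/-- By Tonelli the sum of the series has a finite integral, so it is finite almost everywhere. -/
lemma ae_summable_of_summable_integral {X : Type*} [MeasurableSpace X] {μ : Measure X}
    {f : ℕ → X → ℝ} (hf : ∀ k, Integrable (f k) μ) (h0 : ∀ k x, 0 ≤ f k x)
    (hs : Summable fun k => ∫ x, f k x ∂μ) : ∀ᵐ x ∂μ, Summable fun k => f k x := by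
  have h1 : ∫⁻ x, ∑' k, ENNReal.ofReal (f k x) ∂μ ≠ ⊤ := by
    rw [lintegral_tsum fun k => (hf k).aestronglyMeasurable.aemeasurable.ennreal_ofReal]
    simp_rw [← ofReal_integral_eq_lintegral_ofReal (hf _) (.of_forall (h0 _))]
    exact hs.tsum_ofReal_ne_top
  have hm : AEMeasurable (fun x => ∑' k, ENNReal.ofReal (f k x)) μ :=
    AEMeasurable.tsum fun k => (hf k).aestronglyMeasurable.aemeasurable.ennreal_ofReal
  filter_upwards [ae_lt_top' hm h1] with x hx
  refine (ENNReal.summable_toReal hx.ne).congr fun k => ?_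
  rw [ENNReal.toReal_ofReal (h0 k x)]

lemma hasSum_norm_sq_modeP {F : Type*} [NormedAddCommGroup F] [InnerProductSpace ℝ F]
    [CompleteSpace F] [SecondCountableTopology F] (hΩ : Bornology.IsBounded Ω) (hT : 0 < T)
    (w : Lp F 2 (muQ Ω T)) : HasSum (fun k => ‖modeP Ω T k w‖ ^ 2) (‖w‖ ^ 2) := by
  have h := (hasSum_modeP hΩ hT w).mapL (innerSL ℝ w)
  simp only [innerSL_apply_apply, real_inner_self_eq_norm_sq] at h
  refine h.congr_fun fun k => ?_
  rw [← real_inner_self_eq_norm_sq, inner_modeP_comm, modeP_modeP_self hT]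

lemma HasModeDeriv.summable_sq (hΩ : Bornology.IsBounded Ω) (hT : 0 < T) {u w : L2Q Ω T} (h : HasModeDeriv Ω T u w) :
    Summable fun k : ℕ => (k * freq T) ^ 2 * ‖modeP Ω T k u‖ ^ 2 := by
  refine Summable.of_nonneg_of_le (fun k => by positivity) (fun k => ?_)
    (hasSum_norm_sq_modeP hΩ hT w).summable
  rcases eq_or_ne k 0 with rfl | hk
  · simp
  · rw [h k, norm_smul, norm_modeJ hT hk, mul_pow (‖_‖), Real.norm_eq_abs, sq_abs]

lemma norm_sq_eq_integral {X : Type*} [MeasurableSpace X] {μ : Measure X} (f : Lp ℝ 2 μ) :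
    ‖f‖ ^ 2 = ∫ x, f x ^ 2 ∂μ := by
  rw [← real_inner_self_eq_norm_sq, L2.inner_def]
  simp_rw [real_inner_self_eq_norm_sq, Real.norm_eq_abs, sq_abs]

lemma coeFn_modeP (u : L2Q Ω T) (k : ℕ) :
    modeP Ω T k u =ᵐ[muQ Ω T] fun z =>
      wt k * (cosk T k z.2 * cC Ω T k u z.1 + sink T k z.2 * cS Ω T k u z.1) := by
  filter_upwards [Lp.coeFn_smul (wt k) (eC Ω T k (cC Ω T k u) + eS Ω T k (cS Ω T k u)),
    Lp.coeFn_add (eC Ω T k (cC Ω T k u)) (eS Ω T k (cS Ω T k u)),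
    coeFn_tsyn (continuous_cosk T k) (cC Ω T k u),
    coeFn_tsyn (continuous_sink T k) (cS Ω T k u)] with z h1 h2 h3 h4
  rw [modeP_apply, h1, Pi.smul_apply, h2, Pi.add_apply, eC, eS, h3, h4]
  simp only [smul_eq_mul]

/-- Functions with a mode by mode time derivative are continuous and periodic in time. -/
lemma HasModeDeriv.isTimePeriodic (hΩ : Bornology.IsBounded Ω) (hT : 0 < T)
    {u w : L2Q Ω T} (h : HasModeDeriv Ω T u w) : IsTimePeriodic Ω T u := by
  have hω := freq_pos hT
  have hs0 : Summable fun k : ℕ => ∫ x, (k * freq T) ^ 2 *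
      (cC Ω T k u x ^ 2 + cS Ω T k u x ^ 2) ∂(muX Ω T) := by
    refine Summable.of_nonneg_of_le (fun k => integral_nonneg fun x => by positivity) (fun k => ?_)
      (h.summable_sq hΩ hT)
    rw [integral_const_mul, integral_add (Lp.memLp (cC Ω T k u)).integrable_sq
      (Lp.memLp (cS Ω T k u)).integrable_sq, ← norm_sq_eq_integral, ← norm_sq_eq_integral,
      norm_sq_modeP k u hT]
    refine mul_le_mul_of_nonneg_left (le_mul_of_one_le_left (by positivity) ?_) (by positivity)
    unfold wt; split_ifs <;> norm_num
  have hi : ∀ k : ℕ, Integrable (fun x => (k * freq T) ^ 2 *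
      (cC Ω T k u x ^ 2 + cS Ω T k u x ^ 2)) (muX Ω T) := fun k =>
    (((Lp.memLp (cC Ω T k u)).integrable_sq.add (Lp.memLp (cS Ω T k u)).integrable_sq)).const_mul _
  have hsum := (ae_muX_iff hT).1 (ae_summable_of_summable_integral hi (fun k x => by positivity) hs0)
  let B : E d → ℕ → ℝ := fun x k => wt k * (|cC Ω T k u x| + |cS Ω T k u x|)
  have hB : ∀ᵐ x ∂(volume.restrict Ω), Summable (B x) := by
    filter_upwards [hsum] with x hx
    -- Absolute convergence of the Fourier series of a slice: 2|c| ≤ (kω)² c² + (kω)⁻² for each of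
    -- the two coefficients. The weighted squares are summable for almost every x; the index is
    -- shifted to avoid k = 0.
    have hk2 : Summable fun k : ℕ => 2 * (1 / (k : ℝ) ^ 2) * (freq T)⁻¹ ^ 2:=
      ((Real.summable_one_div_nat_pow.2 one_lt_two).mul_left _).mul_right _
    refine (summable_nat_add_iff 1).1 (Summable.of_nonneg_of_le (fun k => ?_) (fun k => ?_)
      ((summable_nat_add_iff 1).2 (hx.add hk2)))
    · exact mul_nonneg (wt_pos _).le (by positivity)
    · have hm : (0 : ℝ) < ((k + 1 : ℕ) : ℝ) * freq T := by positivity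
      simp only [B, wt, Nat.add_eq_zero_iff, one_ne_zero, and_false, if_false]
      set m := ((k + 1 : ℕ) : ℝ) with hm'
      have key : ∀ c : ℝ, 2 * |c| ≤ (m * freq T) ^ 2 * c ^ 2 + 1 / m ^ 2 * (freq T)⁻¹ ^ 2 := by
        intro c
        have h1 := two_mul_le_add_sq (m * freq T * |c|) ((m * freq T)⁻¹)
        rw [mul_assoc 2, mul_right_comm (m * freq T), mul_inv_cancel₀ hm.ne', one_mul,
          mul_pow _ |c|, sq_abs] at h1
        refine h1.trans (le_of_eq ?_)
        rw [mul_inv, mul_pow _ (freq T)⁻¹, one_div, inv_pow]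
      linarith [key (cC Ω T (k + 1) u x), key (cS Ω T (k + 1) u x)]
  let f : E d × ℝ → ℕ → ℝ := fun z k =>
      wt k * (cosk T k z.2 * cC Ω T k u z.1 + sink T k z.2 * cS Ω T k u z.1)
  have hfB : ∀ z k, ‖f z k‖ ≤ B z.1 k := by
    intro z k
    rw [norm_mul, Real.norm_of_nonneg (wt_pos k).le]
    refine mul_le_mul_of_nonneg_left ((norm_add_le _ _).trans ?_) (wt_pos k).le
    rw [norm_mul, norm_mul]
    exact add_le_add (mul_le_of_le_one_left (abs_nonneg _) (Real.abs_cos_le_one _))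
      (mul_le_of_le_one_left (abs_nonneg _) (Real.abs_sin_le_one _))
  refine ⟨fun z => ∑' k, f z k, ?_, ?_⟩
  -- The pointwise sum agrees with u because a subsequence of the L²-convergent partial sums
  -- converges almost everywhere.
  · obtain ⟨ns, hns, hlim⟩ := (tendstoInMeasure_of_tendsto_Lp
      (hasSum_modeP hΩ hT u).tendsto_sum_nat).exists_seq_tendsto_ae
    have hall : ∀ᵐ z ∂(muQ Ω T), ∀ k, modeP Ω T k u z = f z k := ae_all_iff.2 fun k => coeFn_modeP u k
    have hall2 : ∀ᵐ z ∂(muQ Ω T), ∀ n, (∑ k ∈ Finset.range n, modeP Ω T k u : L2Q Ω T) z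
        = ∑ k ∈ Finset.range n, modeP Ω T k u z := by
      refine ae_all_iff.2 fun n => ?_
      filter_upwards [Lp.coeFn_finsetSum (Finset.range n) fun k => modeP Ω T k u] with z hz
      rw [hz]; simp
    filter_upwards [hlim, hall, hall2, ae_muQ_of_ae (T := T) hB] with z h1 h2 h3 h4
    have hsz : Summable (f z) := Summable.of_norm_bounded h4 (hfB z)
    refine tendsto_nhds_unique h1 ((hsz.hasSum.tendsto_sum_nat.comp hns.tendsto_atTop).congr
      fun n => ?_)
    simp only [Function.comp_apply, h3, h2]
  · filter_upwards [hB] with x hx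
    refine ⟨(continuous_tsum (fun k => ?_) hx fun k t => hfB (x, t) k).continuousOn, ?_⟩
    · have h1 := continuous_cosk T k
      have h2 := continuous_sink T k
      show Continuous fun t => wt k * (cosk T k t * cC Ω T k u x + sink T k t * cS Ω T k u x)
      fun_prop
    · refine tsum_congr fun k => ?_
      simp only [f]
      rw [cosk_T hT, sink_T hT]

/-- Half a derivative lies between none and one: kω ≤ (kω)² + 1. -/
lemma HasModeDeriv.memHalf (hΩ : Bornology.IsBounded Ω) (hT : 0 < T) {u w : L2Q Ω T}
    (h : HasModeDeriv Ω T u w) : MemHalf Ω T u := by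
  rw [memHalf_iff hΩ hT]
  have hω := freq_pos hT
  refine Summable.of_nonneg_of_le (fun k => by positivity) (fun k => ?_)
    ((h.summable_sq hΩ hT).add (hasSum_norm_sq_modeP hΩ hT u).summable)
  nlinarith [sq_nonneg ‖modeP Ω T k u‖, mul_nonneg (sq_nonneg ‖modeP Ω T k u‖)
    (sq_nonneg (k * freq T - 1)), mul_nonneg (sq_nonneg ‖modeP Ω T k u‖)
    (show 0 ≤ (k : ℝ) * freq T by positivity)]

lemma memH11ZeroPer_iff (hΩo : IsOpen Ω) (hΩ : Bornology.IsBounded Ω) (hT : 0 < T) (u : L2Q Ω T) :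
    MemH11ZeroPer Ω T u ↔ (u, grad u) ∈ H10 Ω T ∧ HasModeDeriv Ω T u (dt u) := by
  rw [MemH11ZeroPer, memH10Zero_iff hΩ]
  refine and_congr_right fun _ => ⟨fun h => ?_, fun h => ⟨⟨_, h.hasWeakTimeDeriv hΩo hΩ hT⟩,
    h.isTimePeriodic hΩ hT⟩⟩
  exact hasModeDeriv_of_isTimePeriodic hΩo hΩ hT (hasWeakTimeDeriv_dt h.1) h.2

end

/-! ### Coefficients, the energy space and the bilinear forms. -/

section
variable {d : ℕ} {Ω : Set (E d)} {T : ℝ} {σ ν : E d → ℝ} {σlo νlo CF : ℝ}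

/-- The standing assumptions on the domain and on the coefficients. -/
structure Coeffs (Ω : Set (E d)) (T : ℝ) (σ ν : E d → ℝ) (σlo νlo CF : ℝ) : Prop where
  isOpen : IsOpen Ω
  bdd : Bornology.IsBounded Ω
  T_pos : 0 < T
  memσ : MemLp σ ⊤ (muX Ω T)
  memν : MemLp ν ⊤ (muX Ω T)
  σlo_pos : 0 < σlo
  νlo_pos : 0 < νlo
  le_σ : ∀ᵐ z ∂(muQ Ω T), σlo ≤ σ z.1
  le_ν : ∀ᵐ z ∂(muQ Ω T), νlo ≤ ν z.1
  friedrichs : IsFriedrichsConst Ω CF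

section Spaces

lemma memH1half_iff (hΩ : Bornology.IsBounded Ω) (hT : 0 < T) (u : L2Q Ω T) :
    MemH1half Ω T u ↔ (u, grad u) ∈ H10 Ω T ∧
      Summable fun k : ℕ => k * freq T * ‖modeP Ω T k u‖ ^ 2 := by
  rw [MemH1half, memH10Zero_iff hΩ, memHalf_iff hΩ hT]

lemma memH1half_of_mem_H10 (hΩo : IsOpen Ω) (hΩ : Bornology.IsBounded Ω) (hT : 0 < T)
    {u : L2Q Ω T} {g : L2Qvec Ω T} (hp : (u, g) ∈ H10 Ω T)
    (hs : Summable fun k : ℕ => k * freq T * ‖modeP Ω T k u‖ ^ 2) :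
    MemH1half Ω T u ∧ grad u = g := by
  have h := grad_of_mem_H10 hΩo hΩ hp
  simp only at h
  rw [memH1half_iff hΩ hT, h]
  exact ⟨⟨hp, hs⟩, rfl⟩

lemma MemH1half.lin (hΩo : IsOpen Ω) (hΩ : Bornology.IsBounded Ω) (hT : 0 < T) {u v : L2Q Ω T}
    (hu : MemH1half Ω T u) (hv : MemH1half Ω T v) (a b : ℝ) :
    MemH1half Ω T (a • u + b • v) ∧ grad (a • u + b • v) = a • grad u + b • grad v := by
  rw [memH1half_iff hΩ hT] at hu hv
  refine memH1half_of_mem_H10 hΩo hΩ hT ((H10 Ω T).add_mem ((H10 Ω T).smul_mem a hu.1)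
    ((H10 Ω T).smul_mem b hv.1)) ?_
  have hω := freq_pos hT
  refine Summable.of_nonneg_of_le (fun k => by positivity) (fun k => ?_)
    ((hu.2.mul_left (2 * a ^ 2)).add (hv.2.mul_left (2 * b ^ 2)))
  have h1 : ‖modeP Ω T k (a • u + b • v)‖ ≤ |a| * ‖modeP Ω T k u‖ + |b| * ‖modeP Ω T k v‖ := by
    rw [map_add, map_smul, map_smul]
    refine (norm_add_le _ _).trans ?_
    rw [norm_smul, norm_smul]; rfl
  have h2 : ‖modeP Ω T k (a • u + b • v)‖ ^ 2
      ≤ 2 * a ^ 2 * ‖modeP Ω T k u‖ ^ 2 + 2 * b ^ 2 * ‖modeP Ω T k v‖ ^ 2 := by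
    refine (pow_le_pow_left₀ (norm_nonneg _) h1 2).trans ?_
    rw [← sq_abs a, ← sq_abs b]
    nlinarith [sq_nonneg (|a| * ‖modeP Ω T k u‖ - |b| * ‖modeP Ω T k v‖)]
  have h3 : (0 : ℝ) ≤ k * freq T := by positivity
  calc _ ≤ k * freq T * (2 * a ^ 2 * ‖modeP Ω T k u‖ ^ 2 + 2 * b ^ 2 * ‖modeP Ω T k v‖ ^ 2) :=
        mul_le_mul_of_nonneg_left h2 h3
    _ = _ := by ring

lemma MemH1half.sub (hΩo : IsOpen Ω) (hΩ : Bornology.IsBounded Ω) (hT : 0 < T) {u v : L2Q Ω T}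
    (hu : MemH1half Ω T u) (hv : MemH1half Ω T v) :
    MemH1half Ω T (u - v) ∧ grad (u - v) = grad u - grad v := by
  have h := hu.lin hΩo hΩ hT hv 1 (-1)
  simpa [sub_eq_add_neg] using h

end Spaces

section Forms

lemma gradForm_eq (hν : MemLp ν ⊤ (muX Ω T)) (y q : L2Q Ω T) :
    gradForm ν y q = inner ℝ (mulOp (muQ Ω T) (fun z => ν z.1) (grad y)) (grad q) := by
  rw [inner_mulOp_left (memLp_fst hν)]; rfl

/-- A skew operator that commutes with a multiplier. -/
lemma inner_mulOp_modeJ_self {F : Type*} [NormedAddCommGroup F] [InnerProductSpace ℝ F]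
    [CompleteSpace F] {m : E d → ℝ} (hm : MemLp m ⊤ (muX Ω T)) (k : ℕ) (u : Lp F 2 (muQ Ω T)) :
    inner ℝ (mulOp (muQ Ω T) (fun z => m z.1) u) (modeJ Ω T k u) = 0 := by
  have h1 := inner_modeJ_left k u (mulOp (muQ Ω T) (fun z => m z.1) u)
  rw [modeJ_mulOp hm, ← inner_mulOp_comm, real_inner_comm] at h1
  rw [inner_mulOp_comm]
  linarith

lemma inner_mulOp_modeJ_swap {m : E d → ℝ} (hm : MemLp m ⊤ (muX Ω T)) (k : ℕ) (y q : L2Q Ω T) :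
    inner ℝ (mulOp (muQ Ω T) (fun z => m z.1) (modeJ Ω T k y)) q
      = -inner ℝ (mulOp (muQ Ω T) (fun z => m z.1) (modeJ Ω T k q)) y := by
  rw [inner_mulOp_comm, inner_modeJ_left, modeJ_mulOp hm, real_inner_comm]

/-- The multiplier leaves the k-th mode invariant, so only the k-th mode of q is seen. -/
lemma inner_mulOp_modeJ (hT : 0 < T) {m : E d → ℝ} (hm : MemLp m ⊤ (muX Ω T)) (k : ℕ)
    (y q : L2Q Ω T) :
    inner ℝ (mulOp (muQ Ω T) (fun z => m z.1) (modeJ Ω T k y)) q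
      = inner ℝ (mulOp (muQ Ω T) (fun z => m z.1) (modeJ Ω T k y)) (modeP Ω T k q) := by
  rw [← inner_modeP_comm, modeP_mulOp hm, modeP_modeJ hT, if_pos rfl]

lemma halfForm_antisymm (hΩ : Bornology.IsBounded Ω) (hT : 0 < T) (hσ : MemLp σ ⊤ (muX Ω T))
    (y q : L2Q Ω T) : halfForm σ y q = -halfForm σ q y := by
  rw [halfForm_eq hΩ hT hσ, halfForm_eq hΩ hT hσ, ← tsum_neg]
  refine tsum_congr fun k => ?_
  rw [inner_mulOp_modeJ_swap hσ]; ring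

/-- Each term involves only the k-th modes of y and q, so it is dominated by the operator norm times
the terms of the two half norms. Convergence is what makes the form additive, as a divergent `tsum`
would be 0. -/
lemma summable_halfForm (hΩ : Bornology.IsBounded Ω) (hT : 0 < T) (hσ : MemLp σ ⊤ (muX Ω T))
    {y q : L2Q Ω T} (hy : MemH1half Ω T y) (hq : MemH1half Ω T q) :
    Summable fun k : ℕ =>
      k * freq T * inner ℝ (mulOp (muQ Ω T) (fun z => σ z.1) (modeJ Ω T k y)) q := by
  rw [memH1half_iff hΩ hT] at hy hq
  have hω := freq_pos hT
  set S := mulOp (F := ℝ) (muQ Ω T) (fun z => σ z.1)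
  refine Summable.of_norm_bounded ((hy.2.add hq.2).mul_left ‖S‖) fun k => ?_
  have h0 : (0 : ℝ) ≤ k * freq T := by positivity
  rw [norm_mul, Real.norm_of_nonneg h0, inner_mulOp_modeJ hT hσ, ← mul_add, mul_left_comm]
  refine mul_le_mul_of_nonneg_left ?_ h0
  refine (norm_inner_le_norm _ _).trans ?_
  have h1 : ‖S (modeJ Ω T k y)‖ ≤ ‖S‖ * ‖modeP Ω T k y‖ :=
    (S.le_opNorm _).trans (mul_le_mul_of_nonneg_left (norm_modeJ_le hT k y) (norm_nonneg _))
  refine (mul_le_mul_of_nonneg_right h1 (norm_nonneg _)).trans ?_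
  rw [mul_assoc]
  refine mul_le_mul_of_nonneg_left ?_ (norm_nonneg _)
  nlinarith [sq_nonneg (‖modeP Ω T k y‖ - ‖modeP Ω T k q‖), sq_nonneg ‖modeP Ω T k y‖,
    sq_nonneg ‖modeP Ω T k q‖]

lemma halfForm_lin (hΩ : Bornology.IsBounded Ω) (hT : 0 < T) (hσ : MemLp σ ⊤ (muX Ω T))
    {y y' q : L2Q Ω T} (hy : MemH1half Ω T y) (hy' : MemH1half Ω T y') (hq : MemH1half Ω T q)
    (a b : ℝ) :
    halfForm σ (a • y + b • y') q = a * halfForm σ y q + b * halfForm σ y' q := by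
  rw [halfForm_eq hΩ hT hσ, halfForm_eq hΩ hT hσ, halfForm_eq hΩ hT hσ, ← tsum_mul_left,
    ← tsum_mul_left, ← ((summable_halfForm hΩ hT hσ hy hq).mul_left a).tsum_add
      ((summable_halfForm hΩ hT hσ hy' hq).mul_left b)]
  refine tsum_congr fun k => ?_
  simp only [map_add, map_smul, inner_add_left, real_inner_smul_left]
  ring

lemma gradForm_lin (hΩo : IsOpen Ω) (hΩ : Bornology.IsBounded Ω) (hT : 0 < T)
    (hν : MemLp ν ⊤ (muX Ω T)) {y y' : L2Q Ω T} (q : L2Q Ω T) (hy : MemH1half Ω T y)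
    (hy' : MemH1half Ω T y') (a b : ℝ) :
    gradForm ν (a • y + b • y') q = a * gradForm ν y q + b * gradForm ν y' q := by
  rw [gradForm_eq hν, gradForm_eq hν, gradForm_eq hν, (hy.lin hΩo hΩ hT hy' a b).2]
  simp only [map_add, map_smul, inner_add_left, real_inner_smul_left]

lemma halfForm_of_hasModeDeriv (hΩ : Bornology.IsBounded Ω) (hT : 0 < T) (hσ : MemLp σ ⊤ (muX Ω T))
    {y w : L2Q Ω T} (h : HasModeDeriv Ω T y w) (q : L2Q Ω T) :
    halfForm σ y q = inner ℝ (mulOp (muQ Ω T) (fun z => σ z.1) w) q := by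
  rw [halfForm_eq hΩ hT hσ]
  have h1 := ((hasSum_modeP hΩ hT w).mapL (mulOp (muQ Ω T) (fun z => σ z.1))).mapL (innerSL ℝ q)
  simp only [innerSL_apply_apply] at h1
  rw [real_inner_comm, ← h1.tsum_eq]
  refine tsum_congr fun k => ?_
  rw [h k, map_smul, real_inner_smul_right, real_inner_comm]

end Forms

/-! ### The inf-sup estimate. -/

section APriori

/-- The test function `∑_{k<N} (u_k + s u_k^⊥)`. -/
def testOp {F : Type*} [NormedAddCommGroup F] [InnerProductSpace ℝ F] [CompleteSpace F]
    (s : ℝ) (N : ℕ) (u : Lp F 2 (muQ Ω T)) : Lp F 2 (muQ Ω T) :=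
  ∑ k ∈ Finset.range N, (modeP Ω T k u + s • modeJ Ω T k u)

lemma modeP_testOp (hT : 0 < T) {F : Type*} [NormedAddCommGroup F] [InnerProductSpace ℝ F]
    [CompleteSpace F] (s : ℝ) (N l : ℕ) (u : Lp F 2 (muQ Ω T)) :
    modeP Ω T l (testOp s N u)
      = if l ∈ Finset.range N then modeP Ω T l u + s • modeJ Ω T l u else 0 := by
  rw [testOp, map_sum, ← Finset.sum_ite_eq (Finset.range N) l
    (fun k => modeP Ω T k u + s • modeJ Ω T k u)]
  refine Finset.sum_congr rfl fun k _ => ?_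
  rw [map_add, map_smul, modeP_modeP hT, modeP_modeJ hT]
  split_ifs with h
  · subst h; rfl
  · simp

lemma testOp_mem (hΩo : IsOpen Ω) (hΩ : Bornology.IsBounded Ω) (hT : 0 < T) {u : L2Q Ω T}
    (hu : MemH1half Ω T u) (s : ℝ) (N : ℕ) :
    MemH1half Ω T (testOp s N u) ∧ grad (testOp s N u) = testOp s N (grad u) := by
  refine memH1half_of_mem_H10 hΩo hΩ hT ?_ ?_
  · have hp := ((memH1half_iff hΩ hT u).1 hu).1
    have : (testOp s N u, testOp s N (grad u)) = ∑ k ∈ Finset.range N,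
        ((modeP Ω T k u, modeP Ω T k (grad u)) + s • (modeJ Ω T k u, modeJ Ω T k (grad u))) := by
      rw [Prod.ext_iff, Prod.fst_sum, Prod.snd_sum]
      exact ⟨rfl, rfl⟩
    have h1 : ∀ k, (modeP Ω T k u, modeP Ω T k (grad u)) ∈ H10 Ω T := fun k =>
      modeP_mem_H10 (p := (u, grad u)) hΩ hT k hp
    have h2 : ∀ k, (modeJ Ω T k u, modeJ Ω T k (grad u)) ∈ H10 Ω T := fun k =>
      modeJ_mem_H10 (p := (u, grad u)) hΩ hT k hp
    rw [this]
    exact Submodule.sum_mem _ fun k _ => (H10 Ω T).add_mem (h1 k) ((H10 Ω T).smul_mem s (h2 k))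
  · refine summable_of_ne_finset_zero (s := Finset.range N) fun k hk => ?_
    rw [modeP_testOp hT, if_neg hk]; simp

/-- A mode and its rotation are orthogonal and the rotation does not increase the norm. The
resulting factor 2 is the origin of 1/√2 in `mu1`. -/
lemma norm_sq_testOp_le (hT : 0 < T) {F : Type*} [NormedAddCommGroup F] [InnerProductSpace ℝ F]
    [CompleteSpace F] {s : ℝ} (hs : s ^ 2 = 1) (N : ℕ) (u : Lp F 2 (muQ Ω T)) :
    ‖testOp s N u‖ ^ 2 ≤ 2 * ∑ k ∈ Finset.range N, ‖modeP Ω T k u‖ ^ 2 := by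
  rw [testOp, norm_sq_sum_modes hT, Finset.mul_sum]
  · refine Finset.sum_le_sum fun k _ => ?_
    have h1 : inner ℝ (modeP Ω T k u) (modeJ Ω T k u) = 0 := by
      have h2 := inner_modeJ_left k u u
      rw [real_inner_comm] at h2
      rw [inner_modeP_comm, modeP_modeJ hT, if_pos rfl]; linarith
    have h3 := pow_le_pow_left₀ (norm_nonneg _) (norm_modeJ_le hT k u) 2
    rw [norm_add_sq_real, real_inner_smul_right, h1, norm_smul, mul_pow, Real.norm_eq_abs, sq_abs, hs]
    linarith
  · intro k
    rw [map_add, map_smul, modeP_modeP_self hT, modeP_modeJ hT, if_pos rfl]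

lemma mu1_sq (νlo σlo : ℝ) : mu1 νlo σlo ^ 2 = min νlo σlo ^ 2 / 2 := by
  rw [mu1, mul_pow, div_pow, Real.sq_sqrt two_pos.le]; ring

lemma mu1_pos (hσ : 0 < σlo) (hν : 0 < νlo) : 0 < mu1 νlo σlo := by
  have := lt_min hν hσ
  unfold mu1; positivity

/-- The inf-sup estimate. -/
lemma Coeffs.mu1_sq_mul_semiSq_le (D : Coeffs Ω T σ ν σlo νlo CF) {s : ℝ} (hs : s ^ 2 = 1)
    {y : L2Q Ω T} (hy : MemH1half Ω T y) {M : ℝ}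
    (h : ∀ q, MemH1half Ω T q → gradForm ν y q + s * halfForm σ y q ≤ M * ‖grad q‖) :
    mu1 νlo σlo ^ 2 * semiSq y ≤ M ^ 2 := by
  have hT := D.T_pos
  have hω := freq_pos hT
  set g := grad y with hg
  set m := min νlo σlo with hm
  have hm0 : 0 < m := lt_min D.νlo_pos D.σlo_pos
  let S : ℕ → ℝ := fun N => ∑ k ∈ Finset.range N, (‖modeP Ω T k g‖ ^ 2 + k * freq T * ‖modeP Ω T k y‖ ^ 2)
  have hS : Tendsto S atTop (𝓝 (semiSq y)) := by
    rw [semiSq, halfNormSq_eq D.bdd hT]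
    exact ((hasSum_norm_sq_modeP D.bdd hT g).add
      ((memH1half_iff D.bdd hT y).1 hy).2.hasSum).tendsto_sum_nat
  -- Truncating at N modes makes the test function admissible with only finite sums; the bound is
  -- uniform in N.
  refine le_of_tendsto' (hS.const_mul _) fun N => ?_
  have hS0 : 0 ≤ S N := Finset.sum_nonneg fun k _ => by positivity
  obtain ⟨hq, hgq⟩ := testOp_mem D.isOpen D.bdd hT hy s N
  have h1 := h _ hq
  rw [hgq, gradForm_eq D.memν, hgq, halfForm_eq D.bdd hT D.memσ] at h1
  have e1 : inner ℝ (mulOp (muQ Ω T) (fun z => ν z.1) g) (testOp s N g)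
      = ∑ k ∈ Finset.range N,
        inner ℝ (mulOp (muQ Ω T) (fun z => ν z.1) (modeP Ω T k g)) (modeP Ω T k g) := by
    rw [testOp, inner_sum]
    refine Finset.sum_congr rfl fun k _ => ?_
    rw [inner_add_right, real_inner_smul_right, inner_mulOp_modeJ_self D.memν, mul_zero, add_zero,
      ← modeP_mulOp D.memν, inner_modeP_comm, modeP_modeP_self hT]
  -- Skewness leaves only the rotated part of the test function. Its factor s meets the factor s of
  -- the form, and s² = 1 makes the contribution positive for either sign.
  have e2 : ∑' k : ℕ, k * freq T *
        inner ℝ (mulOp (muQ Ω T) (fun z => σ z.1) (modeJ Ω T k y)) (testOp s N y)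
      = ∑ k ∈ Finset.range N, k * freq T *
        (s * inner ℝ (mulOp (muQ Ω T) (fun z => σ z.1) (modeJ Ω T k y)) (modeJ Ω T k y)) := by
    rw [tsum_eq_sum (s := Finset.range N) fun k hk => by
      rw [inner_mulOp_modeJ hT D.memσ, modeP_testOp hT, if_neg hk]; simp]
    refine Finset.sum_congr rfl fun k hk => ?_
    rw [inner_mulOp_modeJ hT D.memσ, modeP_testOp hT, if_pos hk, inner_add_right,
      ← inner_mulOp_modeJ hT D.memσ, real_inner_smul_right]
    have h3 := inner_mulOp_modeJ_swap D.memσ k y y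
    rw [show inner ℝ (mulOp (muQ Ω T) (fun z => σ z.1) (modeJ Ω T k y)) y = 0 by linarith, zero_add]
  have h2 : m * S N ≤ M * ‖testOp s N g‖ := by
    refine le_trans ?_ h1
    rw [e1, e2, Finset.mul_sum, Finset.mul_sum, ← Finset.sum_add_distrib]
    refine Finset.sum_le_sum fun k _ => ?_
    have a1 := le_inner_mulOp_self (memLp_fst D.memν) D.le_ν (modeP Ω T k g)
    have a2 := le_inner_mulOp_self (memLp_fst D.memσ) D.le_σ (modeJ Ω T k y)
    have a3 : m * ‖modeP Ω T k g‖ ^ 2 ≤ νlo * ‖modeP Ω T k g‖ ^ 2 :=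
      mul_le_mul_of_nonneg_right (min_le_left _ _) (sq_nonneg _)
    rcases eq_or_ne k 0 with rfl | hk
    · simp only [Nat.cast_zero, zero_mul, mul_zero, add_zero]; linarith
    rw [norm_modeJ hT hk] at a2
    have a4 : m * ‖modeP Ω T k y‖ ^ 2 ≤ σlo * ‖modeP Ω T k y‖ ^ 2 :=
      mul_le_mul_of_nonneg_right (min_le_right _ _) (sq_nonneg _)
    have a5 := mul_le_mul_of_nonneg_left (a4.trans a2) (show 0 ≤ (k : ℝ) * freq T by positivity)
    have a6 : s * (k * freq T * (s * inner ℝ (mulOp (muQ Ω T) (fun z => σ z.1) (modeJ Ω T k y))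
        (modeJ Ω T k y))) = s ^ 2 * (k * freq T * inner ℝ (mulOp (muQ Ω T) (fun z => σ z.1)
        (modeJ Ω T k y)) (modeJ Ω T k y)) := by ring
    rw [a6, hs]
    linarith
  have h3 : ‖testOp s N g‖ ^ 2 ≤ 2 * S N := by
    refine (norm_sq_testOp_le hT hs N g).trans ?_
    refine mul_le_mul_of_nonneg_left (Finset.sum_le_sum fun k _ => ?_) two_pos.le
    exact le_add_of_nonneg_right (by positivity)
  rw [mu1_sq]
  rcases hS0.eq_or_lt with h0 | h0
  · rw [← h0]; simp; positivity
  -- Squaring gives m² S² ≤ 2 M² S, and one factor S > 0 is cancelled.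
  have h4 : (m * S N) ^ 2 ≤ (M * ‖testOp s N g‖) ^ 2 :=
    pow_le_pow_left₀ (by positivity) h2 2
  have h5 : (m * S N) ^ 2 ≤ M ^ 2 * (2 * S N) := by
    rw [mul_pow M] at h4
    exact h4.trans (mul_le_mul_of_nonneg_left h3 (sq_nonneg M))
  have h6 : m ^ 2 / 2 * S N * (2 * S N) ≤ M ^ 2 * (2 * S N) := by
    refine le_trans (le_of_eq ?_) h5; ring
  exact le_of_mul_le_mul_right h6 (by positivity)

lemma Coeffs.norm_le (D : Coeffs Ω T σ ν σlo νlo CF) {y : L2Q Ω T} (hy : MemH1half Ω T y) :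
    ‖y‖ ≤ CF * ‖grad y‖ := by
  have h := ((memH1half_iff D.bdd D.T_pos y).1 hy).1
  exact norm_le_of_mem_H10 (p := (y, grad y)) D.bdd D.friedrichs h

lemma halfNormSq_nonneg (hΩ : Bornology.IsBounded Ω) (hT : 0 < T) (u : L2Q Ω T) :
    0 ≤ halfNormSq u := by
  rw [halfNormSq_eq hΩ hT]
  have := freq_pos hT
  exact tsum_nonneg fun k => by positivity

lemma norm_grad_sq_le_semiSq (hΩ : Bornology.IsBounded Ω) (hT : 0 < T) (u : L2Q Ω T) :
    ‖grad u‖ ^ 2 ≤ semiSq u :=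
  le_add_of_nonneg_right (halfNormSq_nonneg hΩ hT u)

lemma Coeffs.mu1_mul_norm_grad_le (D : Coeffs Ω T σ ν σlo νlo CF) {s : ℝ} (hs : s ^ 2 = 1)
    {y : L2Q Ω T} (hy : MemH1half Ω T y) {M : ℝ} (hM : 0 ≤ M)
    (h : ∀ q, MemH1half Ω T q → gradForm ν y q + s * halfForm σ y q ≤ M * ‖grad q‖) :
    mu1 νlo σlo * ‖grad y‖ ≤ M := by
  have h1 := D.mu1_sq_mul_semiSq_le hs hy h
  have h2 := mul_le_mul_of_nonneg_left (norm_grad_sq_le_semiSq D.bdd D.T_pos y)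
    (sq_nonneg (mu1 νlo σlo))
  rw [← mul_pow] at h2
  exact (sq_le_sq₀ (mul_nonneg (mu1_pos D.σlo_pos D.νlo_pos).le (norm_nonneg _)) hM).1 (h2.trans h1)

lemma Coeffs.eq_zero_of_form (D : Coeffs Ω T σ ν σlo νlo CF) {s : ℝ} (hs : s ^ 2 = 1)
    {y : L2Q Ω T} (hy : MemH1half Ω T y)
    (h : ∀ q, MemH1half Ω T q → gradForm ν y q + s * halfForm σ y q = 0) : y = 0 := by
  have h1 := D.mu1_mul_norm_grad_le hs hy le_rfl fun q hq => by rw [h q hq, zero_mul]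
  have h2 : ‖grad y‖ ≤ 0 := by
    by_contra hc
    exact absurd h1 (not_le.2 (mul_pos (mu1_pos D.σlo_pos D.νlo_pos) (not_le.1 hc)))
  have h3 := D.norm_le hy
  rw [le_antisymm h2 (norm_nonneg _), mul_zero] at h3
  exact norm_le_zero_iff.1 h3

end APriori
end

/-! ### Existence and extra regularity, by Lax–Milgram on each mode. -/

section
variable {d : ℕ} {Ω : Set (E d)} {T : ℝ} {σ ν : E d → ℝ} {σlo νlo CF : ℝ}

/-- A form of the Lax–Milgram theorem on a closed subspace of a product. -/
lemma exists_of_coercive {H K : Type*} [NormedAddCommGroup H] [InnerProductSpace ℝ H]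
    [CompleteSpace H] [NormedAddCommGroup K] [InnerProductSpace ℝ K] [CompleteSpace K]
    {V : Submodule ℝ (H × K)} (hV : IsClosed (V : Set (H × K))) (a : K →L[ℝ] K) (b : H →L[ℝ] H)
    {c : ℝ} (hc : 0 < c)
    (h : ∀ p ∈ V, c * (‖p.1‖ ^ 2 + ‖p.2‖ ^ 2) ≤ inner ℝ (a p.2) p.2 + inner ℝ (b p.1) p.1) (f : H) :
    ∃ p ∈ V, ∀ q ∈ V, inner ℝ (a p.2) q.2 + inner ℝ (b p.1) q.1 = inner ℝ f q.1 := by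
  -- The product carries the maximum norm; Lax–Milgram needs the equivalent Hilbert norm.
  let L : WithLp 2 (H × K) →L[ℝ] H × K := (WithLp.prodContinuousLinearEquiv 2 ℝ H K).toContinuousLinearMap
  let W : Submodule ℝ (WithLp 2 (H × K)) := V.comap L.toLinearMap
  have hW : IsClosed (W : Set (WithLp 2 (H × K))) := hV.preimage L.continuous
  have : CompleteSpace W := hW.completeSpace_coe
  let π₁ : W →L[ℝ] H := (ContinuousLinearMap.fst ℝ H K).comp (L.comp W.subtypeL)
  let π₂ : W →L[ℝ] K := (ContinuousLinearMap.snd ℝ H K).comp (L.comp W.subtypeL)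
  let B : W →L[ℝ] W →L[ℝ] ℝ :=
    (innerSL ℝ).bilinearComp (a.comp π₂) π₂ + (innerSL ℝ).bilinearComp (b.comp π₁) π₁
  have hB : IsCoercive B := by
    refine ⟨c, hc, fun w => ?_⟩
    have h1 := h _ w.2
    have h2 : ‖w‖ ^ 2 = ‖(w : WithLp 2 (H × K)).fst‖ ^ 2 + ‖(w : WithLp 2 (H × K)).snd‖ ^ 2 :=
      WithLp.prod_norm_sq_eq_of_L2 _
    rw [mul_assoc, ← sq, h2]
    exact h1
  let w : W := hB.continuousLinearEquivOfBilin.symm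
    ((InnerProductSpace.toDual ℝ W).symm ((innerSL ℝ f).comp π₁))
  refine ⟨L w, w.2, fun q hq => ?_⟩
  let q' : W := ⟨WithLp.toLp 2 q, hq⟩
  have h1 := hB.continuousLinearEquivOfBilin_apply w q'
  rw [ContinuousLinearEquiv.apply_symm_apply, InnerProductSpace.toDual_symm_apply] at h1
  exact h1.symm

section Existence

/-- The problem for one mode. -/
lemma Coeffs.exists_mode (D : Coeffs Ω T σ ν σlo νlo CF) {s : ℝ} (hs : s ^ 2 = 1) (f : L2Q Ω T)
    (k : ℕ) :
    ∃ (y : L2Q Ω T) (g : L2Qvec Ω T), (y, g) ∈ H10 Ω T ∧ modeP Ω T k y = y ∧ modeP Ω T k g = g ∧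
      νlo * ‖g‖ ≤ CF * ‖modeP Ω T k f‖ ∧ σlo * (k * freq T * ‖modeJ Ω T k y‖) ≤ ‖modeP Ω T k f‖ ∧
      ∀ p ∈ H10 Ω T, inner ℝ (mulOp (muQ Ω T) (fun z => ν z.1) g) p.2
        + s * inner ℝ (mulOp (muQ Ω T) (fun z => σ z.1) ((k * freq T) • modeJ Ω T k y)) p.1
          = inner ℝ (modeP Ω T k f) p.1 := by
  have hT := D.T_pos
  have hω := freq_pos hT
  have hkω : 0 ≤ (k : ℝ) * freq T := by positivity
  set Mν := mulOp (F := E d) (muQ Ω T) (fun z => ν z.1) with hMν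
  set Mσ := mulOp (F := ℝ) (muQ Ω T) (fun z => σ z.1) with hMσ
  have hskew : ∀ y : L2Q Ω T, inner ℝ (Mσ (modeJ Ω T k y)) y = 0 := fun y => by
    have h3 := inner_mulOp_modeJ_swap D.memσ k y y
    linarith
  -- The time term of a single mode is bounded and skew, so coercivity comes from the diffusion
  -- alone; Friedrichs' inequality gives ‖y‖² + ‖∇y‖² ≤ (C_F² + 1)‖∇y‖².
  have hc : 0 < νlo / (CF ^ 2 + 1) := div_pos D.νlo_pos (by positivity)
  obtain ⟨p, hp, h⟩ := exists_of_coercive (isClosed_H10 Ω T) Mν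
    ((s * (k * freq T)) • Mσ.comp (modeJ Ω T k)) hc (fun p hp => by
      have h1 := pow_le_pow_left₀ (norm_nonneg _) (norm_le_of_mem_H10 D.bdd D.friedrichs hp) 2
      have h2 := le_inner_mulOp_self (memLp_fst D.memν) D.le_ν p.2
      simp only [smul_apply, ContinuousLinearMap.comp_apply,
        real_inner_smul_left, hskew, mul_zero, add_zero]
      refine le_trans ?_ h2
      rw [div_mul_eq_mul_div, div_le_iff₀ (by positivity), mul_assoc]
      refine mul_le_mul_of_nonneg_left ?_ D.νlo_pos.le
      linarith) f
  -- Lax–Milgram is used on all of `H10`; projecting its solution to the k-th mode solves the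
  -- equation with the projected right-hand side.
  set y := modeP Ω T k p.1 with hy
  set g := modeP Ω T k p.2 with hg
  have hyg : (y, g) ∈ H10 Ω T := modeP_mem_H10 D.bdd hT k hp
  have hJ : modeJ Ω T k y = modeJ Ω T k p.1 := by rw [hy, modeJ_modeP hT, if_pos rfl]
  have hweak : ∀ q ∈ H10 Ω T, inner ℝ (Mν g) q.2
      + s * inner ℝ (Mσ ((k * freq T) • modeJ Ω T k y)) q.1 = inner ℝ (modeP Ω T k f) q.1 := by
    intro q hq
    have h1 := h _ (modeP_mem_H10 D.bdd hT k hq)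
    simp only [smul_apply, ContinuousLinearMap.comp_apply,
        real_inner_smul_left] at h1
    rw [← inner_mulOp_modeJ hT D.memσ, ← inner_modeP_comm, ← inner_modeP_comm,
      modeP_mulOp D.memν] at h1
    rw [hJ, map_smul, real_inner_smul_left, ← h1]
    ring
  refine ⟨y, g, hyg, modeP_modeP_self hT k _, modeP_modeP_self hT k _, ?_, ?_, hweak⟩
  -- Testing with y itself removes the time term and bounds the gradient.
  · have h1 := hweak _ hyg
    simp only [map_smul, real_inner_smul_left, hskew, mul_zero, add_zero] at h1
    have h2 := le_inner_mulOp_self (memLp_fst D.memν) D.le_ν g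
    have h3 := norm_le_of_mem_H10 (p := (y, g)) D.bdd D.friedrichs hyg
    have h4 := real_inner_le_norm (modeP Ω T k f) y
    have h5 := mul_le_mul_of_nonneg_left h3 (norm_nonneg (modeP Ω T k f))
    rcases (norm_nonneg g).eq_or_lt with h0 | h0
    · rw [← h0, mul_zero]; exact mul_nonneg D.friedrichs.1.le (norm_nonneg _)
    · refine le_of_mul_le_mul_right ?_ h0
      simp only at h5
      change νlo * ‖g‖ ^ 2 ≤ inner ℝ (Mν g) g at h2
      rw [h1] at h2
      nlinarith
  -- Testing with the rotation of y removes the diffusion term and bounds the time derivative.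
  · have h1 := hweak _ (modeJ_mem_H10 (p := (y, g)) D.bdd hT k hyg)
    simp only [map_smul, real_inner_smul_left] at h1
    rw [inner_mulOp_modeJ_self D.memν, zero_add] at h1
    have h2 := le_inner_mulOp_self (memLp_fst D.memσ) D.le_σ (modeJ Ω T k y)
    change _ ≤ inner ℝ (Mσ (modeJ Ω T k y)) (modeJ Ω T k y) at h2
    have h3 := abs_real_inner_le_norm (modeP Ω T k f) (modeJ Ω T k y)
    have habs : |s| = 1 := by rwa [← sq_eq_sq₀ (abs_nonneg s) zero_le_one, sq_abs, one_pow]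
    have h4 : k * freq T * inner ℝ (Mσ (modeJ Ω T k y)) (modeJ Ω T k y)
        ≤ ‖modeP Ω T k f‖ * ‖modeJ Ω T k y‖ := by
      refine le_trans ?_ h3
      rw [← h1, abs_mul, habs, one_mul]
      exact le_abs_self _
    have h5 := mul_le_mul_of_nonneg_left h2 hkω
    rcases (norm_nonneg (modeJ Ω T k y)).eq_or_lt with h0 | h0
    · rw [← h0]; simp
    · refine le_of_mul_le_mul_right ?_ h0
      refine le_trans (le_of_eq ?_) (h5.trans h4)
      ring

/-- The modes of f are square summable, so by the mode estimates and orthogonality the series of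
solutions, gradients and time derivatives all converge in L². Since w is in L², the equation may be
tested with all of `H10`, without a half derivative of the test function. -/
lemma Coeffs.exists_solution (D : Coeffs Ω T σ ν σlo νlo CF) {s : ℝ} (hs : s ^ 2 = 1)
    (f : L2Q Ω T) :
    ∃ (y w : L2Q Ω T) (g : L2Qvec Ω T), (y, g) ∈ H10 Ω T ∧ HasModeDeriv Ω T y w ∧
      ∀ p ∈ H10 Ω T, inner ℝ (mulOp (muQ Ω T) (fun z => ν z.1) g) p.2
        + s * inner ℝ (mulOp (muQ Ω T) (fun z => σ z.1) w) p.1 = inner ℝ f p.1 := by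
  have hT := D.T_pos
  have hω := freq_pos hT
  choose Y G hmem hY hG hGle hJle hweak using D.exists_mode hs f
  have hsum := (hasSum_norm_sq_modeP D.bdd hT f).summable
  have hGb : ∀ k, ‖G k‖ ≤ CF / νlo * ‖modeP Ω T k f‖ := fun k => by
    rw [div_mul_eq_mul_div, le_div_iff₀ D.νlo_pos, mul_comm]; exact hGle k
  have sG : Summable G := by
    refine summable_of_modes hT hG (Summable.of_nonneg_of_le (fun k => sq_nonneg _) (fun k => ?_)
      (hsum.mul_left ((CF / νlo) ^ 2)))
    rw [← mul_pow]; exact pow_le_pow_left₀ (norm_nonneg _) (hGb k) 2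
  have sY : Summable Y := by
    refine summable_of_modes hT hY (Summable.of_nonneg_of_le (fun k => sq_nonneg _) (fun k => ?_)
      (hsum.mul_left ((CF * (CF / νlo)) ^ 2)))
    rw [← mul_pow, mul_assoc]
    refine pow_le_pow_left₀ (norm_nonneg _) ?_ 2
    exact (norm_le_of_mem_H10 (p := (Y k, G k)) D.bdd D.friedrichs (hmem k)).trans
      (mul_le_mul_of_nonneg_left (hGb k) D.friedrichs.1.le)
  let W : ℕ → L2Q Ω T := fun k => (k * freq T) • modeJ Ω T k (Y k)
  have hW : ∀ k, modeP Ω T k (W k) = W k := fun k => by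
    simp only [W, map_smul, modeP_modeJ hT, if_true]
  have sW : Summable W := by
    refine summable_of_modes hT hW (Summable.of_nonneg_of_le (fun k => sq_nonneg _) (fun k => ?_)
      (hsum.mul_left (σlo⁻¹ ^ 2)))
    rw [← mul_pow]
    refine pow_le_pow_left₀ (norm_nonneg _) ?_ 2
    rw [norm_smul, Real.norm_of_nonneg (by positivity), inv_mul_eq_div, le_div_iff₀ D.σlo_pos, mul_comm]
    exact hJle k
  refine ⟨∑' k, Y k, ∑' k, W k, ∑' k, G k, ?_, ?_, ?_⟩
  · have h1 : HasSum (fun k => (Y k, G k)) (∑' k, Y k, ∑' k, G k) :=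
      sY.hasSum.prodMk sG.hasSum
    exact (isClosed_H10 Ω T).mem_of_tendsto h1 (.of_forall fun t => Submodule.sum_mem _ fun k _ => hmem k)
  · intro k
    rw [(modeP Ω T k).map_tsum sW, (modeJ Ω T k).map_tsum sY, tsum_eq_single k, tsum_eq_single k, hW k]
    · intro l hl
      rw [← hY l, modeJ_modeP hT, if_neg hl.symm]
    · intro l hl
      rw [← hW l, modeP_modeP hT, if_neg hl.symm]
  · intro p hp
    set Mν := mulOp (F := E d) (muQ Ω T) (fun z => ν z.1) with hMν
    set Mσ := mulOp (F := ℝ) (muQ Ω T) (fun z => σ z.1) with hMσ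
    have h1 := (sG.hasSum.mapL Mν).mapL (innerSL ℝ p.2)
    have h2 := ((sW.hasSum.mapL Mσ).mapL (innerSL ℝ p.1)).mul_left s
    have h3 := (hasSum_modeP D.bdd hT f).mapL (innerSL ℝ p.1)
    simp only [innerSL_apply_apply] at h1 h2 h3
    rw [real_inner_comm, real_inner_comm p.1, real_inner_comm p.1]
    refine (h1.add h2).unique ?_
    convert h3 using 2 with k
    have h4 := hweak k p hp
    rw [real_inner_comm, real_inner_comm p.1, real_inner_comm p.1] at h4
    exact h4

end Existence
end

/-! ### Weak solutions and the solution operators. -/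

section
variable {d : ℕ} {Ω : Set (E d)} {T : ℝ} {σ ν : E d → ℝ} {σlo νlo CF : ℝ}

lemma integral_mul_eq_inner (u v : L2Q Ω T) : ∫ z, u z * v z ∂(muQ Ω T) = inner ℝ u v := by
  rw [L2.inner_def]
  refine integral_congr_ae (.of_forall fun z => ?_)
  simp [mul_comm]

lemma gradForm_comm (ν : E d → ℝ) (y q : L2Q Ω T) : gradForm ν y q = gradForm ν q y := by
  simp only [gradForm, real_inner_comm]

lemma MemH11ZeroPer.memH1half (hΩo : IsOpen Ω) (hΩ : Bornology.IsBounded Ω) (hT : 0 < T)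
    {u : L2Q Ω T} (h : MemH11ZeroPer Ω T u) : MemH1half Ω T u :=
  ⟨h.1, ((memH11ZeroPer_iff hΩo hΩ hT u).1 h).2.memHalf hΩ hT⟩

/-- `y` solves `s σ ∂ₜy - ∇·(ν∇y) = f` weakly; `s = 1` is the state equation and `s = -1` the
adjoint equation. -/
def IsSol (σ ν : E d → ℝ) (s : ℝ) (f y : L2Q Ω T) : Prop :=
  MemH1half Ω T y ∧ ∀ q : L2Q Ω T, MemH1half Ω T q →
    gradForm ν y q + s * halfForm σ y q = inner ℝ f q

lemma isState_iff (σ ν : E d → ℝ) (y v : L2Q Ω T) : IsState σ ν y v ↔ IsSol σ ν 1 v y := by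
  simp only [IsState, IsSol, one_mul, integral_mul_eq_inner]

lemma Coeffs.isSol_lin (D : Coeffs Ω T σ ν σlo νlo CF) {s : ℝ} {f f' y y' : L2Q Ω T}
    (h : IsSol σ ν s f y) (h' : IsSol σ ν s f' y') (a b : ℝ) :
    IsSol σ ν s (a • f + b • f') (a • y + b • y') := by
  refine ⟨(h.1.lin D.isOpen D.bdd D.T_pos h'.1 a b).1, fun q hq => ?_⟩
  rw [gradForm_lin D.isOpen D.bdd D.T_pos D.memν q h.1 h'.1,
    halfForm_lin D.bdd D.T_pos D.memσ h.1 h'.1 hq, inner_add_left, real_inner_smul_left,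
    real_inner_smul_left, ← h.2 q hq, ← h'.2 q hq]
  ring

lemma Coeffs.isSol_unique (D : Coeffs Ω T σ ν σlo νlo CF) {s : ℝ} (hs : s ^ 2 = 1)
    {f y y' : L2Q Ω T} (h : IsSol σ ν s f y) (h' : IsSol σ ν s f y') : y = y' := by
  have h1 := D.isSol_lin h h' 1 (-1)
  have h2 : (1 : ℝ) • y + (-1 : ℝ) • y' = 0 := D.eq_zero_of_form hs h1.1 fun q hq => by
    rw [h1.2 q hq]; simp
  rwa [one_smul, neg_one_smul, ← sub_eq_add_neg, sub_eq_zero] at h2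

/-- Solutions exist, and they are more regular than required. -/
lemma Coeffs.exists_isSol (D : Coeffs Ω T σ ν σlo νlo CF) {s : ℝ} (hs : s ^ 2 = 1)
    (f : L2Q Ω T) :
    ∃ y, IsSol σ ν s f y ∧ MemH11ZeroPer Ω T y ∧
      HasWeakDiv Ω T (mulOp (muQ Ω T) (fun z => ν z.1) (grad y))
        (s • mulOp (muQ Ω T) (fun z => σ z.1) (dt y) - f) := by
  obtain ⟨y, w, g, hyg, hw, h⟩ := D.exists_solution hs f
  have hg : grad y = g := grad_of_mem_H10 (p := (y, g)) D.isOpen D.bdd hyg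
  have hdt : dt y = w := dt_eq D.isOpen D.bdd (hw.hasWeakTimeDeriv D.isOpen D.bdd D.T_pos)
  have hmem : MemH11ZeroPer Ω T y := by
    rw [memH11ZeroPer_iff D.isOpen D.bdd D.T_pos, hg, hdt]; exact ⟨hyg, hw⟩
  refine ⟨y, ⟨hmem.memH1half D.isOpen D.bdd D.T_pos, fun q hq => ?_⟩, hmem, fun φ hφ => ?_⟩
  · rw [gradForm_eq D.memν, halfForm_of_hasModeDeriv D.bdd D.T_pos D.memσ hw, hg]
    exact h (q, grad q) ((memH1half_iff D.bdd D.T_pos q).1 hq).1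
  · rw [hg, hdt]
    have m1 := hφ.isLateralTest.latSupp
    have m2 := hφ.isLateralTest.latSupp_spaceGrad
    have h1 := h ((m1.memLp D.bdd T 2).toLp φ, (m2.memLp D.bdd T 2).toLp _)
      (Submodule.le_topologicalClosure _ ⟨φ, hφ.isLateralTest,
        (m1.memLp D.bdd T 2).coeFn_toLp, (m2.memLp D.bdd T 2).coeFn_toLp⟩)
    have h2 := m2.inner_toLp D.bdd (mulOp (muQ Ω T) (fun z => ν z.1) g)
    have h3 := m1.inner_toLp D.bdd (s • mulOp (muQ Ω T) (fun z => σ z.1) w - f)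
    simp only [inner_sub_left, real_inner_smul_left] at h1 h3
    rw [← h2, eq_sub_of_add_eq h1]
    rw [← neg_inj, neg_neg, neg_sub, h3]
    refine integral_congr_ae (.of_forall fun z => ?_)
    simp [mul_comm]

/-- A weak solution coincides with the constructed one by uniqueness and inherits its regularity. -/
lemma Coeffs.isSol_regular (D : Coeffs Ω T σ ν σlo νlo CF) {s : ℝ} (hs : s ^ 2 = 1)
    {f y : L2Q Ω T} (h : IsSol σ ν s f y) :
    MemH11ZeroPer Ω T y ∧ HasWeakDiv Ω T (mulOp (muQ Ω T) (fun z => ν z.1) (grad y))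
        (s • mulOp (muQ Ω T) (fun z => σ z.1) (dt y) - f) := by
  obtain ⟨y', h1, h2⟩ := D.exists_isSol hs f
  rwa [D.isSol_unique hs h h1]

lemma Coeffs.inner_le (D : Coeffs Ω T σ ν σlo νlo CF) (f : L2Q Ω T) {q : L2Q Ω T}
    (hq : MemH1half Ω T q) : inner ℝ f q ≤ CF * ‖f‖ * ‖grad q‖ := by
  refine (real_inner_le_norm f q).trans ?_
  rw [mul_comm CF, mul_assoc]
  exact mul_le_mul_of_nonneg_left (D.norm_le hq) (norm_nonneg _)

lemma Coeffs.isSol_semiSq_le (D : Coeffs Ω T σ ν σlo νlo CF) {s : ℝ} (hs : s ^ 2 = 1)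
    {f y : L2Q Ω T} (h : IsSol σ ν s f y) :
    mu1 νlo σlo ^ 2 * semiSq y ≤ (CF * ‖f‖) ^ 2 :=
  D.mu1_sq_mul_semiSq_le hs h.1 fun q hq => by rw [h.2 q hq]; exact D.inner_le f hq

lemma Coeffs.isSol_norm_grad_le (D : Coeffs Ω T σ ν σlo νlo CF) {s : ℝ} (hs : s ^ 2 = 1)
    {f y : L2Q Ω T} (h : IsSol σ ν s f y) : mu1 νlo σlo * ‖grad y‖ ≤ CF * ‖f‖ :=
  D.mu1_mul_norm_grad_le hs h.1 (mul_nonneg D.friedrichs.1.le (norm_nonneg _)) fun q hq => by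
    rw [h.2 q hq]; exact D.inner_le f hq

/-- Uniqueness makes the chosen solutions linear in f; the inf-sup and Friedrichs inequalities make
them bounded. -/
lemma Coeffs.exists_solOp (D : Coeffs Ω T σ ν σlo νlo CF) {s : ℝ} (hs : s ^ 2 = 1) :
    ∃ S : L2Q Ω T →L[ℝ] L2Q Ω T, ∀ f, IsSol σ ν s f (S f) := by
  choose S hS using fun f => (D.exists_isSol hs f).imp fun _ h => h.1
  have hμ := mu1_pos D.σlo_pos D.νlo_pos
  let L : L2Q Ω T →ₗ[ℝ] L2Q Ω T :=
    { toFun := S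
      map_add' := fun f g => D.isSol_unique hs (hS _) (by
        simpa using D.isSol_lin (hS f) (hS g) 1 1)
      map_smul' := fun a f => D.isSol_unique hs (hS _) (by
        simpa using D.isSol_lin (hS f) (hS f) a 0) }
  refine ⟨L.mkContinuous (CF * (CF / mu1 νlo σlo)) fun f => ?_, hS⟩
  refine (D.norm_le (hS f).1).trans ?_
  rw [mul_assoc]
  refine mul_le_mul_of_nonneg_left ?_ D.friedrichs.1.le
  rw [div_mul_eq_mul_div, le_div_iff₀ hμ, mul_comm]
  exact D.isSol_norm_grad_le hs (hS f)

/-- The solution operators of the state and of the adjoint equation are adjoint. -/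
lemma Coeffs.inner_isSol (D : Coeffs Ω T σ ν σlo νlo CF) {f v y p : L2Q Ω T}
    (hy : IsSol σ ν 1 v y) (hp : IsSol σ ν (-1) f p) : inner ℝ f y = inner ℝ p v := by
  rw [← hp.2 y hy.1, real_inner_comm, ← hy.2 p hp.1, gradForm_comm,
    halfForm_antisymm D.bdd D.T_pos D.memσ]
  ring

lemma exists_apply_eq_of_coercive {H : Type*} [NormedAddCommGroup H] [InnerProductSpace ℝ H]
    [CompleteSpace H] (A : H →L[ℝ] H) {c : ℝ} (hc : 0 < c)
    (h : ∀ v, c * ‖v‖ ^ 2 ≤ inner ℝ (A v) v) (f : H) : ∃ v, A v = f := by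
  have hB : IsCoercive ((innerSL ℝ).comp A : H →L[ℝ] H →L[ℝ] ℝ) :=
    ⟨c, hc, fun v => by rw [mul_assoc, ← sq]; exact h v⟩
  refine ⟨hB.continuousLinearEquivOfBilin.symm f, ext_inner_right ℝ fun w => ?_⟩
  have h1 := hB.continuousLinearEquivOfBilin_apply (hB.continuousLinearEquivOfBilin.symm f) w
  rw [ContinuousLinearEquiv.apply_symm_apply] at h1
  exact h1.symm

/-! ### The optimal control and the optimality system. -/

section Control
variable {lam : ℝ} {yd : L2Q Ω T}

/-- Second order expansion of the cost functional. -/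
lemma Coeffs.cost_eq (D : Coeffs Ω T σ ν σlo νlo CF) {u v yu yv p : L2Q Ω T}
    (hu : IsSol σ ν 1 u yu) (hv : IsSol σ ν 1 v yv) (hp : IsSol σ ν (-1) (yu - yd) p) :
    cost lam yd yv v = cost lam yd yu u + inner ℝ (p + lam • u) (v - u)
      + 1 / 2 * ‖yv - yu‖ ^ 2 + lam / 2 * ‖v - u‖ ^ 2 := by
  have h1 := D.isSol_lin hv hu 1 (-1)
  simp only [one_smul, neg_one_smul, ← sub_eq_add_neg] at h1
  have h2 := D.inner_isSol h1 hp
  have e1 : yv - yd = (yu - yd) + (yv - yu) := by abel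
  have e2 : ‖v‖ ^ 2 = ‖u + (v - u)‖ ^ 2 := by rw [add_sub_cancel]
  rw [cost, cost, e1, e2, norm_add_sq_real, norm_add_sq_real, h2, inner_add_left,
    real_inner_smul_left]
  ring

lemma Coeffs.isOptimalPair_iff (D : Coeffs Ω T σ ν σlo νlo CF) (hlam : 0 < lam) {y u : L2Q Ω T} :
    IsOptimalPair σ ν lam yd y u ↔ IsSol σ ν 1 u y ∧ IsSol σ ν (-1) (y - yd) (-(lam • u)) := by
  simp only [IsOptimalPair, isState_iff]
  refine and_congr_right fun hy => ⟨fun h => ?_, fun hp yv v hv => ?_⟩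
  · obtain ⟨p, hp, -⟩ := D.exists_isSol (s := -1) (by norm_num) (y - yd)
    obtain ⟨S, hS⟩ := D.exists_solOp (s := 1) (by norm_num)
    suffices h0 : p + lam • u = 0 by rwa [← eq_neg_of_add_eq_zero_left h0]
    -- This is the gradient of the reduced cost; u is perturbed along -r.
    set r := p + lam • u with hr
    by_contra hne
    have hr0 : 0 < ‖r‖ ^ 2 := by have := norm_pos_iff.2 hne; positivity
    set c := 1 / 2 * ‖S r‖ ^ 2 + lam / 2 * ‖r‖ ^ 2 with hc
    have hc0 : 0 < c := by positivity
    have key : ∀ ε : ℝ, 0 ≤ -(ε * ‖r‖ ^ 2) + ε ^ 2 * c := fun ε => by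
      have hv : IsSol σ ν 1 (u - ε • r) (y - ε • S r) := by
        simpa [sub_eq_add_neg] using D.isSol_lin hy (hS r) 1 (-ε)
      have h1 := h _ _ hv
      rw [D.cost_eq hy hv hp, sub_sub_cancel_left, sub_sub_cancel_left, norm_neg, norm_neg,
        norm_smul, norm_smul, inner_neg_right, real_inner_smul_right, ← hr,
        real_inner_self_eq_norm_sq, mul_pow, mul_pow, Real.norm_eq_abs, sq_abs] at h1
      rw [hc]; linarith
    -- This ε minimizes the quadratic in `key`, and its value there is negative unless r = 0.
    have h1 := key (‖r‖ ^ 2 / (2 * c))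
    have h2 : -(‖r‖ ^ 2 / (2 * c) * ‖r‖ ^ 2) + (‖r‖ ^ 2 / (2 * c)) ^ 2 * c
        = -((‖r‖ ^ 2) ^ 2 / (4 * c)) := by field_simp; ring
    rw [h2] at h1
    have h3 : 0 < (‖r‖ ^ 2) ^ 2 / (4 * c) := by positivity
    linarith
  · rw [D.cost_eq hy hv hp, neg_add_cancel, inner_zero_left]
    have : 0 ≤ 1 / 2 * ‖yv - y‖ ^ 2 + lam / 2 * ‖v - u‖ ^ 2 := by positivity
    linarith

/-- The control solves the normal equation (S'S + λ)u = S' y_d, where S' solves the adjoint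
equation. It is coercive because ⟨S'Sv, v⟩ = ‖Sv‖². Uniqueness follows from the strict convexity
term in `Coeffs.cost_eq`. -/
lemma Coeffs.existsUnique_isOptimalPair (D : Coeffs Ω T σ ν σlo νlo CF) (hlam : 0 < lam) :
    ∃! w : L2Q Ω T × L2Q Ω T, IsOptimalPair σ ν lam yd w.1 w.2 := by
  obtain ⟨S, hS⟩ := D.exists_solOp (s := 1) (by norm_num)
  obtain ⟨S', hS'⟩ := D.exists_solOp (s := -1) (by norm_num)
  obtain ⟨u, hu⟩ := exists_apply_eq_of_coercive (S'.comp S + lam • ContinuousLinearMap.id ℝ _) hlam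
    (fun v => by
      have h := D.inner_isSol (hS v) (hS' (S v))
      simp only [add_apply, smul_apply, ContinuousLinearMap.comp_apply, ContinuousLinearMap.id_apply,
        inner_add_left, real_inner_smul_left]
      rw [← h, real_inner_self_eq_norm_sq, real_inner_self_eq_norm_sq]
      exact le_add_of_nonneg_left (sq_nonneg _)) (S' yd)
  have hu' : -(lam • u) = S' (S u - yd) := by
    simp only [add_apply, smul_apply, ContinuousLinearMap.comp_apply,
      ContinuousLinearMap.id_apply] at hu
    rw [map_sub, ← hu]; abel
  refine ⟨(S u, u), (D.isOptimalPair_iff hlam).2 ⟨hS u, hu' ▸ hS' _⟩, ?_⟩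
  rintro ⟨y, v⟩ hyv
  have hu0 : IsOptimalPair σ ν lam yd (S u) u := (D.isOptimalPair_iff hlam).2 ⟨hS u, hu' ▸ hS' _⟩
  have h1 := hyv.2 _ _ hu0.1
  have hyv' := (D.isOptimalPair_iff hlam).1 hyv
  have h2 := D.cost_eq (lam := lam) (hS u) hyv'.1 (hu' ▸ hS' (S u - yd))
  simp only [neg_add_cancel, inner_zero_left] at h2
  have h3 : lam / 2 * ‖v - u‖ ^ 2 ≤ 0 := by
    simp only at h1
    linarith [sq_nonneg ‖y - S u‖]
  have h4 : v = u := by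
    by_contra hne
    have := norm_pos_iff.2 (sub_ne_zero.2 hne)
    have : 0 < lam / 2 * ‖v - u‖ ^ 2 := by positivity
    linarith
  subst h4
  exact Prod.ext (D.isSol_unique (by norm_num) hyv'.1 (hS v)) rfl

lemma solvesKKT_iff (hlam : 0 < lam) {y u : L2Q Ω T} :
    SolvesKKT σ ν lam yd y (-(lam • u)) ↔
      IsSol σ ν 1 u y ∧ IsSol σ ν (-1) (y - yd) (-(lam • u)) := by
  have e : ∀ q : L2Q Ω T, lam⁻¹ * inner ℝ (-(lam • u)) q = -inner ℝ u q := fun q => by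
    rw [inner_neg_left, real_inner_smul_left]; field_simp
  simp only [SolvesKKT, IsSol, integral_mul_eq_inner, e, inner_sub_left]
  constructor
  · rintro ⟨h1, h2, h3, h4⟩
    exact ⟨⟨h1, fun q hq => by linarith [h4 q hq]⟩, h2, fun q hq => by linarith [h3 q hq]⟩
  · rintro ⟨⟨h1, h4⟩, h2, h3⟩
    exact ⟨h1, h2, fun q hq => by linarith [h3 q hq], fun q hq => by linarith [h4 q hq]⟩

end Control
end

section
variable {d : ℕ} {Ω : Set (E d)} {T : ℝ} {σ ν : E d → ℝ} {σlo νlo CF : ℝ}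

/-! ### Residuals control the deviation from the solution. -/

section Residuals

lemma normQ_eq_norm {F : Type*} [NormedAddCommGroup F] {f : E d × ℝ → F} {U : Lp F 2 (muQ Ω T)}
    (h : U =ᵐ[muQ Ω T] f) : normQ Ω T f = ‖U‖ := by
  rw [normQ, Lp.norm_def, eLpNorm_congr_ae h]

lemma R1_eq (hσ : MemLp σ ⊤ (muX Ω T)) (η : L2Q Ω T) (τ : L2Qvec Ω T) (v : L2Q Ω T) :
    R1 σ η τ v = ‖mulOp (muQ Ω T) (fun z => σ z.1) (dt η) - dvg τ - v‖ := by
  refine normQ_eq_norm ?_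
  filter_upwards [Lp.coeFn_sub (mulOp (muQ Ω T) (fun z => σ z.1) (dt η) - dvg τ) v,
    Lp.coeFn_sub (mulOp (muQ Ω T) (fun z => σ z.1) (dt η)) (dvg τ),
    coeFn_mulOp (memLp_fst hσ) (dt η)] with z h1 h2 h3
  rw [h1, Pi.sub_apply, h2, Pi.sub_apply, h3, smul_eq_mul]

lemma R2_eq (hν : MemLp ν ⊤ (muX Ω T)) (η : L2Q Ω T) (τ : L2Qvec Ω T) :
    R2 ν η τ = ‖τ - mulOp (muQ Ω T) (fun z => ν z.1) (grad η)‖ := by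
  refine normQ_eq_norm ?_
  filter_upwards [Lp.coeFn_sub τ (mulOp (muQ Ω T) (fun z => ν z.1) (grad η)),
    coeFn_mulOp (memLp_fst hν) (grad η)] with z h1 h2
  rw [h1, Pi.sub_apply, h2]

/-- Up to sign this is the residual of the adjoint equation, s = -1, with right-hand side η - y_d,
so the general residual estimates apply to it. -/
lemma R3_eq (hσ : MemLp σ ⊤ (muX Ω T)) (yd ζ : L2Q Ω T) (ρ : L2Qvec Ω T) (η : L2Q Ω T) :
    R3 σ yd ζ ρ η
      = ‖(-1 : ℝ) • mulOp (muQ Ω T) (fun z => σ z.1) (dt ζ) - dvg ρ - (η - yd)‖ := by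
  have e : ‖(-1 : ℝ) • mulOp (muQ Ω T) (fun z => σ z.1) (dt ζ) - dvg ρ - (η - yd)‖
      = ‖(η - yd + dvg ρ) + mulOp (muQ Ω T) (fun z => σ z.1) (dt ζ)‖ := by
    rw [← norm_neg, neg_one_smul]; congr 1; abel
  rw [e]
  refine normQ_eq_norm ?_
  filter_upwards [Lp.coeFn_add (η - yd + dvg ρ) (mulOp (muQ Ω T) (fun z => σ z.1) (dt ζ)),
    Lp.coeFn_add (η - yd) (dvg ρ), Lp.coeFn_sub η yd,
    coeFn_mulOp (memLp_fst hσ) (dt ζ)] with z h1 h2 h3 h4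
  rw [h1, Pi.add_apply, h2, Pi.add_apply, h3, Pi.sub_apply, h4, smul_eq_mul]

lemma mixedInt_eq (hσ : MemLp σ ⊤ (muX Ω T)) (hν : MemLp ν ⊤ (muX Ω T)) (lam : ℝ)
    (η ζ : L2Q Ω T) :
    mixedInt σ ν lam η ζ = gradForm ν η ζ
      + inner ℝ (mulOp (muQ Ω T) (fun z => σ z.1) (dt η)) ζ + lam⁻¹ * ‖ζ‖ ^ 2 := by
  rw [gradForm_eq hν, ← real_inner_self_eq_norm_sq, L2.inner_def, L2.inner_def, L2.inner_def,
    ← integral_const_mul, ← integral_add (L2.integrable_inner _ _) (L2.integrable_inner _ _),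
    ← integral_add ((L2.integrable_inner _ _).add (L2.integrable_inner _ _))
      ((L2.integrable_inner _ _).const_mul _)]
  refine integral_congr_ae ?_
  filter_upwards [coeFn_mulOp (memLp_fst hσ) (dt η), coeFn_mulOp (memLp_fst hν) (grad η)]
    with z h1 h2
  rw [h1, h2, real_inner_smul_left, real_inner_self_eq_norm_sq, Real.norm_eq_abs, sq_abs]
  simp [mul_comm]

/-- Insert the free flux τ and integrate it by parts against q. The residual functional splits into
the equation residual paired with q and the flux mismatch paired with ∇q; Friedrichs' inequality
converts the first pairing. -/
lemma Coeffs.residual_le (D : Coeffs Ω T σ ν σlo νlo CF) (s : ℝ) (f : L2Q Ω T) {η q : L2Q Ω T}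
    {τ : L2Qvec Ω T} (hη : MemH11ZeroPer Ω T η) (hτ : MemHdiv Ω T τ) (hq : MemH1half Ω T q) :
    |inner ℝ f q - gradForm ν η q - s * halfForm σ η q|
      ≤ (CF * ‖s • mulOp (muQ Ω T) (fun z => σ z.1) (dt η) - dvg τ - f‖
        + ‖τ - mulOp (muQ Ω T) (fun z => ν z.1) (grad η)‖) * ‖grad q‖ := by
  have h1 := ((memH11ZeroPer_iff D.isOpen D.bdd D.T_pos η).1 hη).2
  have hq' := ((memH1half_iff D.bdd D.T_pos q).1 hq).1
  have h2 := inner_grad_of_hasWeakDiv D.isOpen (hasWeakDiv_dvg hτ) hq'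
  simp only at h2
  rw [gradForm_eq D.memν, halfForm_of_hasModeDeriv D.bdd D.T_pos D.memσ h1]
  set r := s • mulOp (muQ Ω T) (fun z => σ z.1) (dt η) - dvg τ - f with hr
  set r' := τ - mulOp (muQ Ω T) (fun z => ν z.1) (grad η) with hr'
  have e : inner ℝ f q - inner ℝ (mulOp (muQ Ω T) (fun z => ν z.1) (grad η)) (grad q)
      - s * inner ℝ (mulOp (muQ Ω T) (fun z => σ z.1) (dt η)) q
      = inner ℝ r' (grad q) - inner ℝ r q := by
    rw [hr, hr']
    simp only [inner_sub_left, real_inner_smul_left]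
    rw [h2]; ring
  rw [e]
  have h3 := abs_real_inner_le_norm r' (grad q)
  have h4 := abs_real_inner_le_norm r q
  have h5 := mul_le_mul_of_nonneg_left (D.norm_le hq) (norm_nonneg r)
  have h6 := abs_sub (inner ℝ r' (grad q)) (inner ℝ r q)
  linarith

/-- The deviation of an approximation from the solution is controlled by the residuals. -/
lemma Coeffs.deviation_le (D : Coeffs Ω T σ ν σlo νlo CF) {s : ℝ} (hs : s ^ 2 = 1)
    {f y η : L2Q Ω T} {τ : L2Qvec Ω T} (hy : IsSol σ ν s f y) (hη : MemH11ZeroPer Ω T η)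
    (hτ : MemHdiv Ω T τ) :
    mu1 νlo σlo * ‖grad (y - η)‖
      ≤ CF * ‖s • mulOp (muQ Ω T) (fun z => σ z.1) (dt η) - dvg τ - f‖
        + ‖τ - mulOp (muQ Ω T) (fun z => ν z.1) (grad η)‖ := by
  have hη' := hη.memH1half D.isOpen D.bdd D.T_pos
  have hCF := D.friedrichs.1
  refine D.mu1_mul_norm_grad_le hs (hy.1.sub D.isOpen D.bdd D.T_pos hη').1 (by positivity)
    fun q hq => ?_
  have h1 := gradForm_lin D.isOpen D.bdd D.T_pos D.memν q hy.1 hη' 1 (-1)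
  have h2 := halfForm_lin D.bdd D.T_pos D.memσ hy.1 hη' hq 1 (-1)
  simp only [one_smul, neg_one_smul, ← sub_eq_add_neg] at h1 h2
  refine le_trans (le_of_eq ?_) ((le_abs_self _).trans (D.residual_le s f hη hτ hq))
  rw [h1, h2, ← hy.2 q hq]
  ring

end Residuals

/-! ### Majorant and minorant of the cost, and the error bound. -/

section Majorant
variable {lam : ℝ} {yd : L2Q Ω T}

/-- Two Young inequalities: α separates the data misfit a from the deviation C g, and β separates
the two residuals. -/
lemma half_sq_le_gam {μ C α β n a g r₁ r₂ : ℝ} (hμ : 0 < μ) (hC : 0 < C) (hα : 0 < α) (hβ : 0 < β)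
    (hn : 0 ≤ n) (hg : 0 ≤ g) (h1 : n ≤ a + C * g) (h2 : μ * g ≤ C * r₁ + r₂) :
    1 / 2 * n ^ 2 ≤ (1 + α) / 2 * a ^ 2 + gam μ C α β * (r₂ ^ 2 + C ^ 2 / β * r₁ ^ 2) := by
  have h3 : n ^ 2 ≤ (a + C * g) ^ 2 := pow_le_pow_left₀ hn h1 2
  have h4 : (a + C * g) ^ 2 ≤ (1 + α) * a ^ 2 + (1 + α) / α * (C * g) ^ 2 := by
    have : (1 + α) * a ^ 2 + (1 + α) / α * (C * g) ^ 2 - (a + C * g) ^ 2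
        = (α * a - C * g) ^ 2 / α := by field_simp; ring
    have h := div_nonneg (sq_nonneg (α * a - C * g)) hα.le
    linarith
  have h5 : (μ * g) ^ 2 ≤ (C * r₁ + r₂) ^ 2 := pow_le_pow_left₀ (by positivity) h2 2
  have h6 : (C * r₁ + r₂) ^ 2 ≤ (1 + β) * (r₂ ^ 2 + C ^ 2 / β * r₁ ^ 2) := by
    have : (1 + β) * (r₂ ^ 2 + C ^ 2 / β * r₁ ^ 2) - (C * r₁ + r₂) ^ 2
        = (β * r₂ - C * r₁) ^ 2 / β := by field_simp; ring
    have h := div_nonneg (sq_nonneg (β * r₂ - C * r₁)) hβ.le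
    linarith
  have h7 := mul_le_mul_of_nonneg_left (h5.trans h6)
    (show 0 ≤ (1 + α) * C ^ 2 / (2 * α * μ ^ 2) by positivity)
  have e1 : (1 + α) * C ^ 2 / (2 * α * μ ^ 2) * (μ * g) ^ 2 = 1 / 2 * ((1 + α) / α * (C * g) ^ 2) := by
    field_simp
  have e2 : (1 + α) * C ^ 2 / (2 * α * μ ^ 2) * ((1 + β) * (r₂ ^ 2 + C ^ 2 / β * r₁ ^ 2))
      = gam μ C α β * (r₂ ^ 2 + C ^ 2 / β * r₁ ^ 2) := by
    rw [gam]; ring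
  rw [e1, e2] at h7
  linarith

/-- `J^⊕` is a majorant of the cost functional. -/
lemma Coeffs.cost_le_Jplus (D : Coeffs Ω T σ ν σlo νlo CF) {α β : ℝ} (hα : 0 < α) (hβ : 0 < β)
    {v yv η : L2Q Ω T} {τ : L2Qvec Ω T} (hv : IsSol σ ν 1 v yv) (hη : MemH11ZeroPer Ω T η)
    (hτ : MemHdiv Ω T τ) :
    cost lam yd yv v ≤ Jplus σ ν (mu1 νlo σlo) lam CF yd α β η τ v := by
  have hη' := hη.memH1half D.isOpen D.bdd D.T_pos
  have h1 := D.deviation_le (by norm_num) hv hη hτ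
  rw [one_smul, ← R1_eq D.memσ, ← R2_eq D.memν] at h1
  have h2 := D.norm_le (hv.1.sub D.isOpen D.bdd D.T_pos hη').1
  have h3 : ‖yv - yd‖ ≤ ‖η - yd‖ + CF * ‖grad (yv - η)‖ := by
    have := norm_add_le (η - yd) (yv - η)
    rw [show η - yd + (yv - η) = yv - yd by abel] at this
    linarith
  have h4 := half_sq_le_gam (mu1_pos D.σlo_pos D.νlo_pos) D.friedrichs.1 hα hβ (norm_nonneg _)
    (norm_nonneg _) h3 h1
  rw [cost, Jplus]
  linarith

/-- `J^⊖` is a minorant of the optimal cost. -/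
lemma Coeffs.Jminus_le_cost (D : Coeffs Ω T σ ν σlo νlo CF) (hlam : 0 < lam)
    {u yu η ζ : L2Q Ω T} {τ ρ : L2Qvec Ω T} (hu : IsSol σ ν 1 u yu)
    (hη : MemH11ZeroPer Ω T η) (hζ : MemH11ZeroPer Ω T ζ) (hτ : MemHdiv Ω T τ)
    (hρ : MemHdiv Ω T ρ) :
    Jminus σ ν (mu1 νlo σlo) lam CF yd η ζ τ ρ ≤ cost lam yd yu u := by
  have hη' := hη.memH1half D.isOpen D.bdd D.T_pos
  have hζ' := hζ.memH1half D.isOpen D.bdd D.T_pos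
  have hμ := mu1_pos D.σlo_pos D.νlo_pos
  have hCF := D.friedrichs.1
  have hηm := ((memH11ZeroPer_iff D.isOpen D.bdd D.T_pos η).1 hη).2
  set μ := mu1 νlo σlo
  set e := yu - η with he
  have heH := (hu.1.sub D.isOpen D.bdd D.T_pos hη').1
  set A := CF * R3 σ yd ζ ρ η + R2 ν ζ ρ with hA
  set B := CF * R1 σ η τ (-(lam⁻¹ • ζ)) + R2 ν η τ with hB
  set δ := ‖u + lam⁻¹ • ζ‖ with hδ
  have hA0 : 0 ≤ A := by rw [hA, R3_eq D.memσ, R2_eq D.memν]; positivity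
  have h1 := D.residual_le (-1) (η - yd) hζ hρ heH
  rw [← R3_eq D.memσ, ← R2_eq D.memν] at h1
  have h2 := D.deviation_le (by norm_num) hu hη hτ
  rw [one_smul, ← R2_eq D.memν] at h2
  have h3 : ‖mulOp (muQ Ω T) (fun z => σ z.1) (dt η) - dvg τ - u‖
      ≤ R1 σ η τ (-(lam⁻¹ • ζ)) + δ := by
    rw [R1_eq D.memσ, hδ]
    refine le_trans (le_of_eq ?_) (norm_sub_le _ _)
    congr 1; abel
  have h4 : μ * ‖grad e‖ ≤ CF * δ + B := by
    have := mul_le_mul_of_nonneg_left h3 hCF.le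
    rw [hB]; linarith
  have h5 := hu.2 ζ hζ'
  have g1 := gradForm_lin D.isOpen D.bdd D.T_pos D.memν ζ hu.1 hη' 1 (-1)
  have g2 := halfForm_lin D.bdd D.T_pos D.memσ hu.1 hη' hζ' 1 (-1)
  simp only [one_smul, neg_one_smul, ← sub_eq_add_neg] at g1 g2
  -- The state equation tested with ζ replaces η by y(u) up to the error e. The forms in e combine
  -- with the linear term (η - y_d, e) of the cost into the adjoint residual at e, which `h1`
  -- bounds.
  have h6 : mixedInt σ ν lam η ζ = inner ℝ u ζ - gradForm ν ζ e + halfForm σ ζ e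
      + lam⁻¹ * ‖ζ‖ ^ 2 := by
    rw [mixedInt_eq D.memσ D.memν, ← halfForm_of_hasModeDeriv D.bdd D.T_pos D.memσ hηm,
      gradForm_comm ν ζ, halfForm_antisymm D.bdd D.T_pos D.memσ ζ, he, g1, g2, ← h5]
    ring
  have h7 : ‖yu - yd‖ ^ 2 = ‖η - yd‖ ^ 2 + 2 * inner ℝ (η - yd) e + ‖e‖ ^ 2 := by
    rw [← norm_add_sq_real, he]; congr 2; abel
  have h8 : δ ^ 2 = ‖u‖ ^ 2 + 2 * (lam⁻¹ * inner ℝ u ζ) + lam⁻¹ ^ 2 * ‖ζ‖ ^ 2 := by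
    rw [hδ, norm_add_sq_real, real_inner_smul_right, norm_smul, mul_pow, Real.norm_eq_abs, sq_abs]
  have h9 : lam / 2 * ‖u‖ ^ 2
      = lam / 2 * δ ^ 2 - inner ℝ u ζ - 1 / (2 * lam) * ‖ζ‖ ^ 2 := by
    rw [h8]; field_simp; ring
  have h10 : lam⁻¹ * ‖ζ‖ ^ 2 = 2 * (1 / (2 * lam) * ‖ζ‖ ^ 2) := by field_simp
  -- The unknown control enters only through δ, since replacing u by -λ⁻¹ζ in the residual costs at
  -- most δ.
  have h11 : A * ‖grad e‖ ≤ A * (CF * δ / μ) + 1 / μ * B * A := by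
    have : ‖grad e‖ ≤ (CF * δ + B) / μ := by rw [le_div_iff₀ hμ, mul_comm]; exact h4
    refine (mul_le_mul_of_nonneg_left this hA0).trans (le_of_eq ?_)
    field_simp
  -- Completing the square in δ uses half of the last term; the other half is slack.
  have h12 : 0 ≤ lam / 2 * δ ^ 2 - A * (CF * δ / μ) + CF ^ 2 / (μ ^ 2 * lam) * A ^ 2 := by
    have : lam / 2 * δ ^ 2 - A * (CF * δ / μ) + CF ^ 2 / (μ ^ 2 * lam) * A ^ 2
        = lam / 2 * (δ - CF * A / (μ * lam)) ^ 2 + CF ^ 2 * A ^ 2 / (2 * (μ ^ 2 * lam)) := by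
      field_simp; ring
    rw [this]; positivity
  have h13 := (neg_abs_le _).trans' (neg_le_neg h1)
  rw [cost, Jminus, h7, h9, h6, h10]
  nlinarith [sq_nonneg ‖e‖]

lemma M1plus_eq (μ lam : ℝ) (yd : L2Q Ω T) (α β : ℝ) (η ζ : L2Q Ω T) (τ ρ : L2Qvec Ω T)
    (v : L2Q Ω T) :
    M1plus σ ν μ lam CF yd α β η ζ τ ρ v
      = α / 2 * ‖η - yd‖ ^ 2
        + gam μ CF α β * (R2 ν η τ ^ 2 + CF ^ 2 / β * R1 σ η τ v ^ 2)
        + lam / 2 * ‖v‖ ^ 2 - 1 / (2 * lam) * ‖ζ‖ ^ 2 + mixedInt σ ν lam η ζ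
        + CF ^ 2 / (μ ^ 2 * lam) * (CF * R3 σ yd ζ ρ η + R2 ν ζ ρ) ^ 2
        + 1 / μ * (CF * R1 σ η τ (-(lam⁻¹ • ζ)) + R2 ν η τ) * (CF * R3 σ yd ζ ρ η + R2 ν ζ ρ)
        + 3 * lam / (4 * CF ^ 2) * (CF * R1 σ η τ v + R2 ν η τ) ^ 2 := by
  rw [M1plus, Jplus, Jminus]; ring

lemma Coeffs.errSq_le_M1plus (D : Coeffs Ω T σ ν σlo νlo CF) (hlam : 0 < lam)
    {u yu v yv : L2Q Ω T} (hopt : IsOptimalPair σ ν lam yd yu u) (hv : IsSol σ ν 1 v yv)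
    {α β : ℝ} (hα : 0 < α) (hβ : 0 < β) {η ζ : L2Q Ω T} {τ ρ : L2Qvec Ω T}
    (hη : MemH11ZeroPer Ω T η) (hζ : MemH11ZeroPer Ω T ζ) (hτ : MemHdiv Ω T τ)
    (hρ : MemHdiv Ω T ρ) :
    errSq (mu1 νlo σlo) lam CF yu yv ≤ M1plus σ ν (mu1 νlo σlo) lam CF yd α β η ζ τ ρ v := by
  obtain ⟨hu, hp⟩ := (D.isOptimalPair_iff hlam).1 hopt
  have hCF := D.friedrichs.1
  have h1 := D.cost_le_Jplus (lam := lam) (yd := yd) hα hβ hv hη hτ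
  have h2 := D.Jminus_le_cost (yd := yd) hlam hu hη hζ hτ hρ
  have h3 := D.cost_eq (lam := lam) hu hv hp
  rw [neg_add_cancel, inner_zero_left, norm_sub_rev yv, norm_sub_rev v] at h3
  have h4 := D.isSol_lin hu hv 1 (-1)
  simp only [one_smul, neg_one_smul, ← sub_eq_add_neg] at h4
  have h5 := D.isSol_semiSq_le (by norm_num) h4
  have h6 : lam * mu1 νlo σlo ^ 2 / (2 * CF ^ 2) * semiSq (yu - yv) ≤ lam / 2 * ‖u - v‖ ^ 2 := by
    have := mul_le_mul_of_nonneg_left h5 (show 0 ≤ lam / (2 * CF ^ 2) by positivity)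
    refine le_trans (le_of_eq (by ring)) (this.trans (le_of_eq ?_))
    field_simp
  -- The estimate already holds without this term of the majorant; only its sign matters.
  have h7 : 0 ≤ 3 * lam / (4 * CF ^ 2) * (CF * R1 σ η τ v + R2 ν η τ) ^ 2 := by positivity
  rw [errSq, M1plus]
  linarith

lemma Coeffs.errSq_nonneg (D : Coeffs Ω T σ ν σlo νlo CF) (hlam : 0 < lam) (μ : ℝ)
    (y y' : L2Q Ω T) : 0 ≤ errSq μ lam CF y y' := by
  have h := halfNormSq_nonneg D.bdd D.T_pos (y - y')
  have : 0 ≤ semiSq (y - y') := add_nonneg (sq_nonneg _) h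
  rw [errSq]; positivity

/-- The majorant at the optimal control, state, adjoint state and fluxes. -/
lemma Coeffs.M1plus_optimal (D : Coeffs Ω T σ ν σlo νlo CF) (hlam : 0 < lam)
    {u yu : L2Q Ω T} (hopt : IsOptimalPair σ ν lam yd yu u) (μ α β : ℝ) :
    M1plus σ ν μ lam CF yd α β yu (-(lam • u))
      (mulOp (muQ Ω T) (fun z => ν z.1) (grad yu))
      (mulOp (muQ Ω T) (fun z => ν z.1) (grad (-(lam • u)))) u = α / 2 * ‖yu - yd‖ ^ 2 := by
  obtain ⟨hu, hp⟩ := (D.isOptimalPair_iff hlam).1 hopt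
  obtain ⟨hyH, hyd⟩ := D.isSol_regular (by norm_num) hu
  obtain ⟨hpH, hpd⟩ := D.isSol_regular (by norm_num) hp
  have hmode := ((memH11ZeroPer_iff D.isOpen D.bdd D.T_pos yu).1 hyH).2
  have e0 : -(lam⁻¹ • -(lam • u)) = u := by
    rw [smul_neg, neg_neg, inv_smul_smul₀ hlam.ne']
  have e1 : R1 σ yu (mulOp (muQ Ω T) (fun z => ν z.1) (grad yu)) u = 0 := by
    rw [R1_eq D.memσ, dvg_eq D.isOpen D.bdd hyd, one_smul]; simp
  have e2 : ∀ y : L2Q Ω T, R2 ν y (mulOp (muQ Ω T) (fun z => ν z.1) (grad y)) = 0 := fun y => by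
    rw [R2_eq D.memν, sub_self, norm_zero]
  have e3 : R3 σ yd (-(lam • u)) (mulOp (muQ Ω T) (fun z => ν z.1) (grad (-(lam • u)))) yu = 0 := by
    rw [R3_eq D.memσ, dvg_eq D.isOpen D.bdd hpd, sub_sub_cancel, sub_self, norm_zero]
  have e4 : ‖-(lam • u)‖ ^ 2 = lam ^ 2 * ‖u‖ ^ 2 := by
    rw [norm_neg, norm_smul, mul_pow, Real.norm_eq_abs, sq_abs]
  -- The state equation tested with p gives (u, p) = -λ‖u‖², cancelled by λ⁻¹‖p‖². The terms
  -- (λ/2)‖u‖² and ‖p‖²/(2λ) likewise cancel in the end.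
  have e5 : mixedInt σ ν lam yu (-(lam • u)) = 0 := by
    have h := hu.2 _ hp.1
    rw [one_mul, inner_neg_right, real_inner_smul_right, real_inner_self_eq_norm_sq] at h
    rw [mixedInt_eq D.memσ D.memν, ← halfForm_of_hasModeDeriv D.bdd D.T_pos D.memσ hmode, h, e4]
    field_simp; ring
  rw [M1plus_eq, e0, e1, e2, e2, e3, e4, e5]
  field_simp; ring

end Majorant

lemma coeffs_of_bounds (hΩ : IsOpen Ω) (hΩb : Bornology.IsBounded Ω) (hT : 0 < T) {σhi νhi : ℝ}
    (hσm : AEMeasurable σ (volume.restrict Ω)) (hνm : AEMeasurable ν (volume.restrict Ω))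
    (hσlo : 0 < σlo) (hνlo : 0 < νlo)
    (hσ : ∀ x ∈ Ω, σlo ≤ σ x ∧ σ x ≤ σhi) (hν : ∀ x ∈ Ω, νlo ≤ ν x ∧ ν x ≤ νhi)
    (hCF : IsFriedrichsConst Ω CF) : Coeffs Ω T σ ν σlo νlo CF := by
  have hmem : ∀ {m : E d → ℝ} {lo hi : ℝ}, AEMeasurable m (volume.restrict Ω) → 0 < lo →
      (∀ x ∈ Ω, lo ≤ m x ∧ m x ≤ hi) → MemLp m ⊤ (muX Ω T) := fun {m lo hi} hm hlo hb => by
    rw [muX_eq]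
    refine MemLp.smul_measure ?_ ENNReal.ofReal_ne_top
    refine memLp_top_of_bound hm.aestronglyMeasurable hi ?_
    filter_upwards [ae_restrict_mem hΩ.measurableSet] with x hx
    rw [Real.norm_of_nonneg (hlo.le.trans (hb x hx).1)]
    exact (hb x hx).2
  have hQ : ∀ᵐ z ∂(muQ Ω T), z.1 ∈ Ω := by
    filter_upwards [ae_restrict_mem (hΩ.measurableSet.prod measurableSet_Ioo)] with z hz
    exact hz.1
  exact ⟨hΩ, hΩb, hT, hmem hσm hσlo hσ, hmem hνm hνlo hν, hσlo, hνlo,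
    hQ.mono fun z hz => (hσ _ hz).1, hQ.mono fun z hz => (hν _ hz).1, hCF⟩

end

end PeriodicOCP

end

theorem mainTheorem7 {d : ℕ} (Ω : Set (PeriodicOCP.E d)) (hΩ : IsOpen Ω)
    (hΩb : Bornology.IsBounded Ω) (T : ℝ) (hT : 0 < T)
    (σ ν : PeriodicOCP.E d → ℝ) (σlo σhi νlo νhi : ℝ)
    (hσm : AEMeasurable σ (volume.restrict Ω)) (hνm : AEMeasurable ν (volume.restrict Ω))
    (hσlo : 0 < σlo) (hνlo : 0 < νlo)
    (hσ : ∀ x ∈ Ω, σlo ≤ σ x ∧ σ x ≤ σhi) (hν : ∀ x ∈ Ω, νlo ≤ ν x ∧ ν x ≤ νhi)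
    (lam : ℝ) (hlam : 0 < lam) (CF : ℝ) (hCF : PeriodicOCP.IsFriedrichsConst Ω CF)
    (yd : PeriodicOCP.L2Q Ω T) :
    -- every control has exactly one state
    (∀ v : PeriodicOCP.L2Q Ω T, ∃! y : PeriodicOCP.L2Q Ω T, PeriodicOCP.IsState σ ν y v) ∧
    -- there is exactly one optimal control, with its state
    (∃! w : PeriodicOCP.L2Q Ω T × PeriodicOCP.L2Q Ω T,
      PeriodicOCP.IsOptimalPair σ ν lam yd w.1 w.2) ∧
    -- minimizing is equivalent to solving the optimality system, where `p = -λ u`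
    (∀ y u : PeriodicOCP.L2Q Ω T, PeriodicOCP.IsOptimalPair σ ν lam yd y u ↔
      PeriodicOCP.SolvesKKT σ ν lam yd y (-(lam • u))) ∧
    ∀ yu u : PeriodicOCP.L2Q Ω T, PeriodicOCP.IsOptimalPair σ ν lam yd yu u →
      -- the majorant bounds the error of every control `v`
      (∀ v yv : PeriodicOCP.L2Q Ω T, PeriodicOCP.IsState σ ν yv v →
        ∀ α β : ℝ, 0 < α → 0 < β →
        ∀ η ζ : PeriodicOCP.L2Q Ω T, PeriodicOCP.MemH11ZeroPer Ω T η →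
          PeriodicOCP.MemH11ZeroPer Ω T ζ →
        ∀ τ ρ : PeriodicOCP.L2Qvec Ω T, PeriodicOCP.MemHdiv Ω T τ → PeriodicOCP.MemHdiv Ω T ρ →
          PeriodicOCP.errSq (PeriodicOCP.mu1 νlo σlo) lam CF yu yv
            ≤ PeriodicOCP.M1plus σ ν (PeriodicOCP.mu1 νlo σlo) lam CF yd α β η ζ τ ρ v ∧
          -- the expanded form of the majorant
          PeriodicOCP.M1plus σ ν (PeriodicOCP.mu1 νlo σlo) lam CF yd α β η ζ τ ρ v
            = α / 2 * ‖η - yd‖ ^ 2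
              + PeriodicOCP.gam (PeriodicOCP.mu1 νlo σlo) CF α β *
                (PeriodicOCP.R2 ν η τ ^ 2 + CF ^ 2 / β * PeriodicOCP.R1 σ η τ v ^ 2)
              + lam / 2 * ‖v‖ ^ 2 - 1 / (2 * lam) * ‖ζ‖ ^ 2
              + PeriodicOCP.mixedInt σ ν lam η ζ
              + CF ^ 2 / (PeriodicOCP.mu1 νlo σlo ^ 2 * lam) *
                (CF * PeriodicOCP.R3 σ yd ζ ρ η + PeriodicOCP.R2 ν ζ ρ) ^ 2
              + 1 / PeriodicOCP.mu1 νlo σlo *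
                (CF * PeriodicOCP.R1 σ η τ (-(lam⁻¹ • ζ)) + PeriodicOCP.R2 ν η τ) *
                (CF * PeriodicOCP.R3 σ yd ζ ρ η + PeriodicOCP.R2 ν ζ ρ)
              + 3 * lam / (4 * CF ^ 2) *
                (CF * PeriodicOCP.R1 σ η τ v + PeriodicOCP.R2 ν η τ) ^ 2) ∧
      -- the infimum of the majorant over all its arguments is zero
      IsGLB {m : ℝ | ∃ (α β : ℝ) (η ζ : PeriodicOCP.L2Q Ω T) (τ ρ : PeriodicOCP.L2Qvec Ω T)
          (v : PeriodicOCP.L2Q Ω T), 0 < α ∧ 0 < β ∧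
          PeriodicOCP.MemH11ZeroPer Ω T η ∧ PeriodicOCP.MemH11ZeroPer Ω T ζ ∧
          PeriodicOCP.MemHdiv Ω T τ ∧ PeriodicOCP.MemHdiv Ω T ρ ∧
          m = PeriodicOCP.M1plus σ ν (PeriodicOCP.mu1 νlo σlo) lam CF yd α β η ζ τ ρ v} 0 ∧
      -- it is reached at the optimal control, state, adjoint state and fluxes as `α → 0`
      PeriodicOCP.MemH11ZeroPer Ω T yu ∧ PeriodicOCP.MemH11ZeroPer Ω T (-(lam • u)) ∧
      ∃ τ ρ : PeriodicOCP.L2Qvec Ω T,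
        (∀ᵐ z ∂(PeriodicOCP.muQ Ω T), τ z = ν z.1 • PeriodicOCP.grad yu z) ∧
        (∀ᵐ z ∂(PeriodicOCP.muQ Ω T), ρ z = ν z.1 • PeriodicOCP.grad (-(lam • u)) z) ∧
        PeriodicOCP.MemHdiv Ω T τ ∧ PeriodicOCP.MemHdiv Ω T ρ ∧
        ∀ β : ℝ, 0 < β →
          (∀ α : ℝ, 0 < α →
            PeriodicOCP.M1plus σ ν (PeriodicOCP.mu1 νlo σlo) lam CF yd α β
              yu (-(lam • u)) τ ρ u = α / 2 * ‖yu - yd‖ ^ 2) ∧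
          Tendsto (fun α : ℝ => PeriodicOCP.M1plus σ ν (PeriodicOCP.mu1 νlo σlo) lam CF yd α β
            yu (-(lam • u)) τ ρ u) (𝓝[>] 0) (𝓝 0) := by
  have D : PeriodicOCP.Coeffs Ω T σ ν σlo νlo CF :=
    PeriodicOCP.coeffs_of_bounds hΩ hΩb hT hσm hνm hσlo hνlo hσ hν hCF
  refine ⟨fun v => ?_, D.existsUnique_isOptimalPair hlam, fun y u => ?_, fun yu u hopt => ?_⟩
  · simp only [PeriodicOCP.isState_iff]
    obtain ⟨y, hy, -⟩ := D.exists_isSol (s := 1) (by norm_num) v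
    exact ⟨y, hy, fun y' hy' => D.isSol_unique (by norm_num) hy' hy⟩
  · rw [D.isOptimalPair_iff hlam, PeriodicOCP.solvesKKT_iff hlam]
  obtain ⟨hu, hp⟩ := (D.isOptimalPair_iff hlam).1 hopt
  obtain ⟨hyH, hyd⟩ := D.isSol_regular (by norm_num) hu
  obtain ⟨hpH, hpd⟩ := D.isSol_regular (by norm_num) hp
  have heq := D.M1plus_optimal hlam hopt (PeriodicOCP.mu1 νlo σlo)
  have hlim : Tendsto (fun α : ℝ => α / 2 * ‖yu - yd‖ ^ 2) (𝓝[>] 0) (𝓝 0) := by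
    have h : Tendsto (fun α : ℝ => α / 2 * ‖yu - yd‖ ^ 2) (𝓝 0) (𝓝 (0 / 2 * ‖yu - yd‖ ^ 2)) :=
      (by fun_prop : Continuous fun α : ℝ => α / 2 * ‖yu - yd‖ ^ 2).tendsto 0
    rw [zero_div, zero_mul] at h
    exact h.mono_left nhdsWithin_le_nhds
  refine ⟨fun v yv hv α β hα hβ η ζ hη hζ τ ρ hτ hρ => ⟨?_, PeriodicOCP.M1plus_eq ..⟩, ⟨?_, ?_⟩,
    hyH, hpH, _, _, PeriodicOCP.coeFn_mulOp (PeriodicOCP.memLp_fst D.memν) _,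
    PeriodicOCP.coeFn_mulOp (PeriodicOCP.memLp_fst D.memν) _, ⟨_, hyd⟩, ⟨_, hpd⟩,
    fun β _ => ⟨fun α _ => heq α β, ?_⟩⟩
  · exact D.errSq_le_M1plus hlam hopt ((PeriodicOCP.isState_iff ..).1 hv) hα hβ hη hζ hτ hρ
  · rintro _ ⟨α, β, η, ζ, τ, ρ, v, hα, hβ, hη, hζ, hτ, hρ, rfl⟩
    obtain ⟨yv, hv, -⟩ := D.exists_isSol (s := 1) (by norm_num) v
    exact (D.errSq_nonneg hlam _ yu yv).trans
      (D.errSq_le_M1plus hlam hopt hv hα hβ hη hζ hτ hρ)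
  · intro b hb
    refine ge_of_tendsto hlim ?_
    filter_upwards [self_mem_nhdsWithin] with α hα
    -- The value of β is irrelevant, since the residuals it weights are zero.
    exact hb ⟨α, 1, _, _, _, _, _, hα, one_pos, hyH, hpH, ⟨_, hyd⟩, ⟨_, hpd⟩, (heq α 1).symm⟩
  · simpa only [heq] using hlim
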